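/- **Setting.** Let $\mathcal G$ be an acyclic directed mixed graph on finitely many observed variables $O$, with a binary treatment $A$, a treatment level $a_0\in\{0,1\}$, $a_1=1-a_0$, and a real outcome $Y$. Fix a topological order in which $A$ comes after all its non-descendants and $Y\ne A$ is last. Assume that $A$ is primal fixable: no child of $A$ lies in the district of $A$ (the set of vertices joined to $A$ by bidirected paths). Let $\mathcal L$ be the set of vertices of the district of $A$ that do not precede $A$ (so $A\in\mathcal L$), $\mathcal M$ the other vertices that come after $A$, and $\mathscr Z=(\mathcal M\cup\mathcal L)\setminus\{A,Y\}=\{Z_1\prec\dots\prec Z_K\}$ (possibly empty), $Z_{K+1}=Y$. For $V\in\mathscr Z\cup\{Y\}$ put $a_V=a_1$ if $V\in\mathcal L$ and $a_V=a_0$ if $V\in\mathcal M$. The Markov pillow $\mathrm{mp}(V)$ consists of the district of $V$ and the parents of that district in the subgraph on $V$ and its predecessors, without $V$; $\mathrm{mp}^{-A}(V)=\mathrm{mp}(V)\setminus\{A\}$. The law $P$ of $O$ satisfies $P(O)=\prod_V P(V\mid \mathrm{mp}(V))$ (each variable is independent of its other predecessors given its Markov pillow). **Nuisances and parameter.** Let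 $Q=(\mu,\pi,(f_{Z})_{Z\in\mathscr Z})$ with $\mu=E[Y\mid\mathrm{mp}(Y)]$, $\pi(a\mid\mathrm{mp}(A))=P(A=a\mid \mathrm{mp}(A))$ and $f_Z(\cdot\mid\mathrm{mp}(Z))$ the conditional density of $Z$ with respect to a $\sigma$-finite measure. Put $$\mathscr B_Y=\mu(\mathrm{mp}^{-A}(Y),a_Y),\qquad \mathscr B_{Z_k}=\int \mathscr B_{Z_{k+1}}\, f_{Z_k}(z_k\mid \mathrm{mp}^{-A}(Z_k),a_{Z_k})\,dz_k ,$$ where $\mathscr B_{Z_1}$ means $\mathscr B_Y$ if $\mathscr Z=\emptyset$, $$f^r_Z=\frac{f_Z(Z\mid\mathrm{mp}^{-A}(Z),a_Z)}{f_Z(Z\mid\mathrm{mp}^{-A}(Z),1-a_Z)},\qquad f^r_A=\frac{\pi(a_1\mid\mathrm{mp}(A))}{\pi(a_0\mid\mathrm{mp}(A))},$$ $\mathscr R_V=\prod_{M\in\mathcal M,\,M\prec V}f^r_M$ if $V\in\mathcal L$, and $\mathscr R_V=f^r_A\prod_{L\in\mathcal L\setminus A,\,L\prec V}f^r_L$ if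 $V\in\mathcal M$. The parameter is $$\psi_{a_0}(Q)=E[\pi(a_1\mid\mathrm{mp}(A))\,\mathscr B_{Z_1}]+E[\mathbb I(A=a_0)Y],$$ and $$\begin{aligned}\Phi_{a_0}(Q)={}&\mathbb I(A=a_Y)\mathscr R_Y\{Y-\mu(\mathrm{mp}^{-A}(Y),a_Y)\}+\sum_{k=1}^K\mathbb I(A=a_{Z_k})\mathscr R_{Z_k}\{\mathscr B_{Z_{k+1}}-\mathscr B_{Z_k}\}\\&+\{\mathbb I(A=a_1)-\pi(a_1\mid\mathrm{mp}(A))\}\mathscr B_{Z_1}+\pi(a_1\mid\mathrm{mp}(A))\mathscr B_{Z_1}+\mathbb I(A=a_0)Y-\psi_{a_0}(Q).\end{aligned}$$ **Estimators.** Let $O_1,O_2,\dots$ be i.i.d. from $P$ and $P_ng=\frac1n\sum_{j\le n}g(O_j)$. For nuisance estimates $\hat Q=(\hat\mu,\hat\pi,(\hat f_Z)_{Z\in\mathscr Z})$ (with $\hat\pi$ a propensity score and each $\hat f_Z$ a conditional density), $\hat{\mathscr B}$, $\hat{\mathscr R}$ and $\Phi_{a_0}(\hat Q)$ are computed from $\hat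 Q$ by the same formulas, with $\psi_{a_0}(\hat Q)$ replaced by the plug-in estimate $P_n[\hat\pi(a_1\mid\mathrm{mp}(A))\hat{\mathscr B}_{Z_1}+\mathbb I(A=a_0)Y]$. The one-step estimator $\psi^+_{a_0,3}(\hat Q)$ is the plug-in estimate plus $P_n\Phi_{a_0}(\hat Q)$. The TMLE $\psi_{a_0,3}(\hat Q^*)$ is the plug-in estimate at targeted nuisance estimates $\hat Q^*$, that is, estimates with $P_n\Phi_{a_0}(\hat Q^*)=o_P(n^{-1/2})$. **Regularity.** Positivity: almost surely $\pi(a\mid\mathrm{mp}(A))>0$ and $f_Z(Z\mid\mathrm{mp}^{-A}(Z),a)>0$ for both levels $a$ and all $Z\in\mathscr Z$. The variables $Y$ and $\mathbb I(A=a_Y)\mathscr R_YY$ are integrable. For the nuisance estimates that are used ($\hat Q$ for the one-step estimator, $\hat Q^*$ for the TMLE): $|\hat\mu(\cdot,a_Y)|$ and, $P$-almost surely, $|\hat{\mathscr R}_V|$ for $V\in\mathscr Z\cup\{Y\}$ are bounded by one constant; and, with probability one, $\Phi_{a_0}(\hat Q)-\Phi_{a_0}(Q)$ lies in a fixed $P$-Glivenko–Cantelli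 class, i.e. a class $\mathcal F$ of integrable functions with $\sup_{g\in\mathcal F}|(P_n-P)g|\to0$ in outer probability (for example a $P$-Donsker class). **Statement.** Let $\|g\|=(Pg^2)^{1/2}$. Each of $\psi^+_{a_0,3}(\hat Q)$ and $\psi_{a_0,3}(\hat Q^*)$ is consistent (converges in probability) for $\psi_{a_0}(Q)$ if, for the nuisance estimates it uses (written with hats; for the TMLE read $\hat Q^*$), the following hold simultaneously: 1. for all $Z_k\in\mathscr Z$ and all $Z_i\in\mathscr Z$ with $Z_i\prec Z_k$ and $a_{Z_i}\ne a_{Z_k}$: $\|\hat f_{Z_k}-f_{Z_k}\|=o_P(1)$ or $\|\hat f_{Z_i}-f_{Z_i}\|=o_P(1)$; 2. for all $Z_i\in\mathscr Z$ with $a_{Z_i}\ne a_Y$: $\|\hat\mu-\mu\|=o_P(1)$ or $\|\hat f_{Z_i}-f_{Z_i}\|=o_P(1)$; 3. for all $Z_k\in\mathcal M\setminus\{Y\}$: $\|\hat f_{Z_k}-f_{Z_k}\|=o_P(1)$ or $\|\hat\pi-\pi\|=o_P(1)$; and, if $Y\in\mathcal M$, also $\|\hat\mu-\mu\|=o_P(1)$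 or $\|\hat\pi-\pi\|=o_P(1)$. In particular both estimators are doubly robust: each is consistent if either - $\|\hat f_{Z}-f_{Z}\|=o_P(1)$ for all $Z\in\mathscr Z\cap\mathcal M$, and $\|\hat\mu-\mu\|=o_P(1)$ if $Y\in\mathcal M$; or - $\|\hat f_{Z}-f_{Z}\|=o_P(1)$ for all $Z\in\mathscr Z\cap\mathcal L$, $\|\hat\pi-\pi\|=o_P(1)$, and $\|\hat\mu-\mu\|=o_P(1)$ if $Y\in\mathcal L$. -/

import Mathlib

open MeasureTheory ProbabilityTheory Filter Topology
open scoped ENNReal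

universe u w

/-- An acyclic directed mixed graph (ADMG): directed edges without directed cycles,
and bidirected edges. -/
structure ADMG (V : Type u) where
  dir : V → V → Prop
  bidir : V → V → Prop
  bidir_symm : ∀ x y, bidir x y → bidir y x
  bidir_irrefl : ∀ x, ¬ bidir x x
  acyclic : ∀ x, ¬ Relation.TransGen dir x x

namespace ADMG

variable {V : Type u} (G : ADMG V)

/-- The children of a vertex. -/
def children (v : V) : Set V := {x | G.dir v x}

/-- The district of a vertex: everything reachable by a bidirected path (including the vertex). -/
def district (v : V) : Set V := {x | Relation.ReflTransGen G.bidir v x}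

/-- A vertex is primal fixable if its children and its district are disjoint. -/
def PrimalFixable (v : V) : Prop := G.children v ∩ G.district v = ∅

/-- The district of `v` in the subgraph induced on `v` and its predecessors. -/
def districtUpTo [LinearOrder V] (v : V) : Set V :=
  {x | Relation.ReflTransGen (fun a b => G.bidir a b ∧ a ≤ v ∧ b ≤ v) v x}

/-- The Markov pillow of `v` (relative to the order): the district of `v`, together with the
parents of that district, in the subgraph induced on `v` and its predecessors; `v` itself is
left out. -/
def markovPillow [LinearOrder V] (v : V) : Set V :=
  {x | x ≤ v ∧ x ≠ v ∧ (x ∈ G.districtUpTo v ∨ ∃ y ∈ G.districtUpTo v, G.dir x y)}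

end ADMG

/-- A causal graph on observed variables `V` with a primal fixable binary treatment `A` and a
real outcome `Y`. The linear order on `V` is the fixed topological order; `S v` is the state
space of the variable `v`. -/
structure CausalModel (V : Type u) [LinearOrder V] (S : V → Type w)
    [∀ v, MeasurableSpace (S v)] where
  G : ADMG V
  /-- the treatment -/
  A : V
  /-- the outcome -/
  Y : V
  A_lt_Y : A < Y
  topological : ∀ x y, G.dir x y → x < y
  /-- the treatment comes after all its non-descendants -/
  nondescendant_lt : ∀ x, ¬ Relation.ReflTransGen G.dir A x → x < A
  /-- the outcome is last -/
  le_Y : ∀ x, x ≤ Y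
  primalFixable : G.PrimalFixable A
  /-- the treatment is binary -/
  level : S A ≃ᵐ Bool
  /-- the real value of the outcome -/
  outcome : S Y → ℝ
  measurable_outcome : Measurable outcome
  /-- the dominating measures for the densities of the mediators -/
  ν : ∀ v, Measure (S v)
  sigmaFinite : ∀ v, SigmaFinite (ν v)
  /-- the treatment level of interest -/
  a₀ : Bool

/-- A collection of nuisances `(μ, π, (f_k)_k)`. All of them are written as functions of a full
configuration `o`: `mu o` stands for `μ(mp(Y))`, `pi a o` for `π(a | mp(A))`, and `f k o` for
`f_k(o_k | mp(k))`. Which coordinates they may depend on is recorded in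
`CausalModel.IsNuisance`; only the `f k` with `k` a mediator are used. -/
structure Nuisance (V : Type u) (S : V → Type w) where
  mu : (∀ v, S v) → ℝ
  pi : Bool → (∀ v, S v) → ℝ
  f : V → (∀ v, S v) → ℝ

namespace CausalModel

variable {V : Type u} [LinearOrder V] [Fintype V] {S : V → Type w} [∀ v, MeasurableSpace (S v)]
variable (T : CausalModel V S)

noncomputable section
open Classical in
/-- `𝓛`: the vertices of the district of `A` that do not precede `A` (so `A ∈ 𝓛`). -/
def L : Finset V := Finset.univ.filter fun v => T.A ≤ v ∧ v ∈ T.G.district T.A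

open Classical in
/-- `𝓜`: the post-treatment vertices outside the district of `A`. -/
def M : Finset V := Finset.univ.filter fun v => T.A < v ∧ v ∉ T.G.district T.A

/-- The mediators `𝓩 = (𝓜 ∪ 𝓛) \ {A, Y}`. -/
def Z : Finset V := (T.M ∪ T.L) \ {T.A, T.Y}

/-- The other treatment level `a₁ = 1 - a₀`. -/
def a₁ : Bool := !T.a₀

/-- `a_v`: the level `a₁` for `v ∈ 𝓛`, and `a₀` otherwise. -/
def lev (v : V) : Bool := if v ∈ T.L then T.a₁ else T.a₀

/-- The configuration `o` with the treatment set to `a`. -/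
def setA (o : ∀ v, S v) (a : Bool) : ∀ v, S v := Function.update o T.A (T.level.symm a)

/-- The indicator `𝕀(A = a)`. -/
def ind (a : Bool) (o : ∀ v, S v) : ℝ := if T.level (o T.A) = a then 1 else 0

/-- The real value of the outcome in the configuration `o`. -/
def y (o : ∀ v, S v) : ℝ := T.outcome (o T.Y)

/-- The functional space of the nuisances: measurable functions of the right variables, `π` a
binary propensity score, each `f_k` a conditional probability density with respect to `ν_k`. -/
structure IsNuisance (Q : Nuisance V S) : Prop where
  mu_meas : Measurable Q.mu
  mu_dep : DependsOn Q.mu (T.G.markovPillow T.Y)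
  pi_meas : ∀ a, Measurable (Q.pi a)
  pi_dep : ∀ a, DependsOn (Q.pi a) (T.G.markovPillow T.A)
  pi_nonneg : ∀ a o, 0 ≤ Q.pi a o
  pi_sum : ∀ o, Q.pi T.a₀ o + Q.pi T.a₁ o = 1
  f_meas : ∀ k ∈ T.Z, Measurable (Q.f k)
  f_dep : ∀ k ∈ T.Z, DependsOn (Q.f k) (insert k (T.G.markovPillow k))
  f_nonneg : ∀ k ∈ T.Z, ∀ o, 0 ≤ Q.f k o
  f_density : ∀ k ∈ T.Z, ∀ o, ∫⁻ z, ENNReal.ofReal (Q.f k (Function.update o k z)) ∂(T.ν k) = 1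

/-- Iterated numerical integration of `μ(·, a_Y)` against the densities
`f_k(· | mp(k) \ A, a_k)` of the mediators in a list (first entry = outermost integral). -/
def seqRegList (Q : Nuisance V S) : List V → (∀ v, S v) → ℝ
  | [], o => Q.mu (T.setA o (T.lev T.Y))
  | k :: l, o => ∫ z, Q.f k (Function.update (T.setA o (T.lev k)) k z) *
      seqRegList Q l (Function.update o k z) ∂(T.ν k)

/-- `𝓑_v`: integrate over all mediators from `v` on; `𝓑_Y` is `μ(·, a_Y)`. -/
def B (Q : Nuisance V S) (v : V) : (∀ v, S v) → ℝ :=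
  T.seqRegList Q ((T.Z.filter fun k => v ≤ k).sort)

/-- `𝓑` of the successor of the mediator `v` in `(Z_1, …, Z_K, Y)`: integrate over all mediators
strictly after `v`. -/
def Bsucc (Q : Nuisance V S) (v : V) : (∀ v, S v) → ℝ :=
  T.seqRegList Q ((T.Z.filter fun k => v < k).sort)

/-- `𝓑_{Z_1}` (which is `μ(·, a_Y)` when there are no mediators): integrate over all mediators. -/
def Bfirst (Q : Nuisance V S) : (∀ v, S v) → ℝ := T.seqRegList Q T.Z.sort

/-- The density ratio `f_k(· | mp(k) \ A, a_k) / f_k(· | mp(k) \ A, 1 - a_k)`. -/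
def fr (Q : Nuisance V S) (k : V) (o : ∀ v, S v) : ℝ :=
  Q.f k (T.setA o (T.lev k)) / Q.f k (T.setA o (!(T.lev k)))

/-- The ratio `π(a₁ | mp(A)) / π(a₀ | mp(A))`. -/
def frA (Q : Nuisance V S) (o : ∀ v, S v) : ℝ := Q.pi T.a₁ o / Q.pi T.a₀ o

/-- `𝓡_v`, the product of density ratios, for a mediator `v` or `v = Y`. -/
def R (Q : Nuisance V S) (v : V) (o : ∀ v, S v) : ℝ :=
  if v ∈ T.L then ∏ i ∈ T.M.filter (fun i => i < v), T.fr Q i o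
  else T.frA Q o * ∏ i ∈ (T.L.filter fun i => i < v).erase T.A, T.fr Q i o

/-- The influence function before centering at the parameter. -/
def eifUncentered (Q : Nuisance V S) (o : ∀ v, S v) : ℝ :=
  T.ind (T.lev T.Y) o * T.R Q T.Y o * (T.y o - Q.mu (T.setA o (T.lev T.Y)))
  + ∑ k ∈ T.Z, T.ind (T.lev k) o * T.R Q k o * (T.Bsucc Q k o - T.B Q k o)
  + (T.ind T.a₁ o - Q.pi T.a₁ o) * T.Bfirst Q o
  + Q.pi T.a₁ o * T.Bfirst Q o + T.ind T.a₀ o * T.y o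

/-- The influence function `Φ(Q)`, where `c` is the value of the parameter at `Q`. -/
def eif (Q : Nuisance V S) (c : ℝ) (o : ∀ v, S v) : ℝ := T.eifUncentered Q o - c

/-- The target parameter
`ψ(P) = E[π(a₁ | mp(A)) ∫ y dP(y | ·, a_Y) ∏ dP(z_k | ·, a_k)] + E[𝕀(A = a₀) Y]`,
with `Q` the nuisances of `P`. -/
def psi (P : Measure (∀ v, S v)) (Q : Nuisance V S) : ℝ :=
  (∫ o, Q.pi T.a₁ o * T.Bfirst Q o ∂P) + ∫ o, T.ind T.a₀ o * T.y o ∂P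

/-- The distribution `P` satisfies the topological factorization `∏ P(O_v | mp(v))`: given its
Markov pillow, each variable is independent of its other predecessors. -/
def TopologicalFactorization (P : Measure (∀ v, S v)) : Prop :=
  ∀ v, ∀ E : Set (S v), MeasurableSet E →
    P[((fun o => o v) ⁻¹' E).indicator (fun _ => (1 : ℝ)) | cylinderEvents (X := S) (Set.Iio v)]
      =ᵐ[P]
    P[((fun o => o v) ⁻¹' E).indicator (fun _ => (1 : ℝ)) |
      cylinderEvents (X := S) (T.G.markovPillow v)]

/-- `Q` consists of the true nuisances of `P`: `μ = E[Y | mp(Y)]`, `π(a | ·) = P(A = a | mp(A))`,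
and `f_k` is the conditional density of the mediator `k` given `mp(k)`. -/
structure IsTruth (P : Measure (∀ v, S v)) (Q : Nuisance V S) : Prop where
  nuisance : T.IsNuisance Q
  mu_eq : Q.mu =ᵐ[P] P[T.y | cylinderEvents (X := S) (T.G.markovPillow T.Y)]
  pi_eq : ∀ a, Q.pi a =ᵐ[P] P[T.ind a | cylinderEvents (X := S) (T.G.markovPillow T.A)]
  f_eq : ∀ k ∈ T.Z, ∀ E : Set (S k), MeasurableSet E →
    (fun o => ∫ z in E, Q.f k (Function.update o k z) ∂(T.ν k)) =ᵐ[P]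
      P[((fun o => o k) ⁻¹' E).indicator (fun _ => (1 : ℝ)) |
        cylinderEvents (X := S) (T.G.markovPillow k)]

/-- Positivity: both treatment levels, and the observed value of each mediator under both
treatment levels, have positive conditional density, almost surely. -/
def Positivity (P : Measure (∀ v, S v)) (Q : Nuisance V S) : Prop :=
  ∀ᵐ o ∂P, ∀ a, 0 < Q.pi a o ∧ ∀ k ∈ T.Z, 0 < Q.f k (T.setA o a)

/-- The outcome is integrable, and so is the outcome in the integral that defines the parameter
(written under `P` by means of the density ratio `𝓡_Y`). -/
def OutcomeIntegrable (P : Measure (∀ v, S v)) (Q : Nuisance V S) : Prop :=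
  Integrable T.y P ∧ Integrable (fun o => T.ind (T.lev T.Y) o * T.R Q T.Y o * T.y o) P

/-- Boundedness of a sequence of (random) nuisance estimates: the estimated outcome regression
and the estimated products of density ratios are bounded by one constant. -/
def BoundedEstimates {Ω : Type*} [MeasurableSpace Ω] (Pr : Measure Ω)
    (P : Measure (∀ v, S v)) (Qh : ℕ → Ω → Nuisance V S) : Prop :=
  ∃ C : ℝ, ∀ n, ∀ᵐ ω ∂Pr, (∀ o, |(Qh n ω).mu (T.setA o (T.lev T.Y))| ≤ C) ∧
    ∀ᵐ o ∂P, ∀ v ∈ insert T.Y T.Z, |T.R (Qh n ω) v o| ≤ C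

end

end CausalModel

noncomputable section

/-- The empirical mean `P_n g` of `g` over the first `n` observations. -/
def empMean {X Ω : Type*} (O : ℕ → Ω → X) (n : ℕ) (ω : Ω) (g : X → ℝ) : ℝ :=
  (∑ j ∈ Finset.range n, g (O j ω)) / n

/-- `F` is a (weak) `P`-Glivenko–Cantelli class: its members are integrable and
`sup_{g ∈ F} |(P_n - P) g|` tends to zero in outer probability for i.i.d. samples from `P`.
(The measure of a set that need not be measurable is its outer measure.) -/
def IsGlivenkoCantelli {X : Type*} [MeasurableSpace X] (P : Measure X) [SigmaFinite P]
    (F : Set (X → ℝ)) : Prop :=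
  (∀ g ∈ F, Integrable g P) ∧ ∀ ε : ℝ, 0 < ε →
    Tendsto (fun n : ℕ => Measure.pi (fun _ : Fin n => P)
      {x | ∃ g ∈ F, ε ≤ |(∑ j, g (x j)) / n - ∫ t, g t ∂P|}) atTop (𝓝 0)

/-- `ξ_n = o_P(1)` for `[0, ∞]`-valued random quantities. -/
def IsLittleOP {Ω : Type*} [MeasurableSpace Ω] (Pr : Measure Ω) (ξ : ℕ → Ω → ℝ≥0∞) : Prop :=
  ∀ ε : ℝ≥0∞, 0 < ε → Tendsto (fun n => Pr {ω | ε ≤ ξ n ω}) atTop (𝓝 0)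

/-- `‖ĝ_n - g‖ = o_P(1)` in the `L²(P)` norm. -/
def L2Consistent {X Ω : Type*} [MeasurableSpace X] [MeasurableSpace Ω] (Pr : Measure Ω)
    (P : Measure X) (gh : ℕ → Ω → X → ℝ) (g : X → ℝ) : Prop :=
  IsLittleOP Pr fun n ω => eLpNorm (fun o => gh n ω o - g o) 2 P

end

namespace CausalModel

variable {V : Type u} [LinearOrder V] [Fintype V] {S : V → Type w} [∀ v, MeasurableSpace (S v)]
variable (T : CausalModel V S)
variable {Ω : Type*}

noncomputable section

/-- The plug-in estimator `P_n[π(a₁ | mp(A)) 𝓑_{Z_1} + 𝕀(A = a₀) Y]`; it is the TMLE when the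
nuisance estimates `q` are the targeted ones. -/
def plugIn (O : ℕ → Ω → ∀ v, S v) (n : ℕ) (ω : Ω) (q : Nuisance V S) : ℝ :=
  empMean O n ω fun o => q.pi T.a₁ o * T.Bfirst q o + T.ind T.a₀ o * T.y o

/-- The one-step estimator: the plug-in estimator plus `P_n Φ(q)`. -/
def oneStep (O : ℕ → Ω → ∀ v, S v) (n : ℕ) (ω : Ω) (q : Nuisance V S) : ℝ :=
  T.plugIn O n ω q + empMean O n ω (T.eif q (T.plugIn O n ω q))

variable [MeasurableSpace Ω]

/-- Complexity condition on the nuisance estimates: with probability one `Φ(Q̂) - Φ(Q)` lies in a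
fixed Glivenko–Cantelli class. -/
def EIFInGlivenkoCantelli (Pr : Measure Ω) (P : Measure (∀ v, S v)) [SigmaFinite P]
    (O : ℕ → Ω → ∀ v, S v) (Q : Nuisance V S) (Qh : ℕ → Ω → Nuisance V S) : Prop :=
  ∃ F : Set ((∀ v, S v) → ℝ), IsGlivenkoCantelli P F ∧
    ∀ n, 1 ≤ n → ∀ᵐ ω ∂Pr,
      (fun o => T.eif (Qh n ω) (T.plugIn O n ω (Qh n ω)) o - T.eif Q (T.psi P Q) o) ∈ F

/-- Regularity of a sequence of nuisance estimates: they take values in the functional space of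
the nuisances, are bounded, and satisfy the complexity condition. -/
structure RegularEstimates (Pr : Measure Ω) (P : Measure (∀ v, S v)) [SigmaFinite P]
    (O : ℕ → Ω → ∀ v, S v) (Q : Nuisance V S) (Qh : ℕ → Ω → Nuisance V S) : Prop where
  nuisance : ∀ n, ∀ᵐ ω ∂Pr, T.IsNuisance (Qh n ω)
  bounded : T.BoundedEstimates Pr P Qh
  complexity : T.EIFInGlivenkoCantelli Pr P O Q Qh

/-- Successful targeting: `P_n Φ(Q̂*) = o_P(n^{-1/2})`. -/
def Targeted (Pr : Measure Ω) (O : ℕ → Ω → ∀ v, S v) (Qs : ℕ → Ω → Nuisance V S) : Prop :=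
  TendstoInMeasure Pr
    (fun (n : ℕ) ω => √(n : ℝ) * empMean O n ω (T.eif (Qs n ω) (T.plugIn O n ω (Qs n ω))))
    atTop (fun _ => 0)

/-- `‖μ̂ - μ‖ = o_P(1)`. -/
def MuConsistent (Pr : Measure Ω) (P : Measure (∀ v, S v)) (Q : Nuisance V S)
    (Qh : ℕ → Ω → Nuisance V S) : Prop :=
  L2Consistent Pr P (fun n ω => (Qh n ω).mu) Q.mu

/-- `‖π̂ - π‖ = o_P(1)`. -/
def PiConsistent (Pr : Measure Ω) (P : Measure (∀ v, S v)) (Q : Nuisance V S)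
    (Qh : ℕ → Ω → Nuisance V S) : Prop :=
  L2Consistent Pr P (fun n ω => (Qh n ω).pi T.a₁) (Q.pi T.a₁)

/-- `‖f̂_k - f_k‖ = o_P(1)`. -/
def DensityConsistent (Pr : Measure Ω) (P : Measure (∀ v, S v)) (Q : Nuisance V S)
    (Qh : ℕ → Ω → Nuisance V S) (k : V) : Prop :=
  L2Consistent Pr P (fun n ω => (Qh n ω).f k) (Q.f k)

/-- The three simultaneous disjunctive conditions. In the third one, the nuisance that belongs to
the vertex `Y`, if `Y ∈ 𝓜`, is the outcome regression. -/
structure DisjunctiveConditions (Pr : Measure Ω) (P : Measure (∀ v, S v)) (Q : Nuisance V S)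
    (Qh : ℕ → Ω → Nuisance V S) : Prop where
  mediators : ∀ k ∈ T.Z, ∀ i ∈ T.Z, i < k → T.lev i ≠ T.lev k →
    DensityConsistent Pr P Q Qh k ∨ DensityConsistent Pr P Q Qh i
  outcome : ∀ i ∈ T.Z, T.lev i ≠ T.lev T.Y →
    MuConsistent Pr P Q Qh ∨ DensityConsistent Pr P Q Qh i
  treatment_mediators : ∀ k ∈ T.M, k ≠ T.Y →
    DensityConsistent Pr P Q Qh k ∨ T.PiConsistent Pr P Q Qh
  treatment_outcome : T.Y ∈ T.M →
    MuConsistent Pr P Q Qh ∨ T.PiConsistent Pr P Q Qh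

/-- All nuisances on the `𝓜` side are consistent, or all those on the `𝓛` side are, `π`
included. -/
def DoublyRobustConditions (Pr : Measure Ω) (P : Measure (∀ v, S v)) (Q : Nuisance V S)
    (Qh : ℕ → Ω → Nuisance V S) : Prop :=
  ((∀ k ∈ T.Z, k ∈ T.M → DensityConsistent Pr P Q Qh k) ∧
      (T.Y ∈ T.M → MuConsistent Pr P Q Qh)) ∨
  ((∀ k ∈ T.Z, k ∈ T.L → DensityConsistent Pr P Q Qh k) ∧
      (T.Y ∈ T.L → MuConsistent Pr P Q Qh) ∧ T.PiConsistent Pr P Q Qh)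

end

end CausalModel

set_option linter.unusedSectionVars false

/-! ### Integration and convergence in probability. -/

section Generic

/-! The uncentered influence function at an estimate has mean equal to the parameter plus one bias
term for each mediator and one for the outcome. Each bias term multiplies an error in the estimated
weight `𝓡̂_v - 𝓡_v` by an error in the nuisance attached to `v`. The disjunctive conditions say
exactly that at least one factor of every term is consistent.

The identity behind this is a change of treatment level (`lintegral_switch`). For functions of an
initial segment that do not read the treatment, integrating on `A = a₁` with the `𝓜` ratios gives
the same value as integrating on `A = a₀` with the treatment ratio and the `𝓛` ratios
(`weight_switch`). Hence the weight `𝓡_k`, on whichever level it lives, is interchangeable with the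
weight of the mediators before `k`, and also with that of the mediators up to `k` (`R_switch`,
`R_switch_le`). With the true weights the sequential-regression differences therefore telescope for
arbitrary regressions (`telescope`). Subtracting this from the mean at the estimate leaves only
differences of weights (`integral_eif_eq`).

The bias terms vanish by dominated convergence, not by Cauchy–Schwarz, because the true weights are
only known to be integrable. For a mediator, the conditional mean of `𝓑̂_{k+1} - 𝓑̂_k` is controlled
by the `L¹` distance of two densities. This distance is twice the true conditional mean of a
relative shortfall lying in `[0, 1]` (`abs_biasZ_le`). For the outcome, `Y` is replaced by its
regression (`biasY_eq`). Along deterministic sequences with `L²` errors at most `2⁻ᵐ` everything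
converges almost everywhere, at both treatment levels by positivity (`ae_setA`);
`tendstoInMeasure_of_seq` turns this into convergence in probability.

Finally, the one-step error is a Glivenko–Cantelli term, a law-of-large-numbers term at the truth,
and the bias. The TMLE differs from the one-step estimator by `P_n Φ(Q̂*)`, which is negligible. -/

lemma lintegral_enorm_eq_pos_add_neg {α : Type*} [MeasurableSpace α] {μ : Measure α} {f : α → ℝ}
    (hf : AEStronglyMeasurable f μ) : ∫⁻ x, ‖f x‖ₑ ∂μ =
      ∫⁻ x, ENNReal.ofReal (f x) ∂μ + ∫⁻ x, ENNReal.ofReal (-f x) ∂μ := by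
  rw [← lintegral_add_left' hf.aemeasurable.ennreal_ofReal]
  refine lintegral_congr fun x => ?_
  rw [Real.enorm_eq_ofReal_abs]
  rcases le_total 0 (f x) with h0 | h0
  · rw [abs_of_nonneg h0, ENNReal.ofReal_of_nonpos (p := -f x) (by linarith), add_zero]
  · rw [abs_of_nonpos h0, ENNReal.ofReal_of_nonpos (p := f x) h0, zero_add]

/-- Two real functions whose positive and negative parts have equal integrals. -/
lemma integrable_iff_and_integral_eq_of_lintegral_ofReal {α β : Type*} [MeasurableSpace α]
    [MeasurableSpace β] {μ : Measure α} {ν : Measure β} {f : α → ℝ} {g : β → ℝ}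
    (hf : AEStronglyMeasurable f μ) (hg : AEStronglyMeasurable g ν)
    (hp : ∫⁻ x, ENNReal.ofReal (f x) ∂μ = ∫⁻ x, ENNReal.ofReal (g x) ∂ν)
    (hn : ∫⁻ x, ENNReal.ofReal (-f x) ∂μ = ∫⁻ x, ENNReal.ofReal (-g x) ∂ν) :
    (Integrable f μ ↔ Integrable g ν) ∧ ∫ x, f x ∂μ = ∫ x, g x ∂ν := by
  have hiff : Integrable f μ ↔ Integrable g ν := by
    simp only [Integrable, hf, hg, true_and, HasFiniteIntegral]
    rw [lintegral_enorm_eq_pos_add_neg hf, lintegral_enorm_eq_pos_add_neg hg, hp, hn]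
  refine ⟨hiff, ?_⟩
  by_cases h : Integrable f μ
  · rw [integral_eq_lintegral_pos_part_sub_lintegral_neg_part h,
      integral_eq_lintegral_pos_part_sub_lintegral_neg_part (hiff.1 h), hp, hn]
  · rw [integral_undef h, integral_undef (fun h' => h (hiff.2 h'))]

/-- Weighted integrals of a real function agree if they do for all nonnegative functions of it. -/
lemma integrable_iff_and_integral_eq_of_lintegral_weights {α : Type*} [MeasurableSpace α]
    {μ : Measure α} {v v' H : α → ℝ} (hv : Measurable v) (hv' : Measurable v') (hH : Measurable H)
    (hv0 : ∀ x, 0 ≤ v x) (hv0' : ∀ x, 0 ≤ v' x)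
    (h : ∀ φ : ℝ → ℝ≥0∞, Measurable φ →
      ∫⁻ x, ENNReal.ofReal (v x) * φ (H x) ∂μ = ∫⁻ x, ENNReal.ofReal (v' x) * φ (H x) ∂μ) :
    (Integrable (fun x => v x * H x) μ ↔ Integrable (fun x => v' x * H x) μ) ∧
      ∫ x, v x * H x ∂μ = ∫ x, v' x * H x ∂μ := by
  refine integrable_iff_and_integral_eq_of_lintegral_ofReal
    (hv.mul hH).aestronglyMeasurable (hv'.mul hH).aestronglyMeasurable ?_ ?_
  · simpa only [ENNReal.ofReal_mul (hv0 _), ENNReal.ofReal_mul (hv0' _)] using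
      h ENNReal.ofReal ENNReal.measurable_ofReal
  · simpa only [← mul_neg, ENNReal.ofReal_mul (hv0 _), ENNReal.ofReal_mul (hv0' _)] using
      h (fun x => ENNReal.ofReal (-x)) (by fun_prop)

/-- Fast `L²` convergence implies convergence almost everywhere. -/
lemma ae_tendsto_of_eLpNorm_two_le {α : Type*} [MeasurableSpace α] {μ : Measure α}
    {g : ℕ → α → ℝ} (hg : ∀ m, AEStronglyMeasurable (g m) μ)
    (h : ∀ m, eLpNorm (g m) 2 μ ≤ 2⁻¹ ^ m) :
    ∀ᵐ x ∂μ, Tendsto (fun m => g m x) atTop (𝓝 0) := by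
  have h2 : ∀ m, ∫⁻ x, ‖g m x‖ₑ ^ (2 : ℝ) ∂μ ≤ 2⁻¹ ^ m := by
    intro m
    have e := h m
    rw [eLpNorm_eq_lintegral_rpow_enorm_toReal (by simp) (by simp)] at e
    simp only [ENNReal.toReal_ofNat, one_div] at e
    have e2 := ENNReal.rpow_le_rpow e (by norm_num : (0 : ℝ) ≤ 2)
    rw [← ENNReal.rpow_mul] at e2
    norm_num at e2
    refine le_trans (by simpa using e2) ?_
    -- Squaring gives `2⁻²ᵐ`; the weaker bound `2⁻ᵐ` is already summable.
    rw [← pow_mul]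
    exact pow_le_pow_right_of_le_one' (by simp) (by omega)
  -- By Tonelli the sum of the squares has finite integral, so it is finite almost everywhere and
  -- its terms tend to zero there.
  have hs : ∫⁻ x, ∑' m, ‖g m x‖ₑ ^ (2 : ℝ) ∂μ ≠ ∞ := by
    rw [lintegral_tsum fun m => ((hg m).enorm.pow_const _)]
    refine ne_top_of_le_ne_top ?_ (ENNReal.tsum_le_tsum h2)
    rw [ENNReal.tsum_geometric]
    simp
  have hae := ae_lt_top' (AEMeasurable.tsum fun m => ((hg m).enorm.pow_const _)) hs
  filter_upwards [hae] with x hx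
  have h0 := ENNReal.tendsto_atTop_zero_of_tsum_ne_top hx.ne
  rw [tendsto_zero_iff_norm_tendsto_zero]
  have h1 : Tendsto (fun m => ‖g m x‖ₑ) atTop (𝓝 0) := by
    have := h0.ennrpow_const (1 / 2)
    simp only [← ENNReal.rpow_mul] at this
    norm_num at this
    exact this
  have h3 := (ENNReal.tendsto_toReal (by simp : (0 : ℝ≥0∞) ≠ ∞)).comp h1
  simpa [Function.comp_def] using h3

/-- A sequential criterion turned into an `ε`-`δ` statement. -/
lemma exists_delta_of_seq {α ι : Type*} (p : α → Prop) (d : ι → α → ℝ≥0∞) (t : α → ℝ)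
    (h : ∀ q : ℕ → α, (∀ m, p (q m)) → (∀ i, ∀ m, d i (q m) ≤ 2⁻¹ ^ m) →
      Tendsto (fun m => t (q m)) atTop (𝓝 0)) (ε : ℝ) (hε : 0 < ε) :
    ∃ δ : ℝ≥0∞, 0 < δ ∧ ∀ a, p a → (∀ i, d i a < δ) → |t a| < ε := by
  by_contra! hc
  -- A counterexample for each `δ = 2⁻ᵐ` yields a sequence that satisfies the hypotheses of `h`
  -- while `|t|` stays at least `ε`.
  choose q hq using fun m : ℕ =>
    hc (2⁻¹ ^ m) (ENNReal.pow_pos (ENNReal.inv_pos.2 (by simp)) m)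
  have ht := h q (fun m => (hq m).1) (fun i m => ((hq m).2.1 i).le)
  rw [Metric.tendsto_atTop] at ht
  obtain ⟨N, hN⟩ := ht ε hε
  have := hN N le_rfl
  rw [Real.dist_eq, sub_zero] at this
  exact absurd this (not_lt.2 (hq N).2.2)

/-- Transfer of a sequential criterion to convergence in probability. -/
lemma tendstoInMeasure_of_seq {Ω α ι : Type*} [MeasurableSpace Ω] [Finite ι] {Pr : Measure Ω}
    (p : α → Prop) (d : ι → α → ℝ≥0∞) (t : α → ℝ)
    (h : ∀ q : ℕ → α, (∀ m, p (q m)) → (∀ i, ∀ m, d i (q m) ≤ 2⁻¹ ^ m) →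
      Tendsto (fun m => t (q m)) atTop (𝓝 0))
    {q : ℕ → Ω → α} (hp : ∀ n, ∀ᵐ ω ∂Pr, p (q n ω))
    (hd : ∀ i, IsLittleOP Pr fun n ω => d i (q n ω)) :
    TendstoInMeasure Pr (fun n ω => t (q n ω)) atTop fun _ => 0 := by
  have := Fintype.ofFinite ι
  rw [tendstoInMeasure_iff_norm]
  intro ε hε
  obtain ⟨δ, hδ, hδt⟩ := exists_delta_of_seq p d t h ε hε
  -- Finiteness of `ι` enters here: the bad event is contained in a finite union of events of
  -- vanishing probability.
  have hsum : Tendsto (fun n => ∑ i, Pr {ω | δ ≤ d i (q n ω)}) atTop (𝓝 0) := by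
    simpa using tendsto_finsetSum Finset.univ fun i _ => hd i δ hδ
  refine tendsto_of_tendsto_of_tendsto_of_le_of_le tendsto_const_nhds hsum
    (fun _ => zero_le) fun n => ?_
  calc Pr {ω | ε ≤ ‖t (q n ω) - 0‖}
      ≤ Pr (⋃ i, {ω | δ ≤ d i (q n ω)}) := by
        refine measure_mono_ae ?_
        filter_upwards [hp n] with ω hω hbad
        change ω ∈ ⋃ i, {ω | δ ≤ d i (q n ω)}
        by_contra hcon
        simp only [Set.mem_iUnion, Set.mem_ofPred_eq, not_exists, not_le] at hcon
        have h1 := hδt _ hω hcon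
        have h2 : ε ≤ ‖t (q n ω) - 0‖ := hbad
        rw [sub_zero, Real.norm_eq_abs] at h2
        linarith
    _ ≤ _ := measure_iUnion_fintype_le _ _

lemma tendstoInMeasure_zero_add {Ω : Type*} [MeasurableSpace Ω] {Pr : Measure Ω}
    {X Y : ℕ → Ω → ℝ} (hX : TendstoInMeasure Pr X atTop fun _ => 0)
    (hY : TendstoInMeasure Pr Y atTop fun _ => 0) :
    TendstoInMeasure Pr (fun n ω => X n ω + Y n ω) atTop fun _ => 0 := by
  rw [tendstoInMeasure_iff_norm] at *
  intro ε hε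
  have h := (hX (ε / 2) (by positivity)).add (hY (ε / 2) (by positivity))
  rw [add_zero] at h
  refine tendsto_of_tendsto_of_tendsto_of_le_of_le tendsto_const_nhds h
    (fun _ => zero_le) fun n => ?_
  refine (measure_mono fun ω hω => ?_).trans (measure_union_le _ _)
  by_contra hcon
  simp only [Set.mem_union, Set.mem_ofPred_eq, not_or, not_le, sub_zero] at hcon hω
  have := norm_add_le (X n ω) (Y n ω)
  linarith

lemma tendstoInMeasure_zero_sum {Ω ι : Type*} [MeasurableSpace Ω] {Pr : Measure Ω}
    (s : Finset ι) {X : ι → ℕ → Ω → ℝ}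
    (hX : ∀ i ∈ s, TendstoInMeasure Pr (X i) atTop fun _ => 0) :
    TendstoInMeasure Pr (fun n ω => ∑ i ∈ s, X i n ω) atTop fun _ => 0 := by
  classical
  induction s using Finset.induction_on with
  | empty =>
    rw [tendstoInMeasure_iff_norm]
    intro ε hε
    simp [not_le.2 hε]
  | insert i s hi ih =>
    simp only [Finset.sum_insert hi]
    exact tendstoInMeasure_zero_add (hX i (by simp)) (ih fun j hj => hX j (by simp [hj]))

/-- Domination is only required eventually, so that `n = 0`, where the empirical mean divides by
zero, can be discarded. -/
lemma tendstoInMeasure_of_abs_sub_le {Ω : Type*} [MeasurableSpace Ω] {Pr : Measure Ω}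
    {X Y : ℕ → Ω → ℝ} {a b : ℝ} (hX : TendstoInMeasure Pr X atTop fun _ => b)
    (h : ∀ᶠ n in atTop, ∀ᵐ ω ∂Pr, |Y n ω - a| ≤ |X n ω - b|) :
    TendstoInMeasure Pr Y atTop fun _ => a := by
  rw [tendstoInMeasure_iff_norm] at *
  intro ε hε
  refine tendsto_of_tendsto_of_tendsto_of_le_of_le' tendsto_const_nhds (hX ε hε)
    (Eventually.of_forall fun _ => zero_le) ?_
  filter_upwards [h] with n hn
  refine measure_mono_ae ?_
  filter_upwards [hn] with ω hω hbad
  have h2 : ε ≤ ‖Y n ω - a‖ := hbad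
  exact h2.trans hω

/-! ### Empirical means of i.i.d. samples. -/

section Sampling

variable {X Ω : Type*} [MeasurableSpace X] [MeasurableSpace Ω] {Pr : Measure Ω}
  [IsProbabilityMeasure Pr] {P : Measure X} [IsProbabilityMeasure P] {O : ℕ → Ω → X}

/-- The Glivenko–Cantelli property in terms of an i.i.d. sample on an arbitrary space. -/
lemma IsGlivenkoCantelli.tendstoInMeasure {F : Set (X → ℝ)} (hF : IsGlivenkoCantelli P F)
    (hOmeas : ∀ j, Measurable (O j)) (hOindep : iIndepFun O Pr) (hOlaw : ∀ j, Pr.map (O j) = P)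
    {g : ℕ → Ω → X → ℝ} (hg : ∀ n, 1 ≤ n → ∀ᵐ ω ∂Pr, g n ω ∈ F) :
    TendstoInMeasure Pr (fun n ω => empMean O n ω (g n ω) - ∫ x, g n ω x ∂P) atTop
      fun _ => 0 := by
  rw [tendstoInMeasure_iff_norm]
  intro ε hε
  refine tendsto_of_tendsto_of_tendsto_of_le_of_le' tendsto_const_nhds (hF.2 ε hε)
    (Eventually.of_forall fun _ => zero_le) ?_
  filter_upwards [eventually_ge_atTop 1] with n hn
  have hlaw : Pr.map (fun ω (i : Fin n) => O i ω) = Measure.pi fun _ : Fin n => P := by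
    have hi : iIndepFun (fun i : Fin n => O i) Pr := hOindep.precomp Fin.val_injective
    rw [(iIndepFun_iff_map_fun_eq_pi_map fun i : Fin n => (hOmeas i).aemeasurable).1 hi]
    simp [hOlaw]
  have hm : Measurable fun ω (i : Fin n) => O i ω := measurable_pi_lambda _ fun i => hOmeas i
  set E : Set (Fin n → X) := {x | ∃ g ∈ F, ε ≤ |(∑ j, g (x j)) / n - ∫ t, g t ∂P|} with hE
  -- The set `E` is indexed by an arbitrary class and need not be measurable, so the law of the
  -- sample is applied to its measurable hull, which has the same outer measure.
  calc Pr {ω | ε ≤ ‖empMean O n ω (g n ω) - ∫ x, g n ω x ∂P - 0‖}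
      ≤ Pr ((fun ω (i : Fin n) => O i ω) ⁻¹' toMeasurable (Measure.pi fun _ : Fin n => P) E) := by
        refine measure_mono_ae ?_
        filter_upwards [hg n hn] with ω hω hbad
        refine subset_toMeasurable _ E ?_
        have h2 : ε ≤ ‖empMean O n ω (g n ω) - ∫ x, g n ω x ∂P - 0‖ := hbad
        refine ⟨g n ω, hω, ?_⟩
        rw [sub_zero, Real.norm_eq_abs, empMean, Finset.sum_range] at h2
        exact h2
    _ = _ := by
        rw [← Measure.map_apply hm (measurableSet_toMeasurable _ _), hlaw, measure_toMeasurable]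

end Sampling

/-- The weak law of large numbers for empirical means. -/
lemma tendstoInMeasure_empMean {X Ω : Type*} [MeasurableSpace X] [MeasurableSpace Ω]
    {Pr : Measure Ω} [IsProbabilityMeasure Pr] {P : Measure X} {O : ℕ → Ω → X}
    (hOmeas : ∀ j, Measurable (O j)) (hOindep : iIndepFun O Pr)
    (hOlaw : ∀ j, Pr.map (O j) = P) {g : X → ℝ} (hgm : Measurable g) (hg : Integrable g P) :
    TendstoInMeasure Pr (fun n ω => empMean O n ω g) atTop fun _ => ∫ x, g x ∂P := by
  have h0 : ∫ x, g x ∂P = Pr[fun ω => g (O 0 ω)] := by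
    rw [← hOlaw 0, integral_map (hOmeas 0).aemeasurable hgm.aestronglyMeasurable]
  rw [h0]
  refine tendstoInMeasure_of_tendsto_ae (fun n => ?_) ?_
  · refine Measurable.aestronglyMeasurable ?_
    unfold empMean
    fun_prop
  · refine strong_law_ae_real (fun j ω => g (O j ω)) ?_ ?_ ?_
    · have := hg
      rw [← hOlaw 0] at this
      exact this.comp_measurable (hOmeas 0)
    · intro i j hij
      exact (hOindep.indepFun hij).comp hgm hgm
    · intro i
      exact (IdentDistrib.mk (hOmeas i).aemeasurable (hOmeas 0).aemeasurable
        (by rw [hOlaw, hOlaw])).comp hgm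

end Generic

/-! ### Functions of a subset of the coordinates. -/

section Freeze

variable {V : Type u} {S : V → Type w} [∀ v, MeasurableSpace (S v)]

open Classical in
/-- The configuration `o` with the coordinates outside `s` replaced by those of `o₀`. -/
noncomputable def freeze (s : Set V) (o₀ o : ∀ v, S v) : ∀ v, S v :=
  fun v => if v ∈ s then o v else o₀ v

lemma freeze_apply_of_mem {s : Set V} (o₀ o : ∀ v, S v) {v : V} (hv : v ∈ s) :
    freeze s o₀ o v = o v := by simp [freeze, hv]

lemma measurable_freeze (s : Set V) (o₀ : ∀ v, S v) :
    Measurable[cylinderEvents (X := S) s] (freeze s o₀) := by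
  refine @measurable_pi_lambda _ _ _ (cylinderEvents (X := S) s) _ _ fun v => ?_
  by_cases hv : v ∈ s
  · simp only [freeze, hv, if_true]
    exact measurable_cylinderEvent_apply hv
  · simp only [freeze, hv, if_false]
    exact measurable_const

/-- Freezing the coordinates outside `s` does not change `f`, and the freezing map is measurable for
the σ-algebra generated by the coordinates in `s`. This turns dependence on coordinates into the
measurability that conditional expectations need. -/
lemma DependsOn.measurable_cylinderEvents {β : Type*} [MeasurableSpace β] {s : Set V}
    {f : (∀ v, S v) → β} (hd : DependsOn f s) (hf : Measurable f) :
    Measurable[cylinderEvents (X := S) s] f := by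
  rcases isEmpty_or_nonempty (∀ v, S v) with h | ⟨⟨o₀⟩⟩
  · exact @measurable_of_empty _ _ (cylinderEvents (X := S) s) _ _ _
  · have : f = f ∘ freeze s o₀ := by
      funext o
      exact hd fun v hv => (freeze_apply_of_mem o₀ o hv).symm
    rw [this]
    exact hf.comp (measurable_freeze s o₀)

end Freeze

/-! ### Order, treatment levels and the variables read by the nuisances. -/

namespace CausalModel

variable {V : Type u} [LinearOrder V] [Fintype V] {S : V → Type w} [∀ v, MeasurableSpace (S v)]
  {T : CausalModel V S}

/-- Membership in the district of `A` sorts every vertex after `A` into exactly one of `𝓜` and `𝓛`,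
so only the position in the order remains. -/
lemma mem_Z {v : V} : v ∈ T.Z ↔ T.A < v ∧ v ≠ T.Y := by
  simp only [Z, M, L, Finset.mem_sdiff, Finset.mem_union, Finset.mem_filter, Finset.mem_univ,
    true_and, Finset.mem_insert, Finset.mem_singleton, not_or]
  constructor
  · rintro ⟨h, h1, h2⟩
    rcases h with h | h
    · exact ⟨h.1, h2⟩
    · exact ⟨lt_of_le_of_ne h.1 (Ne.symm h1), h2⟩
  · rintro ⟨h, h2⟩
    refine ⟨?_, h.ne', h2⟩
    by_cases hd : v ∈ T.G.district T.A
    · exact Or.inr ⟨h.le, hd⟩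
    · exact Or.inl ⟨h, hd⟩

lemma lt_Y_of_mem_Z {v : V} (hv : v ∈ T.Z) : v < T.Y :=
  lt_of_le_of_ne (T.le_Y v) (mem_Z.1 hv).2

lemma mem_M_iff {v : V} (hv : T.A < v) : v ∈ T.M ↔ v ∉ T.L := by
  simp [M, L, hv, hv.le]

lemma ne_A_of_mem_Z {v : V} (hv : v ∈ T.Z) : v ≠ T.A := (mem_Z.1 hv).1.ne'

lemma ind_nonneg (a : Bool) (o : ∀ v, S v) : 0 ≤ T.ind a o := by
  unfold ind; split_ifs <;> simp

lemma ind_le_one (a : Bool) (o : ∀ v, S v) : T.ind a o ≤ 1 := by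
  unfold ind; split_ifs <;> simp

lemma setA_update {k : V} (hk : k ≠ T.A) (o : ∀ v, S v) (z : S k) (a : Bool) :
    T.setA (Function.update o k z) a = Function.update (T.setA o a) k z :=
  Function.update_comm hk _ _ _

lemma setA_setA (o : ∀ v, S v) (a b : Bool) : T.setA (T.setA o a) b = T.setA o b := by
  simp [setA]

lemma setA_apply_of_ne {k : V} (hk : k ≠ T.A) (o : ∀ v, S v) (a : Bool) : T.setA o a k = o k := by
  simp [setA, hk]

lemma setA_eq_self {o : ∀ v, S v} {a : Bool} (h : T.level (o T.A) = a) : T.setA o a = o := by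
  simp [setA, ← h]

/-- This dichotomy is the device for moving between observed and assigned treatment: either the
indicator kills the integrand, or assigning the level changes nothing. -/
lemma ind_eq_zero_or (a : Bool) (o : ∀ v, S v) : T.ind a o = 0 ∨ T.setA o a = o := by
  by_cases h : T.level (o T.A) = a
  · exact Or.inr (setA_eq_self h)
  · exact Or.inl (by simp [ind, h])

lemma measurable_ind (a : Bool) : Measurable (T.ind a) := by
  unfold ind
  refine Measurable.ite ?_ measurable_const measurable_const
  exact (T.level.measurable.comp (measurable_pi_apply T.A)) (measurableSet_singleton a)

lemma measurable_setA (a : Bool) : Measurable fun o => T.setA o a :=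
  measurable_update_left

lemma dependsOn_ind (a : Bool) : DependsOn (T.ind a) {T.A} := by
  intro x y h
  simp only [ind, h T.A rfl]

lemma DependsOn.comp_setA {β : Type*} {f : (∀ v, S v) → β} {s : Set V} (hf : DependsOn f s)
    (a : Bool) : DependsOn (fun o => f (T.setA o a)) (s \ {T.A}) := by
  intro x y h
  refine hf fun i hi => ?_
  by_cases hA : i = T.A
  · subst hA; simp [setA]
  · rw [setA_apply_of_ne hA, setA_apply_of_ne hA]
    exact h i ⟨hi, hA⟩

/-- It suffices below to regard each nuisance as a function of all predecessors, since the
factorization identifies the conditional law given the pillow with the one given the whole past. -/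
lemma markovPillow_subset_Iio (v : V) : T.G.markovPillow v ⊆ Set.Iio v :=
  fun _ hx => lt_of_le_of_ne hx.1 hx.2.1

lemma insert_markovPillow_subset_Iic (v : V) : insert v (T.G.markovPillow v) ⊆ Set.Iic v := by
  intro x hx
  rcases hx with rfl | hx
  · exact le_rfl
  · exact hx.1

namespace IsNuisance

variable {Q : Nuisance V S}

lemma f_dep_Iic (hQ : T.IsNuisance Q) {k : V} (hk : k ∈ T.Z) : DependsOn (Q.f k) (Set.Iic k) :=
  (hQ.f_dep k hk).mono (insert_markovPillow_subset_Iic k)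

lemma pi_dep_Iio (hQ : T.IsNuisance Q) (a : Bool) : DependsOn (Q.pi a) (Set.Iio T.A) :=
  (hQ.pi_dep a).mono (markovPillow_subset_Iio _)

lemma mu_dep_Iio (hQ : T.IsNuisance Q) : DependsOn Q.mu (Set.Iio T.Y) :=
  hQ.mu_dep.mono (markovPillow_subset_Iio _)

end IsNuisance

/-! ### Disintegration of the law along the topological order. -/

section Tower

variable {P : Measure (∀ v, S v)} [IsProbabilityMeasure P] {Q : Nuisance V S}

/-- The law of a mediator given all its predecessors has the density `f_k`. -/
lemma IsTruth.lintegral_tower (hQ : T.IsTruth P Q) (hfact : T.TopologicalFactorization P)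
    {k : V} (hk : k ∈ T.Z) {F : (∀ v, S v) → ℝ≥0∞} (hF : Measurable F)
    (hd : DependsOn F (Set.Iic k)) :
    ∫⁻ o, F o ∂P = ∫⁻ o, ∫⁻ z, ENNReal.ofReal (Q.f k (Function.update o k z)) *
      F (Function.update o k z) ∂(T.ν k) ∂P := by
  have := T.sigmaFinite k
  obtain ⟨o₀⟩ : Nonempty (∀ v, S v) := nonempty_of_isProbabilityMeasure P
  have hup : Measurable fun p : (∀ v, S v) × S k => Function.update p.1 k p.2 :=
    measurable_update'
  have hf : Measurable fun p : (∀ v, S v) × S k =>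
      ENNReal.ofReal (Q.f k (Function.update p.1 k p.2)) :=
    ((hQ.nuisance.f_meas k hk).comp hup).ennreal_ofReal
  have hle : cylinderEvents (X := S) (Set.Iio k) ≤ MeasurableSpace.pi := cylinderEvents_le_pi
  have hfr : Measurable (freeze (Set.Iio k) o₀) := (measurable_freeze (Set.Iio k) o₀).mono hle le_rfl
  have hm1 : Measurable fun o : ∀ v, S v => (freeze (Set.Iio k) o₀ o, o k) :=
    hfr.prodMk (measurable_pi_apply k)
  have hm2 : Measurable fun p : (∀ v, S v) × S k => (freeze (Set.Iio k) o₀ p.1, p.2) :=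
    (hfr.comp measurable_fst).prodMk measurable_snd
  -- The defining property of `f_k`, upgraded by the factorization from the pillow to all
  -- predecessors, in the form of joint probabilities of a past event and an event for the
  -- coordinate `k`.
  have hcond : ∀ t : Set (S k), MeasurableSet t → ∀ D, MeasurableSet[cylinderEvents (X := S) (Set.Iio k)] D →
      P (D ∩ (fun o => o k) ⁻¹' t) =
        ∫⁻ o in D, ∫⁻ z in t, ENNReal.ofReal (Q.f k (Function.update o k z)) ∂(T.ν k) ∂P := by
    intro t ht D hD
    have ht' : MeasurableSet ((fun o : ∀ v, S v => o k) ⁻¹' t) := measurable_pi_apply k ht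
    have hind : Integrable (((fun o : ∀ v, S v => o k) ⁻¹' t).indicator fun _ => (1 : ℝ)) P :=
      (integrable_const 1).indicator ht'
    have e := (hQ.f_eq k hk t ht).trans (hfact k t ht).symm
    have hi : Integrable (fun o => ∫ z in t, Q.f k (Function.update o k z) ∂(T.ν k)) P :=
      integrable_condExp.congr e.symm
    have h1 : ∀ o, ∫⁻ z in t, ENNReal.ofReal (Q.f k (Function.update o k z)) ∂(T.ν k) =
        ENNReal.ofReal (∫ z in t, Q.f k (Function.update o k z) ∂(T.ν k)) := by
      intro o
      have hmz : Measurable fun z => Q.f k (Function.update o k z) :=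
        (hQ.nuisance.f_meas k hk).comp (measurable_update o)
      rw [ofReal_integral_eq_lintegral_ofReal]
      · refine Integrable.restrict ⟨hmz.aestronglyMeasurable, ?_⟩
        rw [hasFiniteIntegral_iff_ofReal (ae_of_all _ fun z => hQ.nuisance.f_nonneg k hk _),
          hQ.nuisance.f_density k hk]
        simp
      · exact ae_of_all _ fun z => hQ.nuisance.f_nonneg k hk _
    simp_rw [h1]
    rw [← ofReal_integral_eq_lintegral_ofReal hi.restrict
      (ae_of_all _ fun o => integral_nonneg fun z => hQ.nuisance.f_nonneg k hk _),
      setIntegral_congr_ae (g := P[((fun o : ∀ v, S v => o k) ⁻¹' t).indicator fun _ => (1 : ℝ) |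
        cylinderEvents (X := S) (Set.Iio k)]) (hle D hD) (e.mono fun o ho _ => ho),
      setIntegral_condExp hle hind hD, integral_indicator ht', integral_const, smul_eq_mul, mul_one,
      measureReal_restrict_apply_univ, measureReal_restrict_apply ht', measureReal_def,
      ENNReal.ofReal_toReal (measure_ne_top _ _), Set.inter_comm]
  -- Freezing gives a version of the past that is measurable for the past σ-algebra. Equality on
  -- rectangles then determines the joint law of the past and the coordinate `k`.
  have hext : P.map (fun o => (freeze (Set.Iio k) o₀ o, o k)) =
      ((P.prod (T.ν k)).withDensity
        fun p => ENNReal.ofReal (Q.f k (Function.update p.1 k p.2))).map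
          fun p => (freeze (Set.Iio k) o₀ p.1, p.2) := by
    have := Measure.isProbabilityMeasure_map (μ := P) hm1.aemeasurable
    refine Measure.ext_prod fun {s t} hs ht => ?_
    have hD : MeasurableSet[cylinderEvents (X := S) (Set.Iio k)] (freeze (Set.Iio k) o₀ ⁻¹' s) :=
      measurable_freeze (Set.Iio k) o₀ hs
    rw [Measure.map_apply hm1 (hs.prod ht), Measure.map_apply hm2 (hs.prod ht),
      withDensity_apply _ (hm2 (hs.prod ht))]
    have e1 : (fun o => (freeze (Set.Iio k) o₀ o, o k)) ⁻¹' s ×ˢ t =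
        freeze (Set.Iio k) o₀ ⁻¹' s ∩ (fun o => o k) ⁻¹' t := rfl
    have e2 : (fun p : (∀ v, S v) × S k => (freeze (Set.Iio k) o₀ p.1, p.2)) ⁻¹' s ×ˢ t =
        (freeze (Set.Iio k) o₀ ⁻¹' s) ×ˢ t := rfl
    rw [e1, e2, hcond t ht _ hD, ← Measure.prod_restrict, lintegral_prod _ hf.aemeasurable]
  have hF' : ∀ (o : ∀ v, S v) (z : S k),
      F (Function.update (freeze (Set.Iio k) o₀ o) k z) = F (Function.update o k z) := by
    intro o z
    refine hd fun i hi => ?_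
    rcases eq_or_lt_of_le (Set.mem_Iic.1 hi) with rfl | hlt
    · simp
    · rw [Function.update_of_ne hlt.ne, Function.update_of_ne hlt.ne,
        freeze_apply_of_mem _ _ (Set.mem_Iio.2 hlt)]
  have hG : Measurable fun p : (∀ v, S v) × S k => F (Function.update p.1 k p.2) := hF.comp hup
  calc ∫⁻ o, F o ∂P
      = ∫⁻ o, F (Function.update (freeze (Set.Iio k) o₀ o) k (o k)) ∂P := by
        simp_rw [hF', Function.update_eq_self]
    _ = ∫⁻ p, F (Function.update p.1 k p.2)
          ∂(P.map (fun o => (freeze (Set.Iio k) o₀ o, o k))) := by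
        rw [lintegral_map hG hm1]
    _ = _ := by
        rw [hext, lintegral_map hG hm2]
        simp only [hF']
        rw [lintegral_withDensity_eq_lintegral_mul _ hf hG, lintegral_prod _ (hf.mul hG).aemeasurable]
        rfl

/-- The Bochner form of `IsTruth.lintegral_tower`. -/
lemma IsTruth.integral_tower (hQ : T.IsTruth P Q) (hfact : T.TopologicalFactorization P)
    {k : V} (hk : k ∈ T.Z) {F : (∀ v, S v) → ℝ} (hF : Measurable F)
    (hd : DependsOn F (Set.Iic k)) (hi : Integrable F P) :
    Integrable (fun p : (∀ v, S v) × S k => Q.f k (Function.update p.1 k p.2) *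
      F (Function.update p.1 k p.2)) (P.prod (T.ν k)) ∧
    ∫ o, F o ∂P = ∫ o, ∫ z, Q.f k (Function.update o k z) *
      F (Function.update o k z) ∂(T.ν k) ∂P := by
  have := T.sigmaFinite k
  have hup : Measurable fun p : (∀ v, S v) × S k => Function.update p.1 k p.2 :=
    measurable_update'
  have hf : Measurable fun p : (∀ v, S v) × S k => Q.f k (Function.update p.1 k p.2) :=
    (hQ.nuisance.f_meas k hk).comp hup
  have hm : Measurable fun p : (∀ v, S v) × S k => Q.f k (Function.update p.1 k p.2) *
      F (Function.update p.1 k p.2) := hf.mul (hF.comp hup)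
  have hfn := hQ.nuisance.f_nonneg k hk
  obtain ⟨h1, h2⟩ := integrable_iff_and_integral_eq_of_lintegral_ofReal (μ := P)
    (ν := P.prod (T.ν k)) (f := F) (g := fun p => Q.f k (Function.update p.1 k p.2) *
      F (Function.update p.1 k p.2)) hF.aestronglyMeasurable hm.aestronglyMeasurable
    (by
      rw [lintegral_prod _ hm.ennreal_ofReal.aemeasurable,
        hQ.lintegral_tower hfact hk hF.ennreal_ofReal fun x y h => by rw [hd h]]
      simp only [ENNReal.ofReal_mul (hfn _)])
    (by
      have hFn : Measurable fun o => ENNReal.ofReal (-F o) := hF.neg.ennreal_ofReal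
      have hmn : Measurable fun p : (∀ v, S v) × S k => ENNReal.ofReal
          (-(Q.f k (Function.update p.1 k p.2) * F (Function.update p.1 k p.2))) :=
        hm.neg.ennreal_ofReal
      rw [lintegral_prod _ hmn.aemeasurable,
        hQ.lintegral_tower hfact hk hFn fun x y h => by rw [hd h]]
      simp only [← mul_neg, ENNReal.ofReal_mul (hfn _)])
  refine ⟨h1.1 hi, ?_⟩
  rw [h2, integral_prod _ (h1.1 hi)]

/-- The treatment given all its predecessors has the law `π`. -/
lemma IsTruth.lintegral_ind (hQ : T.IsTruth P Q) (hfact : T.TopologicalFactorization P)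
    (a : Bool) {F : (∀ v, S v) → ℝ≥0∞} (hF : Measurable F) (hd : DependsOn F (Set.Iio T.A)) :
    ∫⁻ o, ENNReal.ofReal (T.ind a o) * F o ∂P = ∫⁻ o, ENNReal.ofReal (Q.pi a o) * F o ∂P := by
  have hle : cylinderEvents (X := S) (Set.Iio T.A) ≤ MeasurableSpace.pi := cylinderEvents_le_pi
  have hs : MeasurableSet {s : S T.A | T.level s = a} :=
    T.level.measurable (measurableSet_singleton a)
  have hindeq : T.ind a = ((fun o : ∀ v, S v => o T.A) ⁻¹' {s | T.level s = a}).indicator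
      fun _ => (1 : ℝ) := by
    funext o
    simp [ind, Set.indicator_apply]
  have hce : Q.pi a =ᵐ[P] P[T.ind a | cylinderEvents (X := S) (Set.Iio T.A)] := by
    have := hfact T.A _ hs
    rw [← hindeq] at this
    exact (hQ.pi_eq a).trans this.symm
  have hii : Integrable (T.ind a) P :=
    Integrable.of_bound (measurable_ind a).aestronglyMeasurable 1
      (ae_of_all _ fun o => by
        rw [Real.norm_of_nonneg (ind_nonneg a o)]; exact ind_le_one a o)
  have hip : Integrable (Q.pi a) P := integrable_condExp.congr hce.symm
  -- The densities `𝕀(A = a)` and `π(a | ·)` define the same measure on the σ-algebra of the past,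
  -- and `F` is measurable for that σ-algebra.
  have hm : (P.withDensity fun o => ENNReal.ofReal (T.ind a o)).trim hle =
      (P.withDensity fun o => ENNReal.ofReal (Q.pi a o)).trim hle := by
    refine @Measure.ext _ (cylinderEvents (X := S) (Set.Iio T.A)) _ _ fun D hD => ?_
    rw [trim_measurableSet_eq hle hD, trim_measurableSet_eq hle hD,
      withDensity_apply _ (hle D hD), withDensity_apply _ (hle D hD),
      ← ofReal_integral_eq_lintegral_ofReal hii.restrict (ae_of_all _ fun o => ind_nonneg a o),
      ← ofReal_integral_eq_lintegral_ofReal hip.restrict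
        (ae_of_all _ fun o => hQ.nuisance.pi_nonneg a o),
      setIntegral_congr_ae (hle D hD) (hce.mono fun o ho _ => ho), setIntegral_condExp hle hii hD]
  have hFm := hd.measurable_cylinderEvents hF
  have e := congrArg (fun m => ∫⁻ o, F o ∂m) hm
  simp only [lintegral_trim hle hFm] at e
  rw [lintegral_withDensity_eq_lintegral_mul _ (measurable_ind a).ennreal_ofReal hF,
    lintegral_withDensity_eq_lintegral_mul _ (hQ.nuisance.pi_meas a).ennreal_ofReal hF] at e
  simpa using e

end Tower

end CausalModel

/-! ### Conditional independence and conditional expectations of functions. -/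

section CondExp

variable {α : Type*} {m m' mα : MeasurableSpace α} {μ : Measure α} [IsProbabilityMeasure μ]

lemma integrable_and_integral_mul_condExp (hm : m ≤ mα) {g f : α → ℝ}
    (hg : AEStronglyMeasurable[m] g μ) (hgf : Integrable (fun x => g x * f x) μ)
    (hf : Integrable f μ) :
    Integrable (fun x => g x * (μ[f | m]) x) μ ∧
      ∫ x, g x * (μ[f | m]) x ∂μ = ∫ x, g x * f x ∂μ := by
  have e : μ[fun x => g x * f x | m] =ᵐ[μ] fun x => g x * (μ[f | m]) x :=
    condExp_mul_of_aestronglyMeasurable_left hg hgf hf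
  exact ⟨integrable_condExp.congr e, by rw [← integral_congr_ae e, integral_condExp hm]⟩

/-- If the conditional probabilities of all events of `X` agree given `m` and `m' ≤ m`, then so
do the conditional expectations of all integrable functions of `X`. -/
lemma condExp_comp_ae_eq_of_indicator {E : Type*} [MeasurableSpace E] (hm : m ≤ mα)
    (hm' : m' ≤ m) {X : α → E} (hX : Measurable X)
    (h : ∀ t : Set E, MeasurableSet t → μ[(X ⁻¹' t).indicator (fun _ => (1 : ℝ)) | m] =ᵐ[μ]
      μ[(X ⁻¹' t).indicator (fun _ => (1 : ℝ)) | m'])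
    {φ : E → ℝ} (hφ : Measurable φ) (hi : Integrable (fun x => φ (X x)) μ) :
    μ[fun x => φ (X x) | m'] =ᵐ[μ] μ[fun x => φ (X x) | m] := by
  refine ae_eq_condExp_of_forall_setIntegral_eq hm hi
    (fun s _ _ => integrable_condExp.integrableOn) (fun D hD _ => ?_)
    (stronglyMeasurable_condExp.aestronglyMeasurable.mono hm')
  have hm0 : m' ≤ mα := hm'.trans hm
  -- Self-adjointness of conditional expectation turns integration of an `m'`-conditional
  -- expectation over `D` into integration of the original function against the weight `p = E[1_D |
  -- m']`.
  set p : α → ℝ := μ[D.indicator (fun _ => (1 : ℝ)) | m'] with hp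
  have hDi : Integrable (D.indicator fun _ => (1 : ℝ)) μ :=
    (integrable_const 1).indicator (hm D hD)
  have hpm : AEStronglyMeasurable[m'] p μ := stronglyMeasurable_condExp.aestronglyMeasurable
  have hpm0 : Measurable p := (stronglyMeasurable_condExp.mono hm0).measurable
  have hpb : ∀ᵐ x ∂μ, |p x| ≤ 1 := by
    refine ae_bdd_abs_condExp_of_ae_bdd_abs (R := (1 : ℝ)) (ae_of_all _ fun x => ?_)
    by_cases hx : x ∈ D <;> simp [hx]
  have hp0 : 0 ≤ᵐ[μ] p := condExp_nonneg (ae_of_all _ fun x => by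
    by_cases hx : x ∈ D <;> simp [hx])
  have hpi : Integrable p μ := integrable_condExp
  have hbm : ∀ {f : α → ℝ}, Integrable f μ → Integrable (fun x => p x * f x) μ := fun hf =>
    hf.bdd_mul (c := 1) hpm0.aestronglyMeasurable (by simpa using hpb)
  have hind : ∀ {f : α → ℝ}, Integrable f μ →
      Integrable (fun x => D.indicator (fun _ => (1 : ℝ)) x * f x) μ := fun hf =>
    hf.bdd_mul (c := 1) hDi.aestronglyMeasurable (ae_of_all _ fun x => by
      by_cases hx : x ∈ D <;> simp [hx])
  have hindD : ∀ f : α → ℝ, ∫ x in D, f x ∂μ = ∫ x, D.indicator (fun _ => (1 : ℝ)) x * f x ∂μ := by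
    intro f
    rw [← integral_indicator (hm D hD)]
    refine integral_congr_ae (ae_of_all _ fun x => ?_)
    by_cases hx : x ∈ D <;> simp [hx]
  have hDm : AEStronglyMeasurable[m] (D.indicator fun _ => (1 : ℝ)) μ :=
    (stronglyMeasurable_const.indicator hD).aestronglyMeasurable
  -- the set integral of an `m'`-conditional expectation over `D`
  have hswap : ∀ {f : α → ℝ}, Integrable f μ →
      ∫ x, D.indicator (fun _ => (1 : ℝ)) x * (μ[f | m']) x ∂μ = ∫ x, p x * f x ∂μ := by
    intro f hf
    rw [← (integrable_and_integral_mul_condExp hm0 hpm (hbm hf) hf).2]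
    have e := (integrable_and_integral_mul_condExp (g := μ[f | m'])
      (f := D.indicator fun _ => (1 : ℝ)) hm0
      stronglyMeasurable_condExp.aestronglyMeasurable
      (by simpa only [mul_comm] using hind integrable_condExp) hDi).2
    simpa only [mul_comm] using e.symm
  have hpE : ∀ t : Set E, MeasurableSet t →
      ∫ x, p x * (X ⁻¹' t).indicator (fun _ => (1 : ℝ)) x ∂μ = μ.real (D ∩ X ⁻¹' t) := by
    intro t ht
    have hti : Integrable ((X ⁻¹' t).indicator fun _ => (1 : ℝ)) μ :=
      (integrable_const 1).indicator (hX ht)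
    rw [← hswap hti]
    have e : ∀ᵐ x ∂μ, D.indicator (fun _ => (1 : ℝ)) x *
        (μ[(X ⁻¹' t).indicator (fun _ => (1 : ℝ)) | m']) x =
        D.indicator (fun _ => (1 : ℝ)) x *
        (μ[(X ⁻¹' t).indicator (fun _ => (1 : ℝ)) | m]) x := by
      filter_upwards [h t ht] with x hx
      rw [hx]
    rw [integral_congr_ae e, (integrable_and_integral_mul_condExp hm hDm (hind hti) hti).2,
      ← hindD, integral_indicator (hX ht), integral_const, smul_eq_mul, mul_one,
      measureReal_restrict_apply_univ, measureReal_restrict_apply (hX ht), Set.inter_comm]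
  -- The hypothesis on events says that restricting to `D` and weighting by `p` give `X` the same
  -- law, which extends the equality to integrals of every `φ (X)`.
  have hmeas : (μ.restrict D).map X = (μ.withDensity fun x => ENNReal.ofReal (p x)).map X := by
    refine Measure.ext fun t ht => ?_
    rw [Measure.map_apply hX ht, Measure.map_apply hX ht, withDensity_apply _ (hX ht),
      Measure.restrict_apply (hX ht),
      ← ofReal_integral_eq_lintegral_ofReal hpi.restrict (ae_restrict_of_ae hp0)]
    have e : ∫ x in X ⁻¹' t, p x ∂μ = μ.real (D ∩ X ⁻¹' t) := by
      rw [← hpE t ht, ← integral_indicator (hX ht)]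
      refine integral_congr_ae (ae_of_all _ fun x => ?_)
      by_cases hx : x ∈ X ⁻¹' t <;> simp [hx]
    rw [e, measureReal_def, ENNReal.ofReal_toReal (measure_ne_top _ _), Set.inter_comm]
  have e := congrArg (fun ρ => ∫ x, φ x ∂ρ) hmeas
  beta_reduce at e
  rw [integral_map hX.aemeasurable hφ.aestronglyMeasurable,
    integral_map hX.aemeasurable hφ.aestronglyMeasurable,
    integral_withDensity_eq_integral_toReal_smul hpm0.ennreal_ofReal
      (ae_of_all _ fun _ => ENNReal.ofReal_lt_top)] at e
  rw [e, hindD, hswap hi]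
  refine integral_congr_ae ?_
  filter_upwards [hp0] with x hx
  rw [ENNReal.toReal_ofReal hx, smul_eq_mul]

end CondExp

/-! ### Changing the treatment level. -/

namespace CausalModel

variable {V : Type u} [LinearOrder V] [Fintype V] {S : V → Type w} [∀ v, MeasurableSpace (S v)]
  {T : CausalModel V S}
variable {P : Measure (∀ v, S v)} [IsProbabilityMeasure P] {Q : Nuisance V S}

lemma setA_congr {β : Type*} {f : (∀ v, S v) → β} {s : Set V} (hf : DependsOn f s) (a : Bool)
    {x y : ∀ v, S v} (h : ∀ i ∈ s \ {T.A}, x i = y i) : f (T.setA x a) = f (T.setA y a) :=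
  DependsOn.comp_setA hf a h

lemma measurable_y : Measurable T.y := T.measurable_outcome.comp (measurable_pi_apply T.Y)

/-- The outcome regression, given all predecessors of the outcome. -/
lemma IsTruth.integral_outcome (hQ : T.IsTruth P Q) (hfact : T.TopologicalFactorization P)
    (hy : Integrable T.y P) {G : (∀ v, S v) → ℝ} (hG : Measurable G)
    (hd : DependsOn G (Set.Iio T.Y)) (hi : Integrable (fun o => G o * T.y o) P) :
    Integrable (fun o => G o * Q.mu o) P ∧ ∫ o, G o * Q.mu o ∂P = ∫ o, G o * T.y o ∂P := by
  have hle : cylinderEvents (X := S) (Set.Iio T.Y) ≤ MeasurableSpace.pi := cylinderEvents_le_pi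
  have hmu : Q.mu =ᵐ[P] P[T.y | cylinderEvents (X := S) (Set.Iio T.Y)] :=
    hQ.mu_eq.trans (condExp_comp_ae_eq_of_indicator hle
      (cylinderEvents_mono (markovPillow_subset_Iio _)) (measurable_pi_apply T.Y) (hfact T.Y)
      T.measurable_outcome hy)
  have hGm : AEStronglyMeasurable[cylinderEvents (X := S) (Set.Iio T.Y)] G P :=
    (hd.measurable_cylinderEvents hG).stronglyMeasurable.aestronglyMeasurable
  obtain ⟨h1, h2⟩ := integrable_and_integral_mul_condExp hle hGm hi hy
  have e : ∀ᵐ o ∂P, G o * Q.mu o =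
      G o * (P[T.y | cylinderEvents (X := S) (Set.Iio T.Y)]) o := by
    filter_upwards [hmu] with o ho
    rw [ho]
  exact ⟨h1.congr (e.mono fun o ho => ho.symm), by rw [integral_congr_ae e, h2]⟩

/-- An initial segment of the mediators. -/
def IsInitial (T : CausalModel V S) (D : Finset V) : Prop :=
  D ⊆ T.Z ∧ ∀ j ∈ T.Z, ∀ i ∈ D, j ≤ i → j ∈ D

lemma IsInitial.of_insert {D : Finset V} {k : V} (h : T.IsInitial (insert k D))
    (hk : ∀ i ∈ D, i < k) : T.IsInitial D := by
  refine ⟨fun i hi => h.1 (Finset.mem_insert_of_mem hi), fun j hj i hi hji => ?_⟩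
  have := h.2 j hj i (Finset.mem_insert_of_mem hi) hji
  rcases Finset.mem_insert.1 this with rfl | h'
  · exact absurd (hk i hi) (not_lt.2 hji)
  · exact h'

/-- In an induction that adds the mediators in increasing order, this identifies the set reached so
far with the mediators before `k`, the ones that index `𝓡_k`. -/
lemma IsInitial.eq_filter_lt {D : Finset V} {k : V} (h : T.IsInitial (insert k D))
    (hk : ∀ i ∈ D, i < k) : D = T.Z.filter (· < k) := by
  ext j
  rw [Finset.mem_filter]
  refine ⟨fun hj => ⟨h.1 (Finset.mem_insert_of_mem hj), hk j hj⟩, fun ⟨hj, hjk⟩ => ?_⟩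
  rcases Finset.mem_insert.1 (h.2 j hj k (Finset.mem_insert_self _ _) hjk.le) with rfl | h'
  · exact absurd hjk (lt_irrefl _)
  · exact h'

lemma isInitial_filter_lt (v : V) : T.IsInitial (T.Z.filter (· < v)) :=
  ⟨Finset.filter_subset _ _, fun _ hj _ hi hji =>
    Finset.mem_filter.2 ⟨hj, hji.trans_lt (Finset.mem_filter.1 hi).2⟩⟩

lemma isInitial_filter_le (v : V) : T.IsInitial (T.Z.filter (· ≤ v)) :=
  ⟨Finset.filter_subset _ _, fun _ hj _ hi hji =>
    Finset.mem_filter.2 ⟨hj, hji.trans (Finset.mem_filter.1 hi).2⟩⟩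

/-- The vertices up to the treatment, together with `D`. -/
def upTo (T : CausalModel V S) (D : Finset V) : Set V := Set.Iic T.A ∪ (D : Set V)

lemma Iic_eq_upTo {k : V} (hk : k ∈ T.Z) : Set.Iic k = T.upTo (T.Z.filter (· ≤ k)) := by
  ext v
  simp only [upTo, Set.mem_Iic, Set.mem_union, Finset.mem_coe, Finset.mem_filter, mem_Z]
  constructor
  · intro hv
    rcases le_or_gt v T.A with h | h
    · exact Or.inl h
    · exact Or.inr ⟨⟨h, (hv.trans_lt (lt_Y_of_mem_Z hk)).ne⟩, hv⟩
  · rintro (h | h)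
    · exact h.trans (mem_Z.1 hk).1.le
    · exact h.2

lemma Iio_eq_upTo {k : V} (hk : T.A < k) : Set.Iio k = T.upTo (T.Z.filter (· < k)) := by
  ext v
  simp only [upTo, Set.mem_Iic, Set.mem_Iio, Set.mem_union, Finset.mem_coe, Finset.mem_filter,
    mem_Z]
  constructor
  · intro hv
    rcases le_or_gt v T.A with h | h
    · exact Or.inl h
    · exact Or.inr ⟨⟨h, (hv.trans_le (T.le_Y k)).ne⟩, hv⟩
  · rintro (h | h)
    · exact h.trans_lt hk
    · exact h.2

lemma filter_le_eq_insert {k : V} (hk : k ∈ T.Z) :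
    T.Z.filter (· ≤ k) = insert k (T.Z.filter (· < k)) := by
  ext j
  simp only [Finset.mem_filter, Finset.mem_insert, le_iff_lt_or_eq]
  constructor
  · rintro ⟨h, h1 | h1⟩
    · exact Or.inr ⟨h, h1⟩
    · exact Or.inl h1
  · rintro (rfl | h)
    · exact ⟨hk, Or.inr rfl⟩
    · exact ⟨h.1, Or.inl h.2⟩

/-- The ratio of the densities at two opposite treatment levels. -/
noncomputable def levelRatio (T : CausalModel V S) (Q : Nuisance V S) (a : Bool) (j : V)
    (o : ∀ v, S v) : ℝ := Q.f j (T.setA o a) / Q.f j (T.setA o (!a))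

lemma IsNuisance.measurable_levelRatio (hQ : T.IsNuisance Q) (a : Bool) {j : V} (hj : j ∈ T.Z) :
    Measurable (T.levelRatio Q a j) :=
  ((hQ.f_meas j hj).comp (measurable_setA a)).div ((hQ.f_meas j hj).comp (measurable_setA !a))

lemma IsNuisance.dependsOn_levelRatio (hQ : T.IsNuisance Q) (a : Bool) {j : V} (hj : j ∈ T.Z) :
    DependsOn (T.levelRatio Q a j) (Set.Iic j \ {T.A}) := by
  intro x y h
  simp only [levelRatio]
  rw [setA_congr (hQ.f_dep_Iic hj) a h, setA_congr (hQ.f_dep_Iic hj) (!a) h]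

lemma update_eq_off {k : V} {s : Set V} (hk : k ∉ s) (o : ∀ v, S v) (z : S k) :
    ∀ i ∈ s, Function.update o k z i = o i := fun i hi =>
  Function.update_of_ne (fun h => hk (by rw [← h]; exact hi)) _ _

/-- Change of the treatment level in an integral over the variables that precede the outcome. -/
lemma IsTruth.lintegral_switch (hQ : T.IsTruth P Q) (hfact : T.TopologicalFactorization P)
    (hpos : T.Positivity P Q) (a : Bool) (D : Finset V) (hD : T.IsInitial D)
    {F : (∀ v, S v) → ℝ≥0∞} (hF : Measurable F) (hd : DependsOn F (T.upTo D)) :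
    ∫⁻ o, ENNReal.ofReal (T.ind a o) * F o ∂P =
      ∫⁻ o, ENNReal.ofReal (T.ind (!a) o) * (ENNReal.ofReal (Q.pi a o / Q.pi (!a) o) *
        (∏ j ∈ D, ENNReal.ofReal (T.levelRatio Q a j o)) * F (T.setA o a)) ∂P := by
  induction D using Finset.induction_on_max generalizing F with
  | empty =>
    have hFs : Measurable fun o => F (T.setA o a) := hF.comp (measurable_setA a)
    have hds : DependsOn (fun o => F (T.setA o a)) (Set.Iio T.A) :=
      (DependsOn.comp_setA hd a).mono fun v hv => by
        simp only [upTo, Finset.coe_empty, Set.union_empty, Set.mem_sdiff, Set.mem_Iic,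
          Set.mem_singleton_iff] at hv
        exact lt_of_le_of_ne hv.1 hv.2
    have hpm : Measurable fun o => ENNReal.ofReal (Q.pi a o / Q.pi (!a) o) :=
      ((hQ.nuisance.pi_meas a).div (hQ.nuisance.pi_meas !a)).ennreal_ofReal
    simp only [Finset.prod_empty, mul_one]
    -- Without mediators both sides reduce to integrals of functions of the pre-treatment variables:
    -- the left side acquires the factor `π(a)`, the right side `π(!a)` times the ratio `π(a) /
    -- π(!a)`.
    rw [hQ.lintegral_ind hfact (!a)
      (F := fun o => ENNReal.ofReal (Q.pi a o / Q.pi (!a) o) * F (T.setA o a)) (hpm.mul hFs)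
      fun x y h => by
        have := hds h
        beta_reduce at this ⊢
        rw [hQ.nuisance.pi_dep_Iio a h, hQ.nuisance.pi_dep_Iio (!a) h, this]]
    calc ∫⁻ o, ENNReal.ofReal (T.ind a o) * F o ∂P
        = ∫⁻ o, ENNReal.ofReal (T.ind a o) * F (T.setA o a) ∂P := by
          refine lintegral_congr fun o => ?_
          rcases ind_eq_zero_or (T := T) a o with h0 | h0
          · simp [h0]
          · rw [h0]
      _ = ∫⁻ o, ENNReal.ofReal (Q.pi a o) * F (T.setA o a) ∂P := hQ.lintegral_ind hfact a hFs hds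
      _ = _ := by
          refine lintegral_congr_ae ?_
          filter_upwards [hpos] with o ho
          rw [← mul_assoc, ← ENNReal.ofReal_mul (hQ.nuisance.pi_nonneg _ o),
            mul_div_cancel₀ _ (ho !a).1.ne']
  | insert k D hlt ih =>
    have hkD : k ∉ D := fun h => lt_irrefl _ (hlt k h)
    have hkZ : k ∈ T.Z := hD.1 (Finset.mem_insert_self _ _)
    have hkA := ne_A_of_mem_Z hkZ
    have hDi := hD.of_insert hlt
    have hDe := hD.eq_filter_lt hlt
    have hupIic : T.upTo (insert k D) = Set.Iic k := by
      rw [Iic_eq_upTo hkZ, filter_le_eq_insert hkZ, ← hDe]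
    have hupIio : T.upTo D = Set.Iio k := by
      rw [Iio_eq_upTo (mem_Z.1 hkZ).1, ← hDe]
    rw [hupIic] at hd
    have hAk : T.A ∈ Set.Iic k := (mem_Z.1 hkZ).1.le
    have hn := hQ.nuisance
    have hfm := hn.f_meas k hkZ
    have hfd := hn.f_dep_Iic hkZ
    have := T.sigmaFinite k
    set g : Bool → (∀ v, S v) → ℝ := fun b o => Q.f k (T.setA o b) with hg
    have hgm : ∀ b, Measurable (g b) := fun b => hfm.comp (measurable_setA b)
    have hgd : ∀ b, DependsOn (g b) (Set.Iic k) := fun b =>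
      (DependsOn.comp_setA hfd b).mono Set.sdiff_subset
    -- Positivity holds only `P`-almost surely, whereas the integral over `z` runs over all of `ν
    -- k`. Cutting `F` off where the density at the opposite level vanishes is harmless under `P`
    -- and makes the division below valid for every `z`.
    set F' : (∀ v, S v) → ℝ≥0∞ := fun o => F o * if 0 < g (!a) o then 1 else 0 with hF'
    have hF'm : Measurable F' := hF.mul
      (Measurable.ite (measurableSet_lt measurable_const (hgm _)) measurable_const measurable_const)
    have hF'd : DependsOn F' (Set.Iic k) := fun x y h => by simp only [hF', hd h, hgd (!a) h]
    set F₁ : (∀ v, S v) → ℝ≥0∞ := fun o =>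
      ∫⁻ z, ENNReal.ofReal (g a (Function.update o k z)) * F' (Function.update o k z) ∂(T.ν k)
      with hF₁
    have hF₁m : Measurable F₁ := by
      have : Measurable fun p : (∀ v, S v) × S k =>
          ENNReal.ofReal (g a (Function.update p.1 k p.2)) * F' (Function.update p.1 k p.2) :=
        ((hgm a).ennreal_ofReal.mul hF'm).comp measurable_update'
      exact this.lintegral_prod_right'
    have hF₁d : DependsOn F₁ (T.upTo D) := by
      rw [hupIio]
      intro x y h
      refine lintegral_congr fun z => ?_
      have hxy : ∀ i ∈ Set.Iic k, Function.update x k z i = Function.update y k z i := by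
        intro i hi
        rcases eq_or_lt_of_le (Set.mem_Iic.1 hi) with rfl | hlt
        · simp
        · rw [Function.update_of_ne hlt.ne, Function.update_of_ne hlt.ne]
          exact h i hlt
      rw [hgd a hxy, hF'd hxy]
    have hindu : ∀ b (o : ∀ v, S v) z, T.ind b (Function.update o k z) = T.ind b o := fun b o z =>
      dependsOn_ind b (update_eq_off (by simpa using hkA) o z)
    have hindd : ∀ b, DependsOn (T.ind b) (Set.Iic k) := fun b =>
      (dependsOn_ind b).mono (by simpa using hAk)
    calc ∫⁻ o, ENNReal.ofReal (T.ind a o) * F o ∂P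
        = ∫⁻ o, ENNReal.ofReal (T.ind a o) * F' o ∂P := by
          refine lintegral_congr_ae ?_
          filter_upwards [hpos] with o ho
          simp only [hF', hg, if_pos ((ho !a).2 k hkZ), mul_one]
      _ = ∫⁻ o, ENNReal.ofReal (T.ind a o) * F₁ o ∂P := by
          rw [hQ.lintegral_tower hfact hkZ (F := fun o => ENNReal.ofReal (T.ind a o) * F' o)
            ((measurable_ind a).ennreal_ofReal.mul hF'm)
            fun x y h => by beta_reduce; rw [hindd a h, hF'd h]]
          refine lintegral_congr fun o => ?_
          rcases ind_eq_zero_or (T := T) a o with h0 | h0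
          · simp [hindu, h0]
          · rw [hF₁, ← lintegral_const_mul' _ _ ENNReal.ofReal_ne_top]
            refine lintegral_congr fun z => ?_
            rw [hindu]
            simp only [hg]
            rw [setA_update hkA, h0]
            ring
      _ = _ := ih hDi hF₁m hF₁d
      _ = _ := by
          have hprodm : Measurable fun o : ∀ v, S v =>
              ∏ j ∈ D, ENNReal.ofReal (T.levelRatio Q a j o) :=
            Finset.measurable_prod _ fun j hj =>
              (hn.measurable_levelRatio a (hDi.1 hj)).ennreal_ofReal
          have hprodd : DependsOn (fun o : ∀ v, S v =>
              ∏ j ∈ D, ENNReal.ofReal (T.levelRatio Q a j o)) (Set.Iio k) := by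
            intro x y h
            refine Finset.prod_congr rfl fun j hj => ?_
            rw [hn.dependsOn_levelRatio a (hDi.1 hj) fun i hi => h i (lt_of_le_of_lt hi.1 (hlt j hj))]
          have hpm : Measurable fun o => ENNReal.ofReal (Q.pi a o / Q.pi (!a) o) :=
            ((hn.pi_meas a).div (hn.pi_meas !a)).ennreal_ofReal
          have hpd : DependsOn (fun o => ENNReal.ofReal (Q.pi a o / Q.pi (!a) o)) (Set.Iio k) := by
            intro x y h
            have h' : ∀ i ∈ Set.Iio T.A, x i = y i := fun i hi =>
              h i (lt_trans hi (mem_Z.1 hkZ).1)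
            simp only [hn.pi_dep_Iio a h', hn.pi_dep_Iio (!a) h']
          have hdr : DependsOn (T.levelRatio Q a k) (Set.Iic k) :=
            (hn.dependsOn_levelRatio a hkZ).mono Set.sdiff_subset
          simp only [Finset.prod_insert hkD]
          -- Start from the side with the ratios: integrating out `k` at level `!a` produces its
          -- density at that level, which the ratio of `k` converts into the density at level `a`.
          -- This is the integrand that the induction hypothesis was applied to.
          symm
          rw [hQ.lintegral_tower hfact hkZ (F := fun o => ENNReal.ofReal (T.ind (!a) o) *
              (ENNReal.ofReal (Q.pi a o / Q.pi (!a) o) * (ENNReal.ofReal (T.levelRatio Q a k o) *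
                ∏ j ∈ D, ENNReal.ofReal (T.levelRatio Q a j o)) * F (T.setA o a)))
            ((measurable_ind _).ennreal_ofReal.mul
            ((hpm.mul ((hn.measurable_levelRatio a hkZ).ennreal_ofReal.mul hprodm)).mul
              (hF.comp (measurable_setA a)))) fun x y h => by
              have h' : ∀ i ∈ Set.Iio k, x i = y i := fun i hi => h i (Set.mem_Iio.1 hi).le
              have h1 := hpd h'
              have h2 := hprodd h'
              beta_reduce at h1 h2 ⊢
              rw [hindd _ h, h1, h2, hdr h, setA_congr hd a fun i hi => h i hi.1]]
          refine lintegral_congr fun o => ?_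
          rcases ind_eq_zero_or (T := T) (!a) o with h0 | h0
          · simp [hindu, h0]
          · rw [hF₁, ← lintegral_const_mul' _ _ (ENNReal.mul_ne_top
              ENNReal.ofReal_ne_top (ENNReal.prod_ne_top fun j _ => ENNReal.ofReal_ne_top)),
              ← lintegral_const_mul' _ _ ENNReal.ofReal_ne_top]
            refine lintegral_congr fun z => ?_
            have hoff := update_eq_off (s := Set.Iio k) (by simp) o z
            have hpd' := hpd hoff
            have hprodd' := hprodd hoff
            simp only at hpd' hprodd'
            rw [hindu, hpd', hprodd']
            simp only [hg, levelRatio, hF']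
            rw [setA_update hkA, setA_update hkA, setA_update hkA, setA_update hkA, setA_setA, setA_setA, h0]
            split_ifs with hc
            · have e : ENNReal.ofReal (Q.f k (Function.update (T.setA o a) k z)) =
                  ENNReal.ofReal (Q.f k (Function.update o k z)) *
                    ENNReal.ofReal (Q.f k (Function.update (T.setA o a) k z) /
                      Q.f k (Function.update o k z)) := by
                rw [← ENNReal.ofReal_mul hc.le, mul_div_cancel₀ _ hc.ne']
              rw [e]
              ring
            · rw [ENNReal.ofReal_of_nonpos (not_lt.1 hc)]
              simp

end CausalModel

/-! ### The weights `𝓡_v` and their two representations. -/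

namespace CausalModel

variable {V : Type u} [LinearOrder V] [Fintype V] {S : V → Type w} [∀ v, MeasurableSpace (S v)]
  {T : CausalModel V S}

section Weights

/-- The product of the density ratios of the vertices of `D` in `𝓜`. -/
noncomputable def weightM (T : CausalModel V S) (Q : Nuisance V S) (D : Finset V)
    (o : ∀ v, S v) : ℝ := ∏ i ∈ D.filter (· ∈ T.M), T.fr Q i o

/-- The product of the density ratios of the treatment and the vertices of `D` in `𝓛`. -/
noncomputable def weightL (T : CausalModel V S) (Q : Nuisance V S) (D : Finset V)
    (o : ∀ v, S v) : ℝ := T.frA Q o * ∏ i ∈ D.filter (· ∈ T.L), T.fr Q i o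

lemma not_a₁ : (!T.a₁) = T.a₀ := by simp [a₁]

lemma lev_of_mem {v : V} (hv : v ∈ T.L) : T.lev v = T.a₁ := by simp [lev, hv]

lemma lev_of_notMem {v : V} (hv : v ∉ T.L) : T.lev v = T.a₀ := by simp [lev, hv]

lemma lt_of_mem_M {v : V} (hv : v ∈ T.M) : T.A < v := by
  simp only [M, Finset.mem_filter] at hv
  exact hv.2.1

lemma le_of_mem_L {v : V} (hv : v ∈ T.L) : T.A ≤ v := by
  simp only [L, Finset.mem_filter] at hv
  exact hv.2.1

/-- Since `Y` is last, every factor in the product belongs to a mediator, so `𝓡_v` becomes the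
weight of an initial segment and inductions over initial segments apply. -/
lemma R_of_mem (Q : Nuisance V S) {v : V} (hv : v ∈ T.L) :
    T.R Q v = T.weightM Q (T.Z.filter (· < v)) := by
  funext o
  simp only [R, hv, if_true, weightM]
  refine Finset.prod_congr ?_ fun _ _ => rfl
  ext i
  simp only [Finset.mem_filter, mem_Z]
  exact ⟨fun h => ⟨⟨⟨lt_of_mem_M h.1, (h.2.trans_le (T.le_Y v)).ne⟩, h.2⟩, h.1⟩,
    fun h => ⟨h.2, h.1.2⟩⟩

lemma R_of_notMem (Q : Nuisance V S) {v : V} (hv : v ∉ T.L) :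
    T.R Q v = T.weightL Q (T.Z.filter (· < v)) := by
  funext o
  simp only [R, hv, if_false, weightL]
  congr 1
  refine Finset.prod_congr ?_ fun _ _ => rfl
  ext i
  simp only [Finset.mem_filter, mem_Z, Finset.mem_erase]
  exact ⟨fun h => ⟨⟨⟨lt_of_le_of_ne (le_of_mem_L h.2.1) (Ne.symm h.1),
    (h.2.2.trans_le (T.le_Y v)).ne⟩, h.2.2⟩, h.2.1⟩, fun h => ⟨h.1.1.1.ne', h.2, h.1.2⟩⟩

/-- A vertex contributes no factor to the weight on its own side. Hence `𝓡_k` serves for the segment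
before `k` as well as for the one including `k`, which is what makes the telescoping possible. -/
lemma weightM_insert_of_mem (Q : Nuisance V S) {D : Finset V} {k : V} (hk : k ∈ T.L)
    (hA : T.A < k) : T.weightM Q (insert k D) = T.weightM Q D := by
  funext o
  rw [weightM, Finset.filter_insert, if_neg fun h => (mem_M_iff hA).1 h hk, weightM]

lemma weightL_insert_of_notMem (Q : Nuisance V S) {D : Finset V} {k : V} (hk : k ∉ T.L) :
    T.weightL Q (insert k D) = T.weightL Q D := by
  funext o
  rw [weightL, Finset.filter_insert, if_neg hk, weightL]

variable {Q : Nuisance V S}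

namespace IsNuisance

lemma measurable_fr (hQ : T.IsNuisance Q) {k : V} (hk : k ∈ T.Z) : Measurable (T.fr Q k) :=
  hQ.measurable_levelRatio (T.lev k) hk

lemma dependsOn_fr (hQ : T.IsNuisance Q) {k : V} (hk : k ∈ T.Z) :
    DependsOn (T.fr Q k) (Set.Iic k \ {T.A}) :=
  hQ.dependsOn_levelRatio (T.lev k) hk

lemma fr_nonneg (hQ : T.IsNuisance Q) {k : V} (hk : k ∈ T.Z) (o : ∀ v, S v) : 0 ≤ T.fr Q k o :=
  div_nonneg (hQ.f_nonneg k hk _) (hQ.f_nonneg k hk _)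

lemma frA_nonneg (hQ : T.IsNuisance Q) (o : ∀ v, S v) : 0 ≤ T.frA Q o :=
  div_nonneg (hQ.pi_nonneg _ _) (hQ.pi_nonneg _ _)

lemma measurable_frA (hQ : T.IsNuisance Q) : Measurable (T.frA Q) :=
  (hQ.pi_meas _).div (hQ.pi_meas _)

lemma dependsOn_frA (hQ : T.IsNuisance Q) : DependsOn (T.frA Q) (Set.Iio T.A) := by
  intro x y h
  simp only [frA, hQ.pi_dep_Iio _ h]

variable {D : Finset V}

lemma weightM_nonneg (hQ : T.IsNuisance Q) (hD : D ⊆ T.Z) (o : ∀ v, S v) :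
    0 ≤ T.weightM Q D o :=
  Finset.prod_nonneg fun _ hi => hQ.fr_nonneg (hD (Finset.mem_filter.1 hi).1) o

lemma weightL_nonneg (hQ : T.IsNuisance Q) (hD : D ⊆ T.Z) (o : ∀ v, S v) :
    0 ≤ T.weightL Q D o :=
  mul_nonneg (hQ.frA_nonneg o)
    (Finset.prod_nonneg fun _ hi => hQ.fr_nonneg (hD (Finset.mem_filter.1 hi).1) o)

lemma measurable_weightM (hQ : T.IsNuisance Q) (hD : D ⊆ T.Z) : Measurable (T.weightM Q D) :=
  Finset.measurable_prod _ fun _ hi => hQ.measurable_fr (hD (Finset.mem_filter.1 hi).1)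

lemma measurable_weightL (hQ : T.IsNuisance Q) (hD : D ⊆ T.Z) : Measurable (T.weightL Q D) :=
  hQ.measurable_frA.mul
    (Finset.measurable_prod _ fun _ hi => hQ.measurable_fr (hD (Finset.mem_filter.1 hi).1))

lemma prod_fr_congr (hQ : T.IsNuisance Q) (hD : T.IsInitial D) {E : Finset V} (hE : E ⊆ D)
    {x y : ∀ v, S v} (h : ∀ i ∈ T.upTo D \ {T.A}, x i = y i) :
    ∏ i ∈ E, T.fr Q i x = ∏ i ∈ E, T.fr Q i y := by
  refine Finset.prod_congr rfl fun i hi => hQ.dependsOn_fr (hD.1 (hE hi)) fun j hj => h j ⟨?_, hj.2⟩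
  rcases le_or_gt j T.A with h1 | h1
  · exact Or.inl h1
  · refine Or.inr (hD.2 j (mem_Z.2 ⟨h1, ?_⟩) i (hE hi) hj.1)
    exact (lt_of_le_of_lt hj.1 (lt_Y_of_mem_Z (hD.1 (hE hi)))).ne

lemma dependsOn_weightM (hQ : T.IsNuisance Q) (hD : T.IsInitial D) :
    DependsOn (T.weightM Q D) (T.upTo D \ {T.A}) := fun _ _ h =>
  hQ.prod_fr_congr hD (Finset.filter_subset _ _) h

lemma dependsOn_weightL (hQ : T.IsNuisance Q) (hD : T.IsInitial D) :
    DependsOn (T.weightL Q D) (T.upTo D \ {T.A}) := fun x y h => by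
  rw [weightL, weightL, hQ.prod_fr_congr hD (Finset.filter_subset _ _) h,
    hQ.dependsOn_frA fun i hi => h i ⟨Or.inl (Set.mem_Iio.1 hi).le, (Set.mem_Iio.1 hi).ne⟩]

lemma measurable_R (hQ : T.IsNuisance Q) (v : V) : Measurable (T.R Q v) := by
  by_cases hv : v ∈ T.L
  · rw [R_of_mem Q hv]; exact hQ.measurable_weightM (Finset.filter_subset _ _)
  · rw [R_of_notMem Q hv]; exact hQ.measurable_weightL (Finset.filter_subset _ _)

lemma R_nonneg (hQ : T.IsNuisance Q) (v : V) (o : ∀ v, S v) : 0 ≤ T.R Q v o := by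
  by_cases hv : v ∈ T.L
  · rw [R_of_mem Q hv]; exact hQ.weightM_nonneg (Finset.filter_subset _ _) o
  · rw [R_of_notMem Q hv]; exact hQ.weightL_nonneg (Finset.filter_subset _ _) o

lemma dependsOn_R (hQ : T.IsNuisance Q) {v : V} (hv : T.A < v) :
    DependsOn (T.R Q v) (Set.Iio v \ {T.A}) := by
  rw [Iio_eq_upTo hv]
  by_cases hL : v ∈ T.L
  · rw [R_of_mem Q hL]; exact hQ.dependsOn_weightM (isInitial_filter_lt v)
  · rw [R_of_notMem Q hL]; exact hQ.dependsOn_weightL (isInitial_filter_lt v)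

end IsNuisance

variable {P : Measure (∀ v, S v)} [IsProbabilityMeasure P]

/-- For a vertex of `𝓜` the level ratio at `a₁` is the inverse of its `f^r` and cancels; for a
vertex of `𝓛` the two ratios coincide. So switching the level turns `𝓜` weights into `𝓛` weights. -/
lemma levelRatio_mul_weightM {o : ∀ v, S v} {D : Finset V} (hD : D ⊆ T.Z)
    (ho : ∀ a, ∀ k ∈ T.Z, 0 < Q.f k (T.setA o a)) :
    (∏ j ∈ D, T.levelRatio Q T.a₁ j o) * T.weightM Q D o = ∏ i ∈ D.filter (· ∈ T.L), T.fr Q i o := by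
  rw [weightM, Finset.prod_filter, Finset.prod_filter, ← Finset.prod_mul_distrib]
  refine Finset.prod_congr rfl fun j hj => ?_
  have hjZ := hD hj
  have hM := mem_M_iff (T := T) (mem_Z.1 hjZ).1
  by_cases hL : j ∈ T.L
  · rw [if_neg (fun h => hM.1 h hL), if_pos hL, mul_one, fr, levelRatio, lev_of_mem hL]
  · rw [if_pos (hM.2 hL), if_neg hL, fr, levelRatio, lev_of_notMem hL, not_a₁]
    have h1 := (ho T.a₁ j hjZ).ne'
    have h0 := (ho T.a₀ j hjZ).ne'
    have e : (!T.a₀) = T.a₁ := rfl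
    rw [e]
    field_simp

/-- The two representations of integrals with respect to the reweighted law. -/
lemma IsTruth.weight_switch (hQ : T.IsTruth P Q) (hfact : T.TopologicalFactorization P)
    (hpos : T.Positivity P Q) {D : Finset V} (hD : T.IsInitial D) {H : (∀ v, S v) → ℝ}
    (hH : Measurable H) (hd : DependsOn H (T.upTo D \ {T.A})) :
    (Integrable (fun o => T.ind T.a₁ o * T.weightM Q D o * H o) P ↔
      Integrable (fun o => T.ind T.a₀ o * T.weightL Q D o * H o) P) ∧
    ∫ o, T.ind T.a₁ o * T.weightM Q D o * H o ∂P =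
      ∫ o, T.ind T.a₀ o * T.weightL Q D o * H o ∂P := by
  have hn := hQ.nuisance
  have hwm := hn.measurable_weightM hD.1
  refine integrable_iff_and_integral_eq_of_lintegral_weights
    ((measurable_ind _).mul hwm) ((measurable_ind _).mul (hn.measurable_weightL hD.1)) hH
    (fun o => mul_nonneg (ind_nonneg _ _) (hn.weightM_nonneg hD.1 o))
    (fun o => mul_nonneg (ind_nonneg _ _) (hn.weightL_nonneg hD.1 o)) fun φ hφ => ?_
  have hFd : DependsOn (fun o => ENNReal.ofReal (T.weightM Q D o) * φ (H o))
      (T.upTo D \ {T.A}) := fun x y h => by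
    simp only [hd h, hn.dependsOn_weightM hD h]
  have e := hQ.lintegral_switch hfact hpos T.a₁ D hD (hwm.ennreal_ofReal.mul (hφ.comp hH))
    (hFd.mono Set.sdiff_subset)
  simp only [ENNReal.ofReal_mul (ind_nonneg _ _), mul_assoc]
  refine Eq.trans e ?_
  rw [not_a₁]
  refine lintegral_congr_ae ?_
  filter_upwards [hpos] with o ho
  -- The weight and `H` do not read the treatment, so assigning the level leaves them unchanged.
  have hset : (fun o => ENNReal.ofReal (T.weightM Q D o) * φ (H o)) (T.setA o T.a₁) =
      (fun o => ENNReal.ofReal (T.weightM Q D o) * φ (H o)) o :=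
    hFd fun i hi => setA_apply_of_ne hi.2 _ _
  have hset' : ENNReal.ofReal (T.weightM Q D (T.setA o T.a₁)) * φ (H (T.setA o T.a₁)) =
      ENNReal.ofReal (T.weightM Q D o) * φ (H o) := hset
  have key := levelRatio_mul_weightM (T := T) hD.1 fun a k hk => (ho a).2 k hk
  have hprod0 : ∀ j ∈ D, 0 ≤ T.levelRatio Q T.a₁ j o := fun j hj =>
    div_nonneg (hn.f_nonneg j (hD.1 hj) _) (hn.f_nonneg j (hD.1 hj) _)
  simp only [Pi.mul_apply, Function.comp_apply]
  rw [hset', weightL, ← key, ENNReal.ofReal_mul (hn.frA_nonneg o),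
    ENNReal.ofReal_mul (Finset.prod_nonneg hprod0), ENNReal.ofReal_prod_of_nonneg hprod0, frA]
  ring

/-- Integrals against `𝕀(A = a_v) 𝓡_v`, in terms of the weights of the predecessors of `v`. -/
lemma IsTruth.R_switch (hQ : T.IsTruth P Q) (hfact : T.TopologicalFactorization P)
    (hpos : T.Positivity P Q) {v : V} (hv : T.A < v) {H : (∀ v, S v) → ℝ}
    (hH : Measurable H) (hd : DependsOn H (Set.Iio v \ {T.A})) :
    (Integrable (fun o => T.ind T.a₁ o * T.weightM Q (T.Z.filter (· < v)) o * H o) P ↔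
      Integrable (fun o => T.ind (T.lev v) o * T.R Q v o * H o) P) ∧
    ∫ o, T.ind T.a₁ o * T.weightM Q (T.Z.filter (· < v)) o * H o ∂P =
      ∫ o, T.ind (T.lev v) o * T.R Q v o * H o ∂P := by
  by_cases hL : v ∈ T.L
  · rw [R_of_mem Q hL, lev_of_mem hL]
    exact ⟨Iff.rfl, rfl⟩
  · rw [R_of_notMem Q hL, lev_of_notMem hL]
    exact hQ.weight_switch hfact hpos (isInitial_filter_lt v) hH (by rwa [← Iio_eq_upTo hv])

/-- Integrals against `𝕀(A = a_k) 𝓡_k`, in terms of the weights of `k` and its predecessors. -/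
lemma IsTruth.R_switch_le (hQ : T.IsTruth P Q) (hfact : T.TopologicalFactorization P)
    (hpos : T.Positivity P Q) {k : V} (hk : k ∈ T.Z) {H : (∀ v, S v) → ℝ}
    (hH : Measurable H) (hd : DependsOn H (Set.Iic k \ {T.A})) :
    (Integrable (fun o => T.ind T.a₁ o * T.weightM Q (T.Z.filter (· ≤ k)) o * H o) P ↔
      Integrable (fun o => T.ind (T.lev k) o * T.R Q k o * H o) P) ∧
    ∫ o, T.ind T.a₁ o * T.weightM Q (T.Z.filter (· ≤ k)) o * H o ∂P =
      ∫ o, T.ind (T.lev k) o * T.R Q k o * H o ∂P := by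
  by_cases hL : k ∈ T.L
  · rw [R_of_mem Q hL, lev_of_mem hL, filter_le_eq_insert hk,
      weightM_insert_of_mem Q hL (mem_Z.1 hk).1]
    exact ⟨Iff.rfl, rfl⟩
  · have e := hQ.weight_switch hfact hpos (isInitial_filter_le k) hH (by rwa [← Iic_eq_upTo hk])
    rw [R_of_notMem Q hL, lev_of_notMem hL]
    rw [show T.weightL Q (T.Z.filter (· ≤ k)) = T.weightL Q (T.Z.filter (· < k)) by
      rw [filter_le_eq_insert hk, weightL_insert_of_notMem Q hL]] at e
    exact e

lemma filter_lt_Y : T.Z.filter (· < T.Y) = T.Z :=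
  Finset.filter_true_of_mem fun _ h => lt_Y_of_mem_Z h

lemma integrable_ind (a : Bool) : Integrable (T.ind a) P :=
  Integrable.of_bound (measurable_ind a).aestronglyMeasurable 1
    (ae_of_all _ fun o => by rw [Real.norm_of_nonneg (ind_nonneg a o)]; exact ind_le_one a o)

/-- Take `H = 1`. For each new mediator `k`, the weight of the earlier segment is exchanged for
`𝓡_k`, and `𝓡_k` for the weight of the segment with `k`; both exchanges preserve integrability. The
induction starts from a bare indicator. -/
lemma IsTruth.integrable_weightM (hQ : T.IsTruth P Q) (hfact : T.TopologicalFactorization P)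
    (hpos : T.Positivity P Q) {D : Finset V} (hD : T.IsInitial D) :
    Integrable (fun o => T.ind T.a₁ o * T.weightM Q D o) P := by
  induction D using Finset.induction_on_max with
  | empty => simpa [weightM] using integrable_ind (P := P) T.a₁
  | insert k D hlt ih =>
    have hkZ := hD.1 (Finset.mem_insert_self k D)
    have h := ih (hD.of_insert hlt)
    have e1 := (hQ.R_switch hfact hpos (mem_Z.1 hkZ).1 (H := fun _ => 1) measurable_const
      fun _ _ _ => rfl).1
    have e2 := (hQ.R_switch_le hfact hpos hkZ (H := fun _ => 1) measurable_const
      fun _ _ _ => rfl).1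
    rw [← hD.eq_filter_lt hlt] at e1
    rw [filter_le_eq_insert hkZ, ← hD.eq_filter_lt hlt] at e2
    simp only [mul_one] at e1 e2
    exact e2.2 (e1.1 h)

lemma IsTruth.integrable_R (hQ : T.IsTruth P Q) (hfact : T.TopologicalFactorization P)
    (hpos : T.Positivity P Q) {v : V} (hv : T.A < v) :
    Integrable (fun o => T.ind (T.lev v) o * T.R Q v o) P := by
  have e1 := (hQ.R_switch hfact hpos hv (H := fun _ => 1) measurable_const fun _ _ _ => rfl).1
  simp only [mul_one] at e1
  exact e1.1 (hQ.integrable_weightM hfact hpos (isInitial_filter_lt v))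

end Weights

/-! ### The sequential regressions `𝓑`. -/

section Regressions

variable {q : Nuisance V S}

lemma filter_ge_eq_insert {k : V} (hk : k ∈ T.Z) :
    T.Z.filter (k ≤ ·) = insert k (T.Z.filter (k < ·)) := by
  ext j
  simp only [Finset.mem_filter, Finset.mem_insert, le_iff_lt_or_eq]
  constructor
  · rintro ⟨h, h1 | h1⟩
    · exact Or.inr ⟨h, h1⟩
    · exact Or.inl h1.symm
  · rintro (rfl | h)
    · exact ⟨hk, Or.inr rfl⟩
    · exact ⟨h.1, Or.inl h.2⟩

/-- The mediator `k` is the smallest one from `k` on, hence the head of the sorted list and the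
outermost integral. -/
lemma B_eq (q : Nuisance V S) {k : V} (hk : k ∈ T.Z) (o : ∀ v, S v) :
    T.B q k o = ∫ z, q.f k (Function.update (T.setA o (T.lev k)) k z) *
      T.Bsucc q k (Function.update o k z) ∂(T.ν k) := by
  rw [B, filter_ge_eq_insert hk, Finset.sort_insert _ (fun b hb => (Finset.mem_filter.1 hb).2.le)
    (by simp), seqRegList, Bsucc]

lemma IsNuisance.measurable_seqRegList (hq : T.IsNuisance q) :
    ∀ l : List V, (∀ k ∈ l, k ∈ T.Z) → Measurable (T.seqRegList q l)
  | [], _ => hq.mu_meas.comp (measurable_setA _)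
  | k :: l, hl => by
    have := T.sigmaFinite k
    have ih := hq.measurable_seqRegList l fun j hj => hl j (List.mem_cons_of_mem _ hj)
    have hf := hq.f_meas k (hl k List.mem_cons_self)
    have h1 : Measurable fun p : (∀ v, S v) × S k =>
        q.f k (Function.update (T.setA p.1 (T.lev k)) k p.2) *
          T.seqRegList q l (Function.update p.1 k p.2) :=
      (hf.comp (measurable_update'.comp
        (((measurable_setA _).comp measurable_fst).prodMk measurable_snd))).mul
        (ih.comp measurable_update')
    exact h1.stronglyMeasurable.integral_prod_right'.measurable

/-- The treatment is overwritten, the outcome is not read by the regression `μ`, and the listed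
mediators are integrated out. The list must be increasing so that `f_k`, which reads nothing after
`k`, never reads a variable of an inner integral. -/
lemma IsNuisance.dependsOn_seqRegList (hq : T.IsNuisance q) :
    ∀ l : List V, (∀ k ∈ l, k ∈ T.Z) → l.Pairwise (· < ·) →
      DependsOn (T.seqRegList q l) {v | v ≠ T.A ∧ v ≠ T.Y ∧ v ∉ l}
  | [], _, _ => fun x y h => setA_congr hq.mu_dep_Iio _ fun i hi =>
      h i ⟨hi.2, (Set.mem_Iio.1 hi.1).ne, by simp⟩
  | k :: l, hl, hs => fun x y h => by
    have hkZ := hl k List.mem_cons_self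
    have hkA := ne_A_of_mem_Z hkZ
    have ih := hq.dependsOn_seqRegList l (fun j hj => hl j (List.mem_cons_of_mem _ hj))
      (List.pairwise_cons.1 hs).2
    refine integral_congr_ae (ae_of_all _ fun z => ?_)
    have e1 : q.f k (Function.update (T.setA x (T.lev k)) k z) =
        q.f k (Function.update (T.setA y (T.lev k)) k z) := by
      rw [← setA_update hkA, ← setA_update hkA]
      refine setA_congr (hq.f_dep_Iic hkZ) _ fun i hi => ?_
      by_cases hik : i = k
      · subst hik; simp
      · rw [Function.update_of_ne hik, Function.update_of_ne hik]
        have hlt : i < k := lt_of_le_of_ne hi.1 hik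
        refine h i ⟨hi.2, (hlt.trans (lt_Y_of_mem_Z hkZ)).ne, fun hil => ?_⟩
        rcases List.mem_cons.1 hil with h' | h'
        · exact hik h'
        · exact absurd ((List.pairwise_cons.1 hs).1 i h') (not_lt.2 hlt.le)
    have e2 : T.seqRegList q l (Function.update x k z) =
        T.seqRegList q l (Function.update y k z) := by
      refine ih fun i hi => ?_
      by_cases hik : i = k
      · subst hik; simp
      · rw [Function.update_of_ne hik, Function.update_of_ne hik]
        exact h i ⟨hi.1, hi.2.1, by simp [hik, hi.2.2]⟩
    simp only [e1, e2]

lemma IsNuisance.integrable_density (hq : T.IsNuisance q) {k : V} (hk : k ∈ T.Z) (o : ∀ v, S v) :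
    Integrable (fun z => q.f k (Function.update o k z)) (T.ν k) ∧
      ∫ z, q.f k (Function.update o k z) ∂(T.ν k) = 1 := by
  have hm : Measurable fun z => q.f k (Function.update o k z) :=
    (hq.f_meas k hk).comp (measurable_update o)
  have h0 : 0 ≤ᵐ[T.ν k] fun z => q.f k (Function.update o k z) :=
    ae_of_all _ fun z => hq.f_nonneg k hk _
  refine ⟨⟨hm.aestronglyMeasurable, ?_⟩, ?_⟩
  · rw [hasFiniteIntegral_iff_ofReal h0, hq.f_density k hk]
    simp
  · rw [integral_eq_lintegral_of_nonneg_ae h0 hm.aestronglyMeasurable, hq.f_density k hk]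
    simp

/-- Averaging against probability densities preserves the bound on `μ`, so one constant serves at
every stage. -/
lemma IsNuisance.abs_seqRegList_le (hq : T.IsNuisance q) {C : ℝ}
    (hC : ∀ o, |q.mu (T.setA o (T.lev T.Y))| ≤ C) :
    ∀ l : List V, (∀ k ∈ l, k ∈ T.Z) → ∀ o, |T.seqRegList q l o| ≤ C
  | [], _, o => hC o
  | k :: l, hl, o => by
    have hkZ := hl k List.mem_cons_self
    have ih := hq.abs_seqRegList_le hC l fun j hj => hl j (List.mem_cons_of_mem _ hj)
    obtain ⟨h1, h2⟩ := hq.integrable_density hkZ (T.setA o (T.lev k))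
    rw [seqRegList, ← Real.norm_eq_abs]
    refine (norm_integral_le_of_norm_le (h1.mul_const C) (ae_of_all _ fun z => ?_)).trans ?_
    · rw [norm_mul, Real.norm_of_nonneg (hq.f_nonneg k hkZ _)]
      exact mul_le_mul_of_nonneg_left (ih _) (hq.f_nonneg k hkZ _)
    · rw [integral_mul_const, h2, one_mul]

lemma IsNuisance.measurable_B (hq : T.IsNuisance q) (k : V) : Measurable (T.B q k) :=
  hq.measurable_seqRegList _ fun _ hj => (Finset.mem_filter.1 ((Finset.mem_sort _).1 hj)).1

lemma IsNuisance.measurable_Bsucc (hq : T.IsNuisance q) (k : V) : Measurable (T.Bsucc q k) :=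
  hq.measurable_seqRegList _ fun _ hj => (Finset.mem_filter.1 ((Finset.mem_sort _).1 hj)).1

lemma IsNuisance.measurable_Bfirst (hq : T.IsNuisance q) : Measurable (T.Bfirst q) :=
  hq.measurable_seqRegList _ fun _ hj => (Finset.mem_sort _).1 hj

lemma IsNuisance.dependsOn_sort (hq : T.IsNuisance q) {D : Finset V} (hD : D ⊆ T.Z) :
    DependsOn (T.seqRegList q D.sort) {v | v ≠ T.A ∧ v ≠ T.Y ∧ v ∉ D} := by
  intro x y h
  refine hq.dependsOn_seqRegList D.sort (fun j hj => hD ((Finset.mem_sort _).1 hj))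
    (Finset.sortedLT_sort D).pairwise fun v hv => h v ?_
  exact ⟨hv.1, hv.2.1, fun hD' => hv.2.2 ((Finset.mem_sort _).2 hD')⟩

lemma IsNuisance.dependsOn_B (hq : T.IsNuisance q) {k : V} (hk : k ∈ T.Z) :
    DependsOn (T.B q k) (Set.Iio k \ {T.A}) := by
  refine (hq.dependsOn_sort (Finset.filter_subset _ _)).mono fun v hv => ⟨?_, hv.1⟩
  by_contra h
  have hle : k ≤ v := not_lt.1 h
  exact hv.2.2 (Finset.mem_filter.2 ⟨mem_Z.2 ⟨(mem_Z.1 hk).1.trans_le hle, hv.2.1⟩, hle⟩)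

lemma IsNuisance.dependsOn_Bsucc (hq : T.IsNuisance q) {k : V} (hk : k ∈ T.Z) :
    DependsOn (T.Bsucc q k) (Set.Iic k \ {T.A}) := by
  refine (hq.dependsOn_sort (Finset.filter_subset _ _)).mono fun v hv => ⟨?_, hv.1⟩
  by_contra h
  have hlt : k < v := not_le.1 h
  exact hv.2.2 (Finset.mem_filter.2 ⟨mem_Z.2 ⟨(mem_Z.1 hk).1.trans hlt, hv.2.1⟩, hlt⟩)

/-- Only pre-treatment variables remain once all mediators are integrated out; this is what permits
replacing `𝕀(A = a₁)` by `π(a₁ | ·)` in the parameter. -/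
lemma IsNuisance.dependsOn_Bfirst (hq : T.IsNuisance q) :
    DependsOn (T.Bfirst q) (Set.Iio T.A) := by
  refine (hq.dependsOn_sort (Finset.Subset.refl _)).mono fun v hv => ?_
  by_contra h
  exact hv.2.2 (mem_Z.2 ⟨lt_of_le_of_ne (not_lt.1 h) (Ne.symm hv.1), hv.2.1⟩)

end Regressions

end CausalModel

/-! ### Mean of the influence function at the truth and at an estimate. -/

namespace CausalModel

variable {V : Type u} [LinearOrder V] [Fintype V] {S : V → Type w} [∀ v, MeasurableSpace (S v)]
  {T : CausalModel V S}
variable {P : Measure (∀ v, S v)} [IsProbabilityMeasure P] {Q q : Nuisance V S}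

/-- Integrating out a mediator at its own treatment level. -/
lemma IsTruth.integral_tower_lev (hQ : T.IsTruth P Q) (hfact : T.TopologicalFactorization P)
    {k : V} (hk : k ∈ T.Z) {G h : (∀ v, S v) → ℝ} (hG : Measurable G)
    (hGd : DependsOn G (Set.Iio k)) (hh : Measurable h) (hhd : DependsOn h (Set.Iic k))
    (hi : Integrable (fun o => T.ind (T.lev k) o * G o * h o) P) :
    Integrable (fun o => T.ind (T.lev k) o * G o *
      ∫ z, Q.f k (Function.update (T.setA o (T.lev k)) k z) *
        h (Function.update o k z) ∂(T.ν k)) P ∧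
    ∫ o, T.ind (T.lev k) o * G o * h o ∂P = ∫ o, T.ind (T.lev k) o * G o *
      ∫ z, Q.f k (Function.update (T.setA o (T.lev k)) k z) *
        h (Function.update o k z) ∂(T.ν k) ∂P := by
  have := T.sigmaFinite k
  have hkA := ne_A_of_mem_Z hk
  have hindd : DependsOn (T.ind (T.lev k)) (Set.Iio k) :=
    (dependsOn_ind _).mono (by simpa using (mem_Z.1 hk).1)
  obtain ⟨h1, h2⟩ := hQ.integral_tower hfact hk
    (F := fun o => T.ind (T.lev k) o * G o * h o) (((measurable_ind _).mul hG).mul hh)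
    (fun x y hxy => by
      have hxy' : ∀ i ∈ Set.Iio k, x i = y i := fun i hi => hxy i (Set.mem_Iio.1 hi).le
      beta_reduce
      rw [hindd hxy', hGd hxy', hhd hxy]) hi
  have e : ∀ o, ∫ z, Q.f k (Function.update o k z) * (T.ind (T.lev k) (Function.update o k z) *
      G (Function.update o k z) * h (Function.update o k z)) ∂(T.ν k) =
      T.ind (T.lev k) o * G o * ∫ z, Q.f k (Function.update (T.setA o (T.lev k)) k z) *
        h (Function.update o k z) ∂(T.ν k) := by
    intro o
    rw [← integral_const_mul]
    refine integral_congr_ae (ae_of_all _ fun z => ?_)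
    have hoff := update_eq_off (s := Set.Iio k) (by simp) o z
    beta_reduce
    rw [hindd hoff, hGd hoff]
    rcases ind_eq_zero_or (T := T) (T.lev k) o with h0 | h0
    · simp [h0]
    · rw [h0]; ring
  exact ⟨h1.integral_prod_left.congr (ae_of_all _ e), by rw [h2]; simp only [e]⟩

lemma sdiff_filter_lt (k : V) : T.Z \ T.Z.filter (· < k) = T.Z.filter (k ≤ ·) := by
  ext j
  simp only [Finset.mem_sdiff, Finset.mem_filter, not_and, not_lt]
  exact ⟨fun h => ⟨h.1, h.2 h.1⟩, fun h => ⟨h.1, fun _ => h.2⟩⟩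

lemma sdiff_filter_le (k : V) : T.Z \ T.Z.filter (· ≤ k) = T.Z.filter (k < ·) := by
  ext j
  simp only [Finset.mem_sdiff, Finset.mem_filter, not_and, not_le]
  exact ⟨fun h => ⟨h.1, h.2 h.1⟩, fun h => ⟨h.1, fun _ => h.2⟩⟩

lemma IsNuisance.dependsOn_R_Iio (hq : T.IsNuisance q) {v : V} (hv : T.A < v) :
    DependsOn (T.R q v) (Set.Iio v) := (hq.dependsOn_R hv).mono Set.sdiff_subset

/-- The sequential regressions of the truth have the same weighted means at every stage. -/
lemma IsTruth.chain (hQ : T.IsTruth P Q) (hfact : T.TopologicalFactorization P)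
    (hpos : T.Positivity P Q) {D : Finset V} (hD : T.IsInitial D)
    (hi : Integrable (fun o => T.ind T.a₁ o * T.weightM Q D o *
      T.seqRegList Q (T.Z \ D).sort o) P) :
    (∀ k ∈ D, Integrable (fun o => T.ind (T.lev k) o * T.R Q k o * T.Bsucc Q k o) P ∧
      Integrable (fun o => T.ind (T.lev k) o * T.R Q k o * T.B Q k o) P ∧
      ∫ o, T.ind (T.lev k) o * T.R Q k o * T.Bsucc Q k o ∂P =
        ∫ o, T.ind (T.lev k) o * T.R Q k o * T.B Q k o ∂P) ∧
    Integrable (fun o => T.ind T.a₁ o * T.Bfirst Q o) P ∧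
    ∫ o, T.ind T.a₁ o * T.Bfirst Q o ∂P =
      ∫ o, T.ind T.a₁ o * T.weightM Q D o * T.seqRegList Q (T.Z \ D).sort o ∂P := by
  induction D using Finset.induction_on_max with
  | empty =>
    simp only [weightM, Finset.filter_empty, Finset.prod_empty, mul_one, Finset.sdiff_empty] at hi ⊢
    exact ⟨by simp, hi, rfl⟩
  | insert k D hlt ih =>
    have hn := hQ.nuisance
    have hkZ := hD.1 (Finset.mem_insert_self k D)
    have hkA := (mem_Z.1 hkZ).1
    have hDe := hD.eq_filter_lt hlt
    have hDe' : insert k D = T.Z.filter (· ≤ k) := by rw [filter_le_eq_insert hkZ, ← hDe]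
    have ih := ih (hD.of_insert hlt)
    -- Integrability and value pass from the segment with `k` to the one without it in three moves:
    -- exchange its weight for `𝓡_k`, integrate out `k`, which turns `Bsucc` into `B`, and exchange
    -- `𝓡_k` for the weight of the earlier segment.
    have e1 := hQ.R_switch hfact hpos hkA (hn.measurable_B k) (hn.dependsOn_B hkZ)
    have e2 := hQ.R_switch_le hfact hpos hkZ (hn.measurable_Bsucc k) (hn.dependsOn_Bsucc hkZ)
    rw [← hDe] at e1
    rw [← hDe'] at e2
    have s1 : T.Z \ D = T.Z.filter (k ≤ ·) := by rw [hDe, sdiff_filter_lt]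
    have s2 : T.Z \ insert k D = T.Z.filter (k < ·) := by rw [hDe', sdiff_filter_le]
    rw [s1] at ih
    rw [s2] at hi ⊢
    change Integrable (fun o => _ * T.B Q k o) P → _ at ih
    change Integrable (fun o => _ * T.Bsucc Q k o) P at hi
    have hi2 := e2.1.1 hi
    obtain ⟨t1, t2⟩ := hQ.integral_tower_lev hfact hkZ (hn.measurable_R k)
      (hn.dependsOn_R_Iio hkA) (hn.measurable_Bsucc k)
      ((hn.dependsOn_Bsucc hkZ).mono Set.sdiff_subset) hi2
    simp only [← B_eq Q hkZ] at t1 t2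
    obtain ⟨i1, i2, i3⟩ := ih (e1.1.2 t1)
    refine ⟨fun j hj => ?_, i2, ?_⟩
    · rcases Finset.mem_insert.1 hj with rfl | hj
      · exact ⟨hi2, t1, t2⟩
      · exact i1 j hj
    · rw [i3]
      exact e1.2.trans (t2.symm.trans e2.2.symm)

/-- Telescoping of the bias terms at the true density ratios. -/
lemma IsTruth.telescope (hQ : T.IsTruth P Q) (hfact : T.TopologicalFactorization P)
    (hpos : T.Positivity P Q) (hq : T.IsNuisance q) {C : ℝ}
    (hC : ∀ o, |q.mu (T.setA o (T.lev T.Y))| ≤ C) {D : Finset V} (hD : T.IsInitial D) :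
    ∑ k ∈ D, ∫ o, T.ind (T.lev k) o * T.R Q k o * (T.Bsucc q k o - T.B q k o) ∂P =
      ∫ o, T.ind T.a₁ o * T.weightM Q D o * T.seqRegList q (T.Z \ D).sort o ∂P -
        ∫ o, T.ind T.a₁ o * T.Bfirst q o ∂P := by
  induction D using Finset.induction_on_max with
  | empty => simp [weightM, Bfirst]
  | insert k D hlt ih =>
    have hkD : k ∉ D := fun h => lt_irrefl _ (hlt k h)
    have hkZ := hD.1 (Finset.mem_insert_self k D)
    have hkA := (mem_Z.1 hkZ).1
    have hDe := hD.eq_filter_lt hlt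
    have hDe' : insert k D = T.Z.filter (· ≤ k) := by rw [filter_le_eq_insert hkZ, ← hDe]
    have e1 := hQ.R_switch hfact hpos hkA (hq.measurable_B k) (hq.dependsOn_B hkZ)
    have e2 := hQ.R_switch_le hfact hpos hkZ (hq.measurable_Bsucc k) (hq.dependsOn_Bsucc hkZ)
    rw [← hDe] at e1
    rw [← hDe'] at e2
    have s1 : T.Z \ D = T.Z.filter (k ≤ ·) := by rw [hDe, sdiff_filter_lt]
    have s2 : T.Z \ insert k D = T.Z.filter (k < ·) := by rw [hDe', sdiff_filter_le]
    have hR := hQ.integrable_R hfact hpos hkA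
    have hb : ∀ l : List V, (∀ j ∈ l, j ∈ T.Z) → Integrable (fun o =>
        T.ind (T.lev k) o * T.R Q k o * T.seqRegList q l o) P := fun l hl =>
      hR.mul_bdd (c := C) (hq.measurable_seqRegList l hl).aestronglyMeasurable
        (ae_of_all _ fun o => hq.abs_seqRegList_le hC l hl o)
    have hb1 : Integrable (fun o => T.ind (T.lev k) o * T.R Q k o * T.Bsucc q k o) P :=
      hb _ fun j hj => (Finset.mem_filter.1 ((Finset.mem_sort _).1 hj)).1
    have hb2 : Integrable (fun o => T.ind (T.lev k) o * T.R Q k o * T.B q k o) P :=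
      hb _ fun j hj => (Finset.mem_filter.1 ((Finset.mem_sort _).1 hj)).1
    rw [Finset.sum_insert hkD, ih (hD.of_insert hlt), s1, s2]
    simp only [mul_sub]
    rw [integral_sub hb1 hb2]
    -- The `B` part cancels the boundary term of the earlier segment and the `Bsucc` part becomes
    -- the new one. No relation between `q` and `P` is needed beyond boundedness.
    have e1' := e1.2
    have e2' := e2.2
    rw [B] at e1'
    rw [Bsucc] at e2'
    rw [e1', e2']
    change _ + (∫ o, _ * T.B q k o ∂P - _) = ∫ o, _ * T.Bsucc q k o ∂P - _
    ring

/-- The two occurrences of `π(a₁ | ·) 𝓑_{Z_1}` cancel, so the propensity score enters only through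
the weights `𝓡`. -/
lemma eifUncentered_eq (q : Nuisance V S) (o : ∀ v, S v) :
    T.eifUncentered q o =
      T.ind (T.lev T.Y) o * T.R q T.Y o * (T.y o - q.mu (T.setA o (T.lev T.Y)))
      + ∑ k ∈ T.Z, T.ind (T.lev k) o * T.R q k o * (T.Bsucc q k o - T.B q k o)
      + T.ind T.a₁ o * T.Bfirst q o + T.ind T.a₀ o * T.y o := by
  unfold eifUncentered; ring

/-- The mean of the uncentered influence function, term by term. -/
lemma integrable_and_integral_eifUncentered
    (iY : Integrable (fun o => T.ind (T.lev T.Y) o * T.R q T.Y o *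
      (T.y o - q.mu (T.setA o (T.lev T.Y)))) P)
    (ik : ∀ k ∈ T.Z, Integrable (fun o => T.ind (T.lev k) o * T.R q k o *
      (T.Bsucc q k o - T.B q k o)) P)
    (iF : Integrable (fun o => T.ind T.a₁ o * T.Bfirst q o) P)
    (i0 : Integrable (fun o => T.ind T.a₀ o * T.y o) P) :
    Integrable (T.eifUncentered q) P ∧ ∫ o, T.eifUncentered q o ∂P =
      ∫ o, T.ind (T.lev T.Y) o * T.R q T.Y o * (T.y o - q.mu (T.setA o (T.lev T.Y))) ∂P +
      ∑ k ∈ T.Z, ∫ o, T.ind (T.lev k) o * T.R q k o * (T.Bsucc q k o - T.B q k o) ∂P +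
      ∫ o, T.ind T.a₁ o * T.Bfirst q o ∂P + ∫ o, T.ind T.a₀ o * T.y o ∂P := by
  have iS := integrable_finsetSum T.Z ik
  have e0 : T.eifUncentered q = _ := funext fun o => eifUncentered_eq q o
  constructor
  · rw [e0]
    exact ((iY.add iS).add iF).add i0
  · rw [e0, ← integral_finsetSum T.Z ik]
    refine (integral_add ((iY.add iS).add iF) i0).trans (congrArg (· + _) ?_)
    exact (integral_add (iY.add iS) iF).trans (congrArg (· + _) (integral_add iY iS))

lemma IsNuisance.measurable_mu_setA (hq : T.IsNuisance q) (a : Bool) :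
    Measurable fun o => q.mu (T.setA o a) := hq.mu_meas.comp (measurable_setA a)

lemma IsNuisance.measurable_eifUncentered (hq : T.IsNuisance q) :
    Measurable (T.eifUncentered q) := by
  have h1 := hq.measurable_mu_setA (T.lev T.Y)
  have h2 := hq.measurable_Bfirst
  have h3 := measurable_y (T := T)
  have h4 := measurable_ind (T := T)
  have h5 := hq.measurable_R
  have e : T.eifUncentered q = _ := funext fun o => eifUncentered_eq q o
  rw [e]
  refine (((((h4 _).mul (h5 _)).mul (h3.sub h1)).add ?_).add ((h4 _).mul h2)).add ((h4 _).mul h3)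
  exact Finset.measurable_fun_sum _ fun k _ =>
    ((h4 _).mul (h5 k)).mul ((hq.measurable_Bsucc k).sub (hq.measurable_B k))

lemma integrable_ind_mul_y (hy : Integrable T.y P) (a : Bool) :
    Integrable (fun o => T.ind a o * T.y o) P :=
  hy.bdd_mul (c := 1) (measurable_ind a).aestronglyMeasurable (ae_of_all _ fun o => by
    rw [Real.norm_of_nonneg (ind_nonneg a o)]; exact ind_le_one a o)

lemma dependsOn_ind_mul_R (hq : T.IsNuisance q) :
    DependsOn (fun o => T.ind (T.lev T.Y) o * T.R q T.Y o) (Set.Iio T.Y) := fun x y h => by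
  beta_reduce
  rw [hq.dependsOn_R_Iio T.A_lt_Y h, dependsOn_ind _ fun i hi => h i (by
    rw [Set.mem_singleton_iff.1 hi]; exact T.A_lt_Y)]

lemma ind_mul_mu_setA (q : Nuisance V S) (o : ∀ v, S v) (a : Bool) (x : ℝ) :
    T.ind a o * x * q.mu (T.setA o a) = T.ind a o * x * q.mu o := by
  rcases ind_eq_zero_or (T := T) a o with h0 | h0
  · simp [h0]
  · rw [h0]

/-- The true outcome regression in the weighted mean of the outcome. -/
lemma IsTruth.integral_mu (hQ : T.IsTruth P Q) (hfact : T.TopologicalFactorization P)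
    (hint : T.OutcomeIntegrable P Q) :
    Integrable (fun o => T.ind (T.lev T.Y) o * T.R Q T.Y o * Q.mu o) P ∧
      ∫ o, T.ind (T.lev T.Y) o * T.R Q T.Y o * Q.mu o ∂P =
        ∫ o, T.ind (T.lev T.Y) o * T.R Q T.Y o * T.y o ∂P :=
  hQ.integral_outcome hfact hint.1 ((measurable_ind _).mul (hQ.nuisance.measurable_R _))
    (dependsOn_ind_mul_R hQ.nuisance) hint.2

lemma dependsOn_mu_setA (hq : T.IsNuisance q) :
    DependsOn (fun o => q.mu (T.setA o (T.lev T.Y))) (Set.Iio T.Y \ {T.A}) :=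
  fun _ _ h => setA_congr hq.mu_dep_Iio _ h

/-- The uncentered influence function at the truth is integrable with mean `ψ`, and `ψ` is the
weighted mean of the outcome plus the mean under the observed level. -/
lemma IsTruth.integral_eif (hQ : T.IsTruth P Q) (hfact : T.TopologicalFactorization P)
    (hpos : T.Positivity P Q) (hint : T.OutcomeIntegrable P Q) :
    Integrable (T.eifUncentered Q) P ∧ ∫ o, T.eifUncentered Q o ∂P = T.psi P Q ∧
      T.psi P Q = ∫ o, T.ind (T.lev T.Y) o * T.R Q T.Y o * T.y o ∂P +
        ∫ o, T.ind T.a₀ o * T.y o ∂P := by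
  have hn := hQ.nuisance
  obtain ⟨m1, m2⟩ := hQ.integral_mu hfact hint
  simp only [← ind_mul_mu_setA Q] at m1 m2
  have e := hQ.R_switch hfact hpos T.A_lt_Y (hn.measurable_mu_setA (T.lev T.Y))
    (dependsOn_mu_setA hn)
  rw [filter_lt_Y] at e
  have hZ : T.IsInitial T.Z := ⟨Finset.Subset.refl _, fun j hj _ _ _ => hj⟩
  have hs : ∀ o, T.seqRegList Q (T.Z \ T.Z).sort o = Q.mu (T.setA o (T.lev T.Y)) := by
    intro o
    rw [Finset.sdiff_self, Finset.sort_empty, seqRegList]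
  obtain ⟨c1, c2, c3⟩ := hQ.chain hfact hpos hZ (by simp only [hs]; exact e.1.2 m1)
  simp only [hs] at c3
  -- The function `Bfirst` reads only pre-treatment variables, so the treatment indicator can be
  -- exchanged for its conditional probability.
  have hpi : ∫ o, T.ind T.a₁ o * T.Bfirst Q o ∂P = ∫ o, Q.pi T.a₁ o * T.Bfirst Q o ∂P :=
    (integrable_iff_and_integral_eq_of_lintegral_weights (measurable_ind _) (hn.pi_meas _)
      hn.measurable_Bfirst (ind_nonneg _) (hn.pi_nonneg _) fun φ hφ =>
        hQ.lintegral_ind hfact T.a₁ (F := fun o => φ (T.Bfirst Q o))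
          (hφ.comp hn.measurable_Bfirst) fun x y h => by
            beta_reduce; rw [hn.dependsOn_Bfirst h]).2
  have i0 := integrable_ind_mul_y hint.1 (T := T) T.a₀
  have iY : Integrable (fun o => T.ind (T.lev T.Y) o * T.R Q T.Y o *
      (T.y o - Q.mu (T.setA o (T.lev T.Y)))) P := by
    simp only [mul_sub]
    exact hint.2.sub m1
  have ik : ∀ k ∈ T.Z, Integrable (fun o => T.ind (T.lev k) o * T.R Q k o *
      (T.Bsucc Q k o - T.B Q k o)) P := by
    intro k hk
    simp only [mul_sub]
    exact (c1 k hk).1.sub (c1 k hk).2.1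
  have hpsi : T.psi P Q = ∫ o, T.ind (T.lev T.Y) o * T.R Q T.Y o * T.y o ∂P +
        ∫ o, T.ind T.a₀ o * T.y o ∂P := by
    rw [psi, ← hpi, c3, e.2, m2]
  obtain ⟨j1, j2⟩ := integrable_and_integral_eifUncentered iY ik c2 i0
  refine ⟨j1, ?_, hpsi⟩
  · rw [j2]
    have z1 : ∫ o, T.ind (T.lev T.Y) o * T.R Q T.Y o *
        (T.y o - Q.mu (T.setA o (T.lev T.Y))) ∂P = 0 := by
      simp only [mul_sub]
      rw [integral_sub hint.2 m1, m2, sub_self]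
    have z2 : ∑ k ∈ T.Z, ∫ o, T.ind (T.lev k) o * T.R Q k o *
        (T.Bsucc Q k o - T.B Q k o) ∂P = 0 := by
      refine Finset.sum_eq_zero fun k hk => ?_
      simp only [mul_sub]
      rw [integral_sub (c1 k hk).1 (c1 k hk).2.1, (c1 k hk).2.2, sub_self]
    rw [z1, z2, hpi, psi]
    ring

/-- Nuisances bounded as in `BoundedEstimates`. -/
structure IsBounded (T : CausalModel V S) (P : Measure (∀ v, S v)) (C : ℝ) (q : Nuisance V S) :
    Prop where
  nuisance : T.IsNuisance q
  mu_le : ∀ o, |q.mu (T.setA o (T.lev T.Y))| ≤ C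
  R_le : ∀ᵐ o ∂P, ∀ v ∈ insert T.Y T.Z, |T.R q v o| ≤ C

lemma IsBounded.R_le_of_mem {C : ℝ} (hq : T.IsBounded P C q) {v : V} (hv : v ∈ insert T.Y T.Z) :
    ∀ᵐ o ∂P, |T.R q v o| ≤ C := hq.R_le.mono fun _ ho => ho v hv

lemma IsBounded.ind_R_le {C : ℝ} (hq : T.IsBounded P C q) {v : V} (hv : v ∈ insert T.Y T.Z) :
    ∀ᵐ o ∂P, ‖T.ind (T.lev v) o * T.R q v o‖ ≤ C := by
  filter_upwards [hq.R_le_of_mem hv] with o ho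
  rw [norm_mul, Real.norm_of_nonneg (ind_nonneg _ o), Real.norm_eq_abs]
  exact (mul_le_of_le_one_left (abs_nonneg _) (ind_le_one _ o)).trans ho

/-- The bias of the uncentered influence function. -/
lemma IsTruth.integral_eif_eq (hQ : T.IsTruth P Q) (hfact : T.TopologicalFactorization P)
    (hpos : T.Positivity P Q) (hint : T.OutcomeIntegrable P Q) {C : ℝ}
    (hq : T.IsBounded P C q) :
    Integrable (T.eifUncentered q) P ∧ ∫ o, T.eifUncentered q o ∂P = T.psi P Q +
      (∫ o, T.ind (T.lev T.Y) o * (T.R q T.Y o - T.R Q T.Y o) *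
        (T.y o - q.mu (T.setA o (T.lev T.Y))) ∂P +
      ∑ k ∈ T.Z, ∫ o, T.ind (T.lev k) o * (T.R q k o - T.R Q k o) *
        (T.Bsucc q k o - T.B q k o) ∂P) := by
  have hqn := hq.nuisance
  have hy := hint.1
  have hmu : ∀ {F : (∀ v, S v) → ℝ}, Integrable F P →
      Integrable (fun o => F o * q.mu (T.setA o (T.lev T.Y))) P := fun hF =>
    hF.mul_bdd (c := C) (hqn.measurable_mu_setA _).aestronglyMeasurable (ae_of_all _ hq.mu_le)
  have hB : ∀ {F : (∀ v, S v) → ℝ} (k), Integrable F P →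
      Integrable (fun o => F o * T.B q k o) P := fun k hF =>
    hF.mul_bdd (c := C) (hqn.measurable_B k).aestronglyMeasurable (ae_of_all _ fun o =>
      hqn.abs_seqRegList_le hq.mu_le _
        (fun j hj => (Finset.mem_filter.1 ((Finset.mem_sort _).1 hj)).1) o)
  have hBs : ∀ {F : (∀ v, S v) → ℝ} (k), Integrable F P →
      Integrable (fun o => F o * T.Bsucc q k o) P := fun k hF =>
    hF.mul_bdd (c := C) (hqn.measurable_Bsucc k).aestronglyMeasurable (ae_of_all _ fun o =>
      hqn.abs_seqRegList_le hq.mu_le _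
        (fun j hj => (Finset.mem_filter.1 ((Finset.mem_sort _).1 hj)).1) o)
  have hBf : ∀ {F : (∀ v, S v) → ℝ}, Integrable F P →
      Integrable (fun o => F o * T.Bfirst q o) P := fun hF =>
    hF.mul_bdd (c := C) hqn.measurable_Bfirst.aestronglyMeasurable (ae_of_all _ fun o =>
      hqn.abs_seqRegList_le hq.mu_le _ (fun j hj => (Finset.mem_sort _).1 hj) o)
  have hRq : ∀ v ∈ insert T.Y T.Z, Integrable (fun o => T.ind (T.lev v) o * T.R q v o) P :=
    fun v hv => Integrable.of_bound
      ((measurable_ind _).mul (hqn.measurable_R v)).aestronglyMeasurable C (hq.ind_R_le hv)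
  have hRQ : ∀ v, T.A < v → Integrable (fun o => T.ind (T.lev v) o * T.R Q v o) P :=
    fun v hv => hQ.integrable_R hfact hpos hv
  have hYm : T.Y ∈ insert T.Y T.Z := Finset.mem_insert_self _ _
  have iYy : Integrable (fun o => T.ind (T.lev T.Y) o * T.R q T.Y o * T.y o) P :=
    hy.bdd_mul (c := C) ((measurable_ind _).mul (hqn.measurable_R _)).aestronglyMeasurable
      (hq.ind_R_le hYm)
  have iY : Integrable (fun o => T.ind (T.lev T.Y) o * T.R q T.Y o *
      (T.y o - q.mu (T.setA o (T.lev T.Y)))) P := by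
    simp only [mul_sub]
    exact iYy.sub (hmu (hRq _ hYm))
  have iYQ : Integrable (fun o => T.ind (T.lev T.Y) o * T.R Q T.Y o *
      (T.y o - q.mu (T.setA o (T.lev T.Y)))) P := by
    simp only [mul_sub]
    exact hint.2.sub (hmu (hRQ _ T.A_lt_Y))
  have ik : ∀ k ∈ T.Z, Integrable (fun o => T.ind (T.lev k) o * T.R q k o *
      (T.Bsucc q k o - T.B q k o)) P := by
    intro k hk
    simp only [mul_sub]
    exact (hBs k (hRq k (Finset.mem_insert_of_mem hk))).sub
      (hB k (hRq k (Finset.mem_insert_of_mem hk)))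
  have ikQ : ∀ k ∈ T.Z, Integrable (fun o => T.ind (T.lev k) o * T.R Q k o *
      (T.Bsucc q k o - T.B q k o)) P := by
    intro k hk
    simp only [mul_sub]
    exact (hBs k (hRQ k (mem_Z.1 hk).1)).sub (hB k (hRQ k (mem_Z.1 hk).1))
  have iF := hBf (F := T.ind T.a₁) (integrable_ind T.a₁)
  have i0 := integrable_ind_mul_y hint.1 (T := T) T.a₀
  obtain ⟨j1, j2⟩ := integrable_and_integral_eifUncentered iY ik iF i0
  refine ⟨j1, ?_⟩
  · rw [j2]
    have hZ : T.IsInitial T.Z := ⟨Finset.Subset.refl _, fun j hj _ _ _ => hj⟩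
    -- With the true weights and estimated regressions the mediator terms telescope, and the terms
    -- in `μ̂` and `Bfirst` drop out; what remains is the weighted mean of `Y`, the first part of
    -- `ψ`. The bias is the effect of replacing the true weights by the estimated ones.
    have ht := hQ.telescope hfact hpos hqn hq.mu_le hZ
    have hs : ∀ o, T.seqRegList q (T.Z \ T.Z).sort o = q.mu (T.setA o (T.lev T.Y)) := by
      intro o
      rw [Finset.sdiff_self, Finset.sort_empty, seqRegList]
    simp only [hs] at ht
    have e := (hQ.R_switch hfact hpos T.A_lt_Y (hqn.measurable_mu_setA (T.lev T.Y))
      (dependsOn_mu_setA hqn)).2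
    rw [filter_lt_Y] at e
    rw [e] at ht
    have dY : ∫ o, T.ind (T.lev T.Y) o * (T.R q T.Y o - T.R Q T.Y o) *
        (T.y o - q.mu (T.setA o (T.lev T.Y))) ∂P =
        ∫ o, T.ind (T.lev T.Y) o * T.R q T.Y o * (T.y o - q.mu (T.setA o (T.lev T.Y))) ∂P -
        (∫ o, T.ind (T.lev T.Y) o * T.R Q T.Y o * T.y o ∂P -
          ∫ o, T.ind (T.lev T.Y) o * T.R Q T.Y o * q.mu (T.setA o (T.lev T.Y)) ∂P) := by
      rw [← integral_sub hint.2 (hmu (hRQ _ T.A_lt_Y))]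
      simp only [← mul_sub]
      rw [← integral_sub iY iYQ]
      exact integral_congr_ae (ae_of_all _ fun o => by ring)
    have dk : ∑ k ∈ T.Z, ∫ o, T.ind (T.lev k) o * (T.R q k o - T.R Q k o) *
        (T.Bsucc q k o - T.B q k o) ∂P =
        ∑ k ∈ T.Z, ∫ o, T.ind (T.lev k) o * T.R q k o * (T.Bsucc q k o - T.B q k o) ∂P -
        ∑ k ∈ T.Z, ∫ o, T.ind (T.lev k) o * T.R Q k o * (T.Bsucc q k o - T.B q k o) ∂P := by
      rw [← Finset.sum_sub_distrib]
      refine Finset.sum_congr rfl fun k hk => ?_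
      rw [← integral_sub (ik k hk) (ikQ k hk)]
      exact integral_congr_ae (ae_of_all _ fun o => by ring)
    rw [dY, dk, ht, (hQ.integral_eif hfact hpos hint).2.2]
    ring

end CausalModel

/-! ### Bounds on the bias terms. -/

namespace CausalModel

variable {V : Type u} [LinearOrder V] [Fintype V] {S : V → Type w} [∀ v, MeasurableSpace (S v)]
  {T : CausalModel V S}
variable {P : Measure (∀ v, S v)} [IsProbabilityMeasure P] {Q q : Nuisance V S}

section Bias

/-- The bias term of a mediator. -/
noncomputable def biasZ (T : CausalModel V S) (P : Measure (∀ v, S v)) (Q : Nuisance V S) (k : V)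
    (q : Nuisance V S) : ℝ :=
  ∫ o, T.ind (T.lev k) o * (T.R q k o - T.R Q k o) * (T.Bsucc q k o - T.B q k o) ∂P

/-- The bias term of the outcome. -/
noncomputable def biasY (T : CausalModel V S) (P : Measure (∀ v, S v)) (Q q : Nuisance V S) : ℝ :=
  ∫ o, T.ind (T.lev T.Y) o * (T.R q T.Y o - T.R Q T.Y o) *
    (T.y o - q.mu (T.setA o (T.lev T.Y))) ∂P

/-- The relative shortfall of the density `f_k` of `q` below that of `Q`. -/
noncomputable def shortfall (Q q : Nuisance V S) (k : V) (o : ∀ v, S v) : ℝ :=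
  max 0 (1 - q.f k o / Q.f k o)

lemma shortfall_nonneg (Q q : Nuisance V S) (k : V) (o : ∀ v, S v) : 0 ≤ shortfall Q q k o :=
  le_max_left _ _

/-- However large the estimated density is, the one-sided relative error stays in `[0, 1]`. This
supplies the domination in `tendsto_biasZ` without any bound on the densities. -/
lemma IsNuisance.shortfall_le_one (hQ : T.IsNuisance Q) (hq : T.IsNuisance q) {k : V}
    (hk : k ∈ T.Z) (o : ∀ v, S v) : shortfall Q q k o ≤ 1 :=
  max_le zero_le_one (sub_le_self _ (div_nonneg (hq.f_nonneg k hk o) (hQ.f_nonneg k hk o)))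

lemma IsNuisance.measurable_shortfall (hQ : T.IsNuisance Q) (hq : T.IsNuisance q) {k : V}
    (hk : k ∈ T.Z) : Measurable (shortfall Q q k) :=
  measurable_const.max (measurable_const.sub ((hq.f_meas k hk).div (hQ.f_meas k hk)))

/-- The `L¹` distance of two densities, in terms of the shortfall. -/
lemma IsNuisance.integral_abs_sub_density (hQ : T.IsNuisance Q) (hq : T.IsNuisance q) {k : V}
    (hk : k ∈ T.Z) (o : ∀ v, S v) :
    ∫ z, |Q.f k (Function.update o k z) - q.f k (Function.update o k z)| ∂(T.ν k) =
      2 * ∫ z, Q.f k (Function.update o k z) * shortfall Q q k (Function.update o k z) ∂(T.ν k) := by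
  obtain ⟨i1, e1⟩ := hQ.integrable_density hk o
  obtain ⟨i2, e2⟩ := hq.integrable_density hk o
  have i3 : Integrable (fun z => Q.f k (Function.update o k z) *
      shortfall Q q k (Function.update o k z)) (T.ν k) :=
    i1.mul_bdd (c := 1)
      (((hQ.measurable_shortfall hq hk).comp (measurable_update o)).aestronglyMeasurable)
      (ae_of_all _ fun z => by
        rw [Real.norm_of_nonneg (shortfall_nonneg _ _ _ _)]
        exact hQ.shortfall_le_one hq hk _)
  -- The identity is `|x - y| = 2 (x - y)⁺ - (x - y)`; the last difference integrates to zero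
  -- because both densities have mass one.
  have e : ∀ z, |Q.f k (Function.update o k z) - q.f k (Function.update o k z)| =
      2 * (Q.f k (Function.update o k z) * shortfall Q q k (Function.update o k z)) -
        (Q.f k (Function.update o k z) - q.f k (Function.update o k z)) := by
    intro z
    set x := Q.f k (Function.update o k z) with hx
    set y := q.f k (Function.update o k z) with hy
    have hx0 : 0 ≤ x := hQ.f_nonneg k hk _
    have hy0 : 0 ≤ y := hq.f_nonneg k hk _
    have hs : x * shortfall Q q k (Function.update o k z) = max 0 (x - y) := by
      rw [shortfall, ← hx, ← hy]
      rcases hx0.eq_or_lt with h0 | h0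
      · rw [← h0, zero_mul, max_eq_left (by linarith)]
      · rw [mul_max_of_nonneg _ _ hx0, mul_zero, mul_sub, mul_one, mul_div_cancel₀ _ h0.ne']
    rw [hs]
    rcases le_total x y with h | h
    · rw [abs_of_nonpos (by linarith), max_eq_left (by linarith)]; ring
    · rw [abs_of_nonneg (by linarith), max_eq_right (by linarith)]; ring
  simp only [e]
  refine (integral_sub (i3.const_mul 2) (i1.sub i2)).trans ?_
  simp only [Pi.sub_apply]
  rw [integral_sub i1 i2, e1, e2, integral_const_mul]
  ring

lemma integrable_weight_diff (hQ : T.IsTruth P Q) (hfact : T.TopologicalFactorization P)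
    (hpos : T.Positivity P Q) {C : ℝ} (hq : T.IsBounded P C q) {v : V}
    (hv : v ∈ insert T.Y T.Z) :
    Integrable (fun o => T.ind (T.lev v) o * (T.R q v o - T.R Q v o)) P := by
  have hA : T.A < v := by
    rcases Finset.mem_insert.1 hv with rfl | h
    · exact T.A_lt_Y
    · exact (mem_Z.1 h).1
  simp only [mul_sub]
  exact (Integrable.of_bound ((measurable_ind _).mul
    (hq.nuisance.measurable_R v)).aestronglyMeasurable C (hq.ind_R_le hv)).sub
    (hQ.integrable_R hfact hpos hA)

/-- The weight difference is fixed given the past of `k`, and the conditional mean of `Bsucc - B` is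
the integral of `(f_k - f̂_k) Bsucc`, at most `C` times the `L¹` distance of the densities. That
distance is twice a true conditional mean of the shortfall, so the tower property applied backwards
returns an expectation under `P`. -/
lemma IsTruth.abs_biasZ_le (hQ : T.IsTruth P Q) (hfact : T.TopologicalFactorization P)
    (hpos : T.Positivity P Q) {C : ℝ} (hq : T.IsBounded P C q) {k : V} (hk : k ∈ T.Z) :
    |T.biasZ P Q k q| ≤ 2 * C *
      ∫ o, T.ind (T.lev k) o * |T.R q k o - T.R Q k o| * shortfall Q q k o ∂P := by
  have hn := hQ.nuisance
  have hqn := hq.nuisance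
  have hkA := (mem_Z.1 hk).1
  have hkA' := ne_A_of_mem_Z hk
  have hw := integrable_weight_diff hQ hfact hpos hq (Finset.mem_insert_of_mem hk)
  have hBsC : ∀ o, |T.Bsucc q k o| ≤ C := hqn.abs_seqRegList_le hq.mu_le _
    (fun j hj => (Finset.mem_filter.1 ((Finset.mem_sort _).1 hj)).1)
  have hBC : ∀ o, |T.B q k o| ≤ C := hqn.abs_seqRegList_le hq.mu_le _
    (fun j hj => (Finset.mem_filter.1 ((Finset.mem_sort _).1 hj)).1)
  have hC0 : 0 ≤ C := by
    obtain ⟨o₀⟩ : Nonempty (∀ v, S v) := nonempty_of_isProbabilityMeasure P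
    exact (abs_nonneg _).trans (hBC o₀)
  have hG : Measurable fun o => T.R q k o - T.R Q k o := (hqn.measurable_R k).sub (hn.measurable_R k)
  have hGd : DependsOn (fun o => T.R q k o - T.R Q k o) (Set.Iio k) := fun x y h => by
    beta_reduce
    rw [hqn.dependsOn_R_Iio hkA h, hn.dependsOn_R_Iio hkA h]
  have iBs := hw.mul_bdd (c := C) (hqn.measurable_Bsucc k).aestronglyMeasurable
    (ae_of_all _ hBsC)
  have iB := hw.mul_bdd (c := C) (hqn.measurable_B k).aestronglyMeasurable (ae_of_all _ hBC)
  obtain ⟨t1, t2⟩ := hQ.integral_tower_lev hfact hk hG hGd (hqn.measurable_Bsucc k)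
    ((hqn.dependsOn_Bsucc hk).mono Set.sdiff_subset) iBs
  -- the shortfall at the level of `k`
  set s : (∀ v, S v) → ℝ := fun o => shortfall Q q k (T.setA o (T.lev k)) with hs
  have hsm : Measurable s := (hn.measurable_shortfall hqn hk).comp (measurable_setA _)
  have hsd : DependsOn s (Set.Iic k) := fun x y h => by
    have h' : ∀ i ∈ Set.Iic k \ {T.A}, x i = y i := fun i hi => h i hi.1
    simp only [hs, shortfall]
    rw [setA_congr (hn.f_dep_Iic hk) _ h', setA_congr (hqn.f_dep_Iic hk) _ h']
  have habs : Integrable (fun o => T.ind (T.lev k) o * |T.R q k o - T.R Q k o|) P :=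
    hw.abs.congr (ae_of_all _ fun o => by
      beta_reduce
      rw [abs_mul, abs_of_nonneg (ind_nonneg _ o)])
  have is : Integrable (fun o => T.ind (T.lev k) o * |T.R q k o - T.R Q k o| * s o) P :=
    habs.mul_bdd (c := 1) hsm.aestronglyMeasurable (ae_of_all _ fun o => by
      rw [Real.norm_of_nonneg (shortfall_nonneg _ _ _ _)]
      exact hn.shortfall_le_one hqn hk _)
  obtain ⟨u1, u2⟩ := hQ.integral_tower_lev hfact hk (G := fun o => |T.R q k o - T.R Q k o|)
    hG.abs (fun x y h => congrArg abs (hGd h)) hsm hsd is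
  have e3 : ∫ o, T.ind (T.lev k) o * |T.R q k o - T.R Q k o| * shortfall Q q k o ∂P =
      ∫ o, T.ind (T.lev k) o * |T.R q k o - T.R Q k o| * s o ∂P := by
    refine integral_congr_ae (ae_of_all _ fun o => ?_)
    rcases ind_eq_zero_or (T := T) (T.lev k) o with h0 | h0
    · simp [h0]
    · simp only [hs, h0]
  rw [biasZ]
  simp only [mul_sub (T.ind _ _ * _)]
  rw [integral_sub iBs iB, t2, ← integral_sub t1 iB, e3, u2, ← integral_const_mul,
    ← Real.norm_eq_abs]
  refine norm_integral_le_of_norm_le (u1.const_mul (2 * C)) (ae_of_all _ fun o => ?_)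
  rw [← mul_sub, norm_mul, norm_mul, Real.norm_of_nonneg (ind_nonneg _ o), Real.norm_eq_abs,
    Real.norm_eq_abs]
  have hin : |(∫ z, Q.f k (Function.update (T.setA o (T.lev k)) k z) *
        T.Bsucc q k (Function.update o k z) ∂(T.ν k)) - T.B q k o| ≤
      2 * C * ∫ z, Q.f k (Function.update (T.setA o (T.lev k)) k z) *
        s (Function.update o k z) ∂(T.ν k) := by
    obtain ⟨i1, _⟩ := hn.integrable_density hk (T.setA o (T.lev k))
    obtain ⟨i2, _⟩ := hqn.integrable_density hk (T.setA o (T.lev k))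
    have hbm : AEStronglyMeasurable (fun z => T.Bsucc q k (Function.update o k z)) (T.ν k) :=
      ((hqn.measurable_Bsucc k).comp (measurable_update o)).aestronglyMeasurable
    rw [B_eq q hk, ← integral_sub
      (i1.mul_bdd (c := C) hbm (ae_of_all _ fun z => hBsC _))
      (i2.mul_bdd (c := C) hbm (ae_of_all _ fun z => hBsC _)), ← Real.norm_eq_abs]
    refine (norm_integral_le_of_norm_le ((i1.sub i2).abs.mul_const C)
      (ae_of_all _ fun z => ?_)).trans_eq ?_
    · rw [← sub_mul, norm_mul, Real.norm_eq_abs, Real.norm_eq_abs]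
      exact mul_le_mul_of_nonneg_left (hBsC _) (abs_nonneg _)
    · rw [integral_mul_const]
      simp only [Pi.sub_apply]
      rw [hn.integral_abs_sub_density hqn hk]
      simp only [hs, setA_update hkA']
      ring
  calc T.ind (T.lev k) o * |T.R q k o - T.R Q k o| * _ ≤
      T.ind (T.lev k) o * |T.R q k o - T.R Q k o| * (2 * C *
        ∫ z, Q.f k (Function.update (T.setA o (T.lev k)) k z) *
          s (Function.update o k z) ∂(T.ν k)) :=
        mul_le_mul_of_nonneg_left hin (mul_nonneg (ind_nonneg _ _) (abs_nonneg _))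
    _ = _ := by ring

/-- The weight difference depends only on predecessors of the outcome, so `Y` may be replaced by its
true regression; this exposes the error of `μ̂`. -/
lemma IsTruth.biasY_eq (hQ : T.IsTruth P Q) (hfact : T.TopologicalFactorization P)
    (hpos : T.Positivity P Q) (hint : T.OutcomeIntegrable P Q) {C : ℝ}
    (hq : T.IsBounded P C q) :
    T.biasY P Q q = ∫ o, T.ind (T.lev T.Y) o * (T.R q T.Y o - T.R Q T.Y o) *
      (Q.mu o - q.mu (T.setA o (T.lev T.Y))) ∂P := by
  have hn := hQ.nuisance
  have hqn := hq.nuisance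
  have hYm : T.Y ∈ insert T.Y T.Z := Finset.mem_insert_self _ _
  have hw := integrable_weight_diff hQ hfact hpos hq hYm
  have imu := hw.mul_bdd (c := C) (hqn.measurable_mu_setA (T.lev T.Y)).aestronglyMeasurable
    (ae_of_all _ hq.mu_le)
  have iy : Integrable (fun o => T.ind (T.lev T.Y) o * (T.R q T.Y o - T.R Q T.Y o) * T.y o) P := by
    simp only [mul_sub, sub_mul]
    exact (hint.1.bdd_mul (c := C) ((measurable_ind _).mul
      (hqn.measurable_R _)).aestronglyMeasurable (hq.ind_R_le hYm)).sub hint.2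
  obtain ⟨m1, m2⟩ := hQ.integral_outcome hfact hint.1
    (G := fun o => T.ind (T.lev T.Y) o * (T.R q T.Y o - T.R Q T.Y o))
    ((measurable_ind _).mul ((hqn.measurable_R _).sub (hn.measurable_R _)))
    (fun x y h => by
      have h1 := dependsOn_ind_mul_R hqn h
      have h2 := dependsOn_ind_mul_R hn h
      beta_reduce at h1 h2 ⊢
      rw [mul_sub, mul_sub, h1, h2]) iy
  rw [biasY]
  simp only [mul_sub (T.ind _ _ * _)]
  rw [integral_sub iy imu, integral_sub m1 imu, m2]

end Bias

/-! ### Limits of the bias terms along deterministic sequences. -/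

section Limits

/-- Properties of the predecessors of the outcome that hold almost surely also hold after the
treatment level is set. -/
lemma IsTruth.ae_setA (hQ : T.IsTruth P Q) (hfact : T.TopologicalFactorization P)
    (hpos : T.Positivity P Q) {p : (∀ v, S v) → Prop} (hpm : MeasurableSet {o | p o})
    (hpd : DependsOn p (Set.Iio T.Y)) (hp : ∀ᵐ o ∂P, p o) (a : Bool) :
    ∀ᵐ o ∂P, p (T.setA o a) := by
  have hn := hQ.nuisance
  set F : (∀ v, S v) → ℝ≥0∞ := {o | p o}ᶜ.indicator 1 with hF
  have hFm : Measurable F := measurable_one.indicator hpm.compl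
  have hFd : DependsOn F (T.upTo T.Z) := by
    have e : T.upTo T.Z = Set.Iio T.Y := by rw [Iio_eq_upTo T.A_lt_Y, filter_lt_Y]
    rw [e]
    intro x y h
    have hxy : x ∈ {o | p o}ᶜ ↔ y ∈ {o | p o}ᶜ := by
      change ¬ p x ↔ ¬ p y
      rw [hpd h]
    by_cases hx : x ∈ {o | p o}ᶜ
    · simp only [hF, Set.indicator_of_mem hx, Set.indicator_of_mem (hxy.1 hx), Pi.one_apply]
    · simp only [hF, Set.indicator_of_notMem hx, Set.indicator_of_notMem (fun h => hx (hxy.2 h))]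
  have hZ : T.IsInitial T.Z := ⟨Finset.Subset.refl _, fun j hj _ _ _ => hj⟩
  -- Apply the switch to the indicator of the exceptional set: the left side vanishes, and on the
  -- right the exceptional set is seen at the assigned level with almost surely positive ratios in
  -- front.
  have e := hQ.lintegral_switch hfact hpos a T.Z hZ hFm hFd
  have e0 : ∫⁻ o, ENNReal.ofReal (T.ind a o) * F o ∂P = 0 := by
    refine (lintegral_eq_zero_iff ((measurable_ind a).ennreal_ofReal.mul hFm)).2 ?_
    filter_upwards [hp] with o ho
    have : o ∉ {o | p o}ᶜ := fun h => h ho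
    simp [hF, Set.indicator_of_notMem this]
  have hrm : Measurable fun o => ENNReal.ofReal (T.ind (!a) o) *
      (ENNReal.ofReal (Q.pi a o / Q.pi (!a) o) *
        (∏ j ∈ T.Z, ENNReal.ofReal (T.levelRatio Q a j o)) * F (T.setA o a)) := by
    refine (measurable_ind _).ennreal_ofReal.mul
      ((((hn.pi_meas a).div (hn.pi_meas !a)).ennreal_ofReal.mul ?_).mul
        (hFm.comp (measurable_setA a)))
    exact Finset.measurable_prod _ fun j hj => (hn.measurable_levelRatio a hj).ennreal_ofReal
  rw [e0, eq_comm, lintegral_eq_zero_iff hrm] at e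
  filter_upwards [e, hp, hpos] with o ho hpo hpos
  by_cases hl : T.level (o T.A) = a
  · rwa [setA_eq_self hl]
  · have hi : T.ind (!a) o = 1 := by
      rw [ind, if_pos]
      revert hl
      cases T.level (o T.A) <;> cases a <;> simp
    by_contra hcon
    have hmem : T.setA o a ∈ {o | p o}ᶜ := hcon
    simp only [hi, hF, Set.indicator_of_mem hmem, Pi.one_apply, mul_one, ENNReal.ofReal_one,
      one_mul, Pi.zero_apply, mul_eq_zero, ENNReal.ofReal_eq_zero, Finset.prod_eq_zero_iff] at ho
    rcases ho with h | ⟨j, hj, h⟩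
    · exact absurd (div_pos (hpos a).1 (hpos !a).1) (not_lt.2 h)
    · exact absurd (div_pos ((hpos a).2 j hj) ((hpos !a).2 j hj)) (not_lt.2 h)

variable {qs : ℕ → Nuisance V S}

/-- The norm controls the density only at the observed treatment, while the ratios evaluate it at
both levels; `ae_setA` carries the convergence over. -/
lemma IsTruth.ae_tendsto_f (hQ : T.IsTruth P Q) (hfact : T.TopologicalFactorization P)
    (hpos : T.Positivity P Q) (hqs : ∀ m, T.IsNuisance (qs m)) {k : V} (hk : k ∈ T.Z)
    (h : ∀ m, eLpNorm (fun o => (qs m).f k o - Q.f k o) 2 P ≤ 2⁻¹ ^ m) (a : Bool) :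
    ∀ᵐ o ∂P, Tendsto (fun m => (qs m).f k (T.setA o a)) atTop (𝓝 (Q.f k (T.setA o a))) := by
  have hn := hQ.nuisance
  have hsub : Set.Iic k ⊆ Set.Iio T.Y := fun i hi => lt_of_le_of_lt hi (lt_Y_of_mem_Z hk)
  refine hQ.ae_setA hfact hpos
    (p := fun o => Tendsto (fun m => (qs m).f k o) atTop (𝓝 (Q.f k o))) ?_ ?_ ?_ a
  · exact measurableSet_tendsto_fun (fun m => (hqs m).f_meas k hk) (hn.f_meas k hk)
  · intro x y hxy
    have hxy' : ∀ i ∈ Set.Iic k, x i = y i := fun i hi => hxy i (hsub hi)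
    simp only [hn.f_dep_Iic hk hxy', (hqs _).f_dep_Iic hk hxy']
  · filter_upwards [ae_tendsto_of_eLpNorm_two_le
      (fun m => (((hqs m).f_meas k hk).sub (hn.f_meas k hk)).aestronglyMeasurable) h] with o ho
    exact tendsto_sub_nhds_zero_iff.1 ho

lemma IsTruth.ae_tendsto_pi (hQ : T.IsTruth P Q) (hqs : ∀ m, T.IsNuisance (qs m))
    (h : ∀ m, eLpNorm (fun o => (qs m).pi T.a₁ o - Q.pi T.a₁ o) 2 P ≤ 2⁻¹ ^ m) :
    ∀ᵐ o ∂P, Tendsto (fun m => (qs m).pi T.a₁ o) atTop (𝓝 (Q.pi T.a₁ o)) := by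
  filter_upwards [ae_tendsto_of_eLpNorm_two_le
    (fun m => (((hqs m).pi_meas _).sub (hQ.nuisance.pi_meas _)).aestronglyMeasurable) h] with o ho
  exact tendsto_sub_nhds_zero_iff.1 ho

lemma IsTruth.ae_tendsto_mu (hQ : T.IsTruth P Q) (hqs : ∀ m, T.IsNuisance (qs m))
    (h : ∀ m, eLpNorm (fun o => (qs m).mu o - Q.mu o) 2 P ≤ 2⁻¹ ^ m) :
    ∀ᵐ o ∂P, Tendsto (fun m => (qs m).mu o) atTop (𝓝 (Q.mu o)) := by
  filter_upwards [ae_tendsto_of_eLpNorm_two_le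
    (fun m => ((hqs m).mu_meas.sub hQ.nuisance.mu_meas).aestronglyMeasurable) h] with o ho
  exact tendsto_sub_nhds_zero_iff.1 ho

/-- Convergence of the products of density ratios. -/
lemma IsTruth.ae_tendsto_R (hQ : T.IsTruth P Q) (hfact : T.TopologicalFactorization P)
    (hpos : T.Positivity P Q) (hqs : ∀ m, T.IsNuisance (qs m)) {v : V}
    (hf : ∀ i ∈ T.Z, i < v → T.lev i ≠ T.lev v →
      ∀ m, eLpNorm (fun o => (qs m).f i o - Q.f i o) 2 P ≤ 2⁻¹ ^ m)
    (hpi : v ∉ T.L → ∀ m, eLpNorm (fun o => (qs m).pi T.a₁ o - Q.pi T.a₁ o) 2 P ≤ 2⁻¹ ^ m) :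
    ∀ᵐ o ∂P, Tendsto (fun m => T.R (qs m) v o) atTop (𝓝 (T.R Q v o)) := by
  have hfr : ∀ᵐ o ∂P, ∀ i ∈ T.Z, i < v → T.lev i ≠ T.lev v →
      Tendsto (fun m => T.fr (qs m) i o) atTop (𝓝 (T.fr Q i o)) := by
    rw [ae_all_iff]
    intro i
    by_cases hi : i ∈ T.Z ∧ i < v ∧ T.lev i ≠ T.lev v
    · have h := hf i hi.1 hi.2.1 hi.2.2
      filter_upwards [hQ.ae_tendsto_f hfact hpos hqs hi.1 h (T.lev i),
        hQ.ae_tendsto_f hfact hpos hqs hi.1 h (!(T.lev i)), hpos] with o h1 h2 ho _ _ _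
      exact h1.div h2 ((ho _).2 i hi.1).ne'
    · exact ae_of_all _ fun o h1 h2 h3 => absurd ⟨h1, h2, h3⟩ hi
  have hne : T.a₀ ≠ T.a₁ := by unfold a₁; cases T.a₀ <;> simp
  by_cases hv : v ∈ T.L
  · filter_upwards [hfr] with o ho
    simp only [R_of_mem _ hv, weightM]
    refine tendsto_finsetProd _ fun i hi => ?_
    obtain ⟨hi1, hi2⟩ := Finset.mem_filter.1 hi
    obtain ⟨hi3, hi4⟩ := Finset.mem_filter.1 hi1
    refine ho i hi3 hi4 ?_
    rw [lev_of_mem hv, lev_of_notMem ((mem_M_iff (mem_Z.1 hi3).1).1 hi2)]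
    exact hne
  · filter_upwards [hfr, hQ.ae_tendsto_pi hqs (hpi hv), hpos] with o ho hpo hp
    simp only [R_of_notMem _ hv, weightL]
    refine Tendsto.mul ?_ (tendsto_finsetProd _ fun i hi => ?_)
    -- Consistency is assumed for `π̂(a₁ | ·)` only; the denominator follows since the two
    -- propensities sum to one.
    · have e : ∀ q : Nuisance V S, T.IsNuisance q → q.pi T.a₀ o = 1 - q.pi T.a₁ o := fun q hq => by
        linarith [hq.pi_sum o]
      have h0 : Tendsto (fun m => (qs m).pi T.a₀ o) atTop (𝓝 (Q.pi T.a₀ o)) := by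
        rw [e Q hQ.nuisance]
        simp only [fun m => e (qs m) (hqs m)]
        exact tendsto_const_nhds.sub hpo
      exact hpo.div h0 (hp _).1.ne'
    · obtain ⟨hi1, hi2⟩ := Finset.mem_filter.1 hi
      obtain ⟨hi3, hi4⟩ := Finset.mem_filter.1 hi1
      refine ho i hi3 hi4 ?_
      rw [lev_of_notMem hv, lev_of_mem hi2]
      exact hne.symm

lemma IsBounded.abs_R_sub_le (hQ : T.IsTruth P Q) {C : ℝ} (hq : T.IsBounded P C q) {v : V}
    (hv : v ∈ insert T.Y T.Z) : ∀ᵐ o ∂P, |T.R q v o - T.R Q v o| ≤ C + T.R Q v o := by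
  filter_upwards [hq.R_le_of_mem hv] with o ho
  have h0 := hQ.nuisance.R_nonneg v o
  refine (abs_sub _ _).trans ?_
  rw [abs_of_nonneg h0]
  linarith

/-- In the bound of `abs_biasZ_le` the shortfall is at most one and the weight error at most `C +
𝓡_k`, which is integrable on `A = a_k`. Dominated convergence therefore needs only one of the two
factors to tend to zero. -/
lemma IsTruth.tendsto_biasZ (hQ : T.IsTruth P Q) (hfact : T.TopologicalFactorization P)
    (hpos : T.Positivity P Q) {C : ℝ} (hqs : ∀ m, T.IsBounded P C (qs m)) {k : V} (hk : k ∈ T.Z)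
    (h : (∀ᵐ o ∂P, Tendsto (fun m => T.R (qs m) k o) atTop (𝓝 (T.R Q k o))) ∨
      ∀ m, eLpNorm (fun o => (qs m).f k o - Q.f k o) 2 P ≤ 2⁻¹ ^ m) :
    Tendsto (fun m => T.biasZ P Q k (qs m)) atTop (𝓝 0) := by
  have hn := hQ.nuisance
  have hkm := Finset.mem_insert_of_mem (b := T.Y) hk
  rw [tendsto_zero_iff_abs_tendsto_zero]
  refine squeeze_zero (fun m => abs_nonneg _)
    (fun m => hQ.abs_biasZ_le hfact hpos (hqs m) hk) ?_
  rw [← mul_zero (2 * C)]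
  refine Tendsto.const_mul (2 * C) ?_
  rw [← integral_zero (∀ v, S v) ℝ (μ := P)]
  have hR := hQ.integrable_R hfact hpos (mem_Z.1 hk).1
  refine tendsto_integral_of_dominated_convergence
    (fun o => T.ind (T.lev k) o * C + T.ind (T.lev k) o * T.R Q k o) (fun m => ?_)
    (((integrable_ind _).mul_const C).add hR) (fun m => ?_) ?_
  · exact (((measurable_ind _).mul (((hqs m).nuisance.measurable_R k).sub
      (hn.measurable_R k)).abs).mul
        (hn.measurable_shortfall (hqs m).nuisance hk)).aestronglyMeasurable
  · filter_upwards [(hqs m).abs_R_sub_le hQ hkm] with o ho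
    rw [norm_mul, norm_mul, Real.norm_of_nonneg (ind_nonneg _ o),
      Real.norm_of_nonneg (shortfall_nonneg _ _ _ _), Real.norm_eq_abs, abs_abs, ← mul_add]
    have h1 := mul_le_mul_of_nonneg_left ho (ind_nonneg (T := T) (T.lev k) o)
    exact (mul_le_of_le_one_right (mul_nonneg (ind_nonneg _ _) (abs_nonneg _))
      (hn.shortfall_le_one (hqs m).nuisance hk o)).trans h1
  · rcases h with h | h
    · filter_upwards [h] with o ho
      have h1 : Tendsto (fun m => T.ind (T.lev k) o * |T.R (qs m) k o - T.R Q k o|) atTop (𝓝 0) := by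
        rw [← mul_zero (T.ind (T.lev k) o)]
        refine Tendsto.const_mul _ ?_
        simpa using (ho.sub_const (T.R Q k o)).abs
      refine squeeze_zero (fun m => mul_nonneg (mul_nonneg (ind_nonneg _ _) (abs_nonneg _))
        (shortfall_nonneg _ _ _ _)) (fun m => ?_) h1
      exact mul_le_of_le_one_right (mul_nonneg (ind_nonneg _ _) (abs_nonneg _))
        (hn.shortfall_le_one (hqs m).nuisance hk o)
    · have hb : ∀ᵐ o ∂P, ∀ m, |T.R (qs m) k o - T.R Q k o| ≤ C + T.R Q k o :=
        ae_all_iff.2 fun m => (hqs m).abs_R_sub_le hQ hkm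
      filter_upwards [hQ.ae_tendsto_f hfact hpos (fun m => (hqs m).nuisance) hk h (T.lev k), hpos,
        hb] with o ho hp hbo
      rcases ind_eq_zero_or (T := T) (T.lev k) o with h0 | h0
      · simp [h0]
      · have hp := (hp (T.lev k)).2 k hk
        rw [h0] at ho hp
        have hs : Tendsto (fun m => shortfall Q (qs m) k o) atTop (𝓝 0) := by
          have h1 : Tendsto (fun m => (qs m).f k o / Q.f k o) atTop (𝓝 1) := by
            rw [← div_self hp.ne']
            exact ho.div_const _
          have h2 := (tendsto_const_nhds (x := (0 : ℝ))).max
            ((tendsto_const_nhds (x := (1 : ℝ))).sub h1)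
          simpa [shortfall] using h2
        have h3 : Tendsto (fun m => T.ind (T.lev k) o * (C + T.R Q k o) *
            shortfall Q (qs m) k o) atTop (𝓝 0) := by
          simpa using hs.const_mul (T.ind (T.lev k) o * (C + T.R Q k o))
        refine squeeze_zero (fun m => mul_nonneg (mul_nonneg (ind_nonneg _ _) (abs_nonneg _))
          (shortfall_nonneg _ _ _ _)) (fun m => ?_) h3
        exact mul_le_mul_of_nonneg_right (mul_le_mul_of_nonneg_left (hbo m) (ind_nonneg _ _))
          (shortfall_nonneg _ _ _ _)

/-- As for the mediators, but the second factor is unbounded and is dominated by `|μ| + C`. -/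
lemma IsTruth.tendsto_biasY (hQ : T.IsTruth P Q) (hfact : T.TopologicalFactorization P)
    (hpos : T.Positivity P Q) (hint : T.OutcomeIntegrable P Q) {C : ℝ}
    (hqs : ∀ m, T.IsBounded P C (qs m))
    (h : (∀ᵐ o ∂P, Tendsto (fun m => T.R (qs m) T.Y o) atTop (𝓝 (T.R Q T.Y o))) ∨
      ∀ m, eLpNorm (fun o => (qs m).mu o - Q.mu o) 2 P ≤ 2⁻¹ ^ m) :
    Tendsto (fun m => T.biasY P Q (qs m)) atTop (𝓝 0) := by
  have hn := hQ.nuisance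
  have hYm : T.Y ∈ insert T.Y T.Z := Finset.mem_insert_self _ _
  simp only [fun m => hQ.biasY_eq hfact hpos hint (hqs m)]
  rw [← integral_zero (∀ v, S v) ℝ (μ := P)]
  have hR := hQ.integrable_R hfact hpos T.A_lt_Y
  have hRmu := (hQ.integral_mu hfact hint).1
  have hmu : Integrable Q.mu P := integrable_condExp.congr hQ.mu_eq.symm
  have hb : ∀ᵐ o ∂P, ∀ m, |T.R (qs m) T.Y o - T.R Q T.Y o| ≤ C + T.R Q T.Y o :=
    ae_all_iff.2 fun m => (hqs m).abs_R_sub_le hQ hYm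
  have hmub : ∀ m o, |Q.mu o - (qs m).mu (T.setA o (T.lev T.Y))| ≤ |Q.mu o| + C := fun m o =>
    (abs_sub _ _).trans (by linarith [(hqs m).mu_le o])
  refine tendsto_integral_of_dominated_convergence
    -- The four terms come from expanding `(C + 𝓡_Y) (|μ| + C)`. The product of `𝓡_Y` and `μ` is
    -- integrable on `A = a_Y` because the weighted outcome is.
    (fun o => C * |Q.mu o| + C * C + |T.ind (T.lev T.Y) o * T.R Q T.Y o * Q.mu o| +
      T.ind (T.lev T.Y) o * T.R Q T.Y o * C) (fun m => ?_)
    ((((hmu.abs.const_mul C).add (integrable_const _)).add hRmu.abs).add (hR.mul_const C))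
    (fun m => ?_) ?_
  · exact (((measurable_ind _).mul (((hqs m).nuisance.measurable_R _).sub
      (hn.measurable_R _))).mul
        (hn.mu_meas.sub ((hqs m).nuisance.measurable_mu_setA _))).aestronglyMeasurable
  · filter_upwards [hb] with o ho
    have hR0 := hn.R_nonneg T.Y o
    have hC0 : 0 ≤ C := (abs_nonneg _).trans ((hqs m).mu_le o)
    have hi0 := ind_nonneg (T := T) (T.lev T.Y) o
    have hi1 := ind_le_one (T := T) (T.lev T.Y) o
    rw [norm_mul, norm_mul, Real.norm_of_nonneg hi0, Real.norm_eq_abs, Real.norm_eq_abs,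
      abs_mul, abs_mul, abs_of_nonneg hi0, abs_of_nonneg hR0]
    have h1 : T.ind (T.lev T.Y) o * |T.R (qs m) T.Y o - T.R Q T.Y o| *
        |Q.mu o - (qs m).mu (T.setA o (T.lev T.Y))| ≤
        T.ind (T.lev T.Y) o * (C + T.R Q T.Y o) * (|Q.mu o| + C) := by
      have := ho m
      have := hmub m o
      gcongr
    have h2 : T.ind (T.lev T.Y) o * (C * (|Q.mu o| + C)) ≤ C * (|Q.mu o| + C) :=
      mul_le_of_le_one_left (by positivity) hi1
    linarith
  · rcases h with h | h
    · filter_upwards [h] with o ho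
      have h1 : Tendsto (fun m => T.ind (T.lev T.Y) o * |T.R (qs m) T.Y o - T.R Q T.Y o| *
          (|Q.mu o| + C)) atTop (𝓝 0) := by
        have h2 : Tendsto (fun m => |T.R (qs m) T.Y o - T.R Q T.Y o|) atTop (𝓝 0) := by
          simpa using (ho.sub_const (T.R Q T.Y o)).abs
        simpa using (h2.const_mul (T.ind (T.lev T.Y) o)).mul_const (|Q.mu o| + C)
      refine squeeze_zero_norm (fun m => ?_) h1
      rw [norm_mul, norm_mul, Real.norm_of_nonneg (ind_nonneg _ o), Real.norm_eq_abs,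
        Real.norm_eq_abs]
      exact mul_le_mul_of_nonneg_left (hmub m o) (mul_nonneg (ind_nonneg _ _) (abs_nonneg _))
    -- Convergence of `μ̂` at the observed treatment suffices, because the integrand carries the
    -- indicator of `A = a_Y`.
    · filter_upwards [hQ.ae_tendsto_mu (fun m => (hqs m).nuisance) h, hb] with o ho hbo
      rcases ind_eq_zero_or (T := T) (T.lev T.Y) o with h0 | h0
      · simp [h0]
      · rw [h0]
        have h1 : Tendsto (fun m => T.ind (T.lev T.Y) o * (C + T.R Q T.Y o) *
            |Q.mu o - (qs m).mu o|) atTop (𝓝 0) := by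
          have h2 := ((tendsto_const_nhds (x := Q.mu o)).sub ho).abs.const_mul
            (T.ind (T.lev T.Y) o * (C + T.R Q T.Y o))
          simpa using h2
        refine squeeze_zero_norm (fun m => ?_) h1
        rw [norm_mul, norm_mul, Real.norm_of_nonneg (ind_nonneg _ o), Real.norm_eq_abs,
          Real.norm_eq_abs]
        exact mul_le_mul_of_nonneg_right (mul_le_mul_of_nonneg_left (hbo m) (ind_nonneg _ _))
          (abs_nonneg _)

end Limits

end CausalModel

/-! ### Convergence in probability and the two estimators. -/

namespace CausalModel

variable {V : Type u} [LinearOrder V] [Fintype V] {S : V → Type w} [∀ v, MeasurableSpace (S v)]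
  {T : CausalModel V S}
variable {P : Measure (∀ v, S v)} [IsProbabilityMeasure P] {Q : Nuisance V S}
variable {Ω : Type*} [MeasurableSpace Ω] {Pr : Measure Ω} {Qh : ℕ → Ω → Nuisance V S}

lemma mem_M_of_mem_Z {k : V} (hk : k ∈ T.Z) (hL : k ∉ T.L) : k ∈ T.M :=
  (mem_M_iff (mem_Z.1 hk).1).2 hL

lemma lev_ne_iff {i k : V} : T.lev i ≠ T.lev k ↔ ¬ (i ∈ T.L ↔ k ∈ T.L) := by
  have hne : T.a₀ ≠ T.a₁ := by unfold a₁; cases T.a₀ <;> simp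
  by_cases hi : i ∈ T.L <;> by_cases hk : k ∈ T.L <;>
    simp [lev_of_mem, lev_of_notMem, hi, hk, hne, hne.symm]

/-- Every disjunction pairs a nuisance of the `𝓜` side with one of the `𝓛` side, where `π` counts as
`𝓛`; a side that is entirely consistent thus settles all of them. -/
lemma DoublyRobustConditions.disjunctive (h : T.DoublyRobustConditions Pr P Q Qh) :
    T.DisjunctiveConditions Pr P Q Qh := by
  have hYM : T.Y ∉ T.L → T.Y ∈ T.M := (mem_M_iff T.A_lt_Y).2
  have hMZ : ∀ k ∈ T.M, k ≠ T.Y → k ∈ T.Z := fun k hk hkY => mem_Z.2 ⟨lt_of_mem_M hk, hkY⟩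
  rcases h with ⟨h1, h2⟩ | ⟨h1, h2, h3⟩
  · refine ⟨fun k hk i hi _ hne => ?_, fun i hi hne => ?_, fun k hk hkY => ?_,
      fun hY => Or.inl (h2 hY)⟩
    · by_cases hkL : k ∈ T.L
      · exact Or.inr (h1 i hi (mem_M_of_mem_Z hi fun hiL => lev_ne_iff.1 hne (by simp [hkL, hiL])))
      · exact Or.inl (h1 k hk (mem_M_of_mem_Z hk hkL))
    · by_cases hYL : T.Y ∈ T.L
      · exact Or.inr (h1 i hi (mem_M_of_mem_Z hi fun hiL => lev_ne_iff.1 hne (by simp [hYL, hiL])))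
      · exact Or.inl (h2 (hYM hYL))
    · exact Or.inl (h1 k (hMZ k hk hkY) hk)
  · refine ⟨fun k hk i hi _ hne => ?_, fun i hi hne => ?_, fun k hk hkY => Or.inr h3,
      fun hY => Or.inr h3⟩
    · by_cases hkL : k ∈ T.L
      · exact Or.inl (h1 k hk hkL)
      · refine Or.inr (h1 i hi ?_)
        by_contra hiL
        exact lev_ne_iff.1 hne (by simp [hkL, hiL])
    · by_cases hYL : T.Y ∈ T.L
      · exact Or.inl (h2 hYL)
      · refine Or.inr (h1 i hi ?_)
        by_contra hiL
        exact lev_ne_iff.1 hne (by simp [hYL, hiL])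

/-- The bias terms vanish in probability as soon as, for each vertex, the density ratios or the
nuisance of the vertex are consistent. -/
lemma IsTruth.tendstoInMeasure_of_weights (hQ : T.IsTruth P Q)
    (hfact : T.TopologicalFactorization P) (hpos : T.Positivity P Q) {C : ℝ} {v : V}
    (t : Nuisance V S → ℝ)
    (ht : ∀ qs : ℕ → Nuisance V S, (∀ m, T.IsBounded P C (qs m)) →
      (∀ᵐ o ∂P, Tendsto (fun m => T.R (qs m) v o) atTop (𝓝 (T.R Q v o))) →
      Tendsto (fun m => t (qs m)) atTop (𝓝 0))
    (hbd : ∀ n, ∀ᵐ ω ∂Pr, T.IsBounded P C (Qh n ω))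
    (hf : ∀ i ∈ T.Z, i < v → T.lev i ≠ T.lev v → DensityConsistent Pr P Q Qh i)
    (hpi : v ∉ T.L → T.PiConsistent Pr P Q Qh) :
    TendstoInMeasure Pr (fun n ω => t (Qh n ω)) atTop fun _ => 0 := by
  classical
  -- One finite family collects all required errors: `none` stands for the propensity score, `some
  -- i` for the density of `i`, and errors that do not enter `𝓡_v` are set to zero.
  let d : Option V → Nuisance V S → ℝ≥0∞ := fun c q => match c with
    | none => if v ∉ T.L then eLpNorm (fun o => q.pi T.a₁ o - Q.pi T.a₁ o) 2 P else 0
    | some i => if i ∈ T.Z ∧ i < v ∧ T.lev i ≠ T.lev v then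
        eLpNorm (fun o => q.f i o - Q.f i o) 2 P else 0
  have h0 : IsLittleOP Pr fun (_ : ℕ) _ => 0 := by
    intro ε hε
    simp [not_le.2 hε]
  refine tendstoInMeasure_of_seq (T.IsBounded P C) d t (fun qs hqs hd => ht qs hqs ?_) hbd ?_
  · refine hQ.ae_tendsto_R hfact hpos (fun m => (hqs m).nuisance) (fun i hi hiv hne m => ?_)
      fun hv m => ?_
    · simpa only [d, if_pos (And.intro hi (And.intro hiv hne))] using hd (some i) m
    · simpa only [d, if_pos hv] using hd none m
  · rintro (_ | i)
    · by_cases hv : v ∉ T.L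
      · simp only [d, if_pos hv]
        exact hpi hv
      · simp only [d, if_neg hv]
        exact h0
    · by_cases hi : i ∈ T.Z ∧ i < v ∧ T.lev i ≠ T.lev v
      · simp only [d, if_pos hi]
        exact hf i hi.1 hi.2.1 hi.2.2
      · simp only [d, if_neg hi]
        exact h0

/-- If the density of `k` is not consistent, the disjunctions leave no choice: all densities
entering `𝓡_k`, and `π` when `k ∈ 𝓜`, are consistent, so the weight converges. -/
lemma IsTruth.tendstoInMeasure_biasZ (hQ : T.IsTruth P Q) (hfact : T.TopologicalFactorization P)
    (hpos : T.Positivity P Q) {C : ℝ} (hbd : ∀ n, ∀ᵐ ω ∂Pr, T.IsBounded P C (Qh n ω))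
    (hdc : T.DisjunctiveConditions Pr P Q Qh) {k : V} (hk : k ∈ T.Z) :
    TendstoInMeasure Pr (fun n ω => T.biasZ P Q k (Qh n ω)) atTop fun _ => 0 := by
  by_cases hc : DensityConsistent Pr P Q Qh k
  · exact tendstoInMeasure_of_seq (ι := Unit) (T.IsBounded P C)
      (fun _ q => eLpNorm (fun o => q.f k o - Q.f k o) 2 P) (T.biasZ P Q k)
      (fun qs hqs hd => hQ.tendsto_biasZ hfact hpos hqs hk (Or.inr (hd ()))) hbd fun _ => hc
  · refine hQ.tendstoInMeasure_of_weights hfact hpos (v := k) (T.biasZ P Q k)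
      (fun qs hqs hR => hQ.tendsto_biasZ hfact hpos hqs hk (Or.inl hR)) hbd
      (fun i hi hik hne => (hdc.mediators k hk i hi hik hne).resolve_left hc) fun hL => ?_
    exact (hdc.treatment_mediators k (mem_M_of_mem_Z hk hL) (mem_Z.1 hk).2).resolve_left hc

lemma IsTruth.tendstoInMeasure_biasY (hQ : T.IsTruth P Q) (hfact : T.TopologicalFactorization P)
    (hpos : T.Positivity P Q) (hint : T.OutcomeIntegrable P Q) {C : ℝ}
    (hbd : ∀ n, ∀ᵐ ω ∂Pr, T.IsBounded P C (Qh n ω))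
    (hdc : T.DisjunctiveConditions Pr P Q Qh) :
    TendstoInMeasure Pr (fun n ω => T.biasY P Q (Qh n ω)) atTop fun _ => 0 := by
  by_cases hc : MuConsistent Pr P Q Qh
  · exact tendstoInMeasure_of_seq (ι := Unit) (T.IsBounded P C)
      (fun _ q => eLpNorm (fun o => q.mu o - Q.mu o) 2 P) (T.biasY P Q)
      (fun qs hqs hd => hQ.tendsto_biasY hfact hpos hint hqs (Or.inr (hd ()))) hbd fun _ => hc
  · refine hQ.tendstoInMeasure_of_weights hfact hpos (v := T.Y) (T.biasY P Q)
      (fun qs hqs hR => hQ.tendsto_biasY hfact hpos hint hqs (Or.inl hR)) hbd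
      (fun i hi _ hne => (hdc.outcome i hi hne).resolve_left hc) fun hL => ?_
    exact (hdc.treatment_outcome ((mem_M_iff T.A_lt_Y).2 hL)).resolve_left hc

/-- The centering constant of the influence function is the plug-in estimate itself, so it cancels;
`n ≥ 1` is needed for the mean of a constant to be that constant. -/
lemma oneStep_eq (O : ℕ → Ω → ∀ v, S v) {n : ℕ} (hn : 1 ≤ n) (ω : Ω) (q : Nuisance V S) :
    T.oneStep O n ω q = empMean O n ω (T.eifUncentered q) := by
  have hn0 : (n : ℝ) ≠ 0 := by positivity
  simp only [oneStep, empMean, eif, Finset.sum_sub_distrib, Finset.sum_const, Finset.card_range,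
    nsmul_eq_mul]
  field_simp
  ring

variable [IsProbabilityMeasure Pr]

/-- Consistency of the one-step estimator. -/
lemma IsTruth.tendstoInMeasure_oneStep (hQ : T.IsTruth P Q)
    (hfact : T.TopologicalFactorization P) (hpos : T.Positivity P Q)
    (hint : T.OutcomeIntegrable P Q) {O : ℕ → Ω → ∀ v, S v} (hOmeas : ∀ j, Measurable (O j))
    (hOindep : iIndepFun O Pr) (hOlaw : ∀ j, Pr.map (O j) = P)
    (hreg : T.RegularEstimates Pr P O Q Qh) (hdc : T.DisjunctiveConditions Pr P Q Qh) :
    TendstoInMeasure Pr (fun n ω => T.oneStep O n ω (Qh n ω)) atTop fun _ => T.psi P Q := by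
  obtain ⟨C, hC⟩ := hreg.bounded
  have hbd : ∀ n, ∀ᵐ ω ∂Pr, T.IsBounded P C (Qh n ω) := fun n => by
    filter_upwards [hreg.nuisance n, hC n] with ω h1 h2
    exact ⟨h1, h2.1, h2.2⟩
  obtain ⟨F, hF, hmem⟩ := hreg.complexity
  obtain ⟨iQ, eQ, _⟩ := hQ.integral_eif hfact hpos hint
  have hGC := hF.tendstoInMeasure hOmeas hOindep hOlaw hmem
  have hLLN := tendstoInMeasure_empMean hOmeas hOindep hOlaw
    hQ.nuisance.measurable_eifUncentered iQ
  rw [eQ] at hLLN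
  have hLLN' : TendstoInMeasure Pr
      (fun n ω => empMean O n ω (T.eifUncentered Q) - T.psi P Q) atTop fun _ => 0 :=
    tendstoInMeasure_of_abs_sub_le hLLN
      (Eventually.of_forall fun n => ae_of_all _ fun ω => by rw [sub_zero])
  have hbias := tendstoInMeasure_zero_add (hQ.tendstoInMeasure_biasY hfact hpos hint hbd hdc)
    (tendstoInMeasure_zero_sum T.Z fun k hk => hQ.tendstoInMeasure_biasZ hfact hpos hbd hdc hk)
  -- The error equals `(P_n - P)(Φ(Q̂) - Φ(Q)) + (P_n - P) Φ(Q)` plus the bias. The random centering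
  -- of `Φ(Q̂)` cancels in the first term.
  refine tendstoInMeasure_of_abs_sub_le
    (tendstoInMeasure_zero_add (tendstoInMeasure_zero_add hGC hLLN') hbias) ?_
  filter_upwards [eventually_ge_atTop 1] with n hn
  filter_upwards [hbd n] with ω hω
  obtain ⟨iq, eq⟩ := hQ.integral_eif_eq hfact hpos hint hω
  refine le_of_eq (congrArg abs ?_)
  rw [oneStep_eq O hn, sub_zero]
  set c := T.plugIn O n ω (Qh n ω)
  have e1 : ∫ o, (T.eif (Qh n ω) c o - T.eif Q (T.psi P Q) o) ∂P =
      (∫ o, T.eifUncentered (Qh n ω) o ∂P - c) - (T.psi P Q - T.psi P Q) := by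
    simp only [eif]
    have j1 : Integrable (fun o => T.eifUncentered (Qh n ω) o - c) P :=
      iq.sub (integrable_const c)
    have j2 : Integrable (fun o => T.eifUncentered Q o - T.psi P Q) P :=
      iQ.sub (integrable_const _)
    rw [integral_sub j1 j2, integral_sub iq (integrable_const c),
      integral_sub iQ (integrable_const _), eQ]
    simp
  have e2 : empMean O n ω (fun o => T.eif (Qh n ω) c o - T.eif Q (T.psi P Q) o) =
      (empMean O n ω (T.eifUncentered (Qh n ω)) - c) -
        (empMean O n ω (T.eifUncentered Q) - T.psi P Q) := by
    have hn0 : (n : ℝ) ≠ 0 := by positivity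
    simp only [empMean, eif, Finset.sum_sub_distrib, Finset.sum_const, Finset.card_range,
      nsmul_eq_mul]
    field_simp
  rw [e1, e2, eq]
  simp only [biasY, biasZ]
  ring

/-- Consistency of the plug-in estimator at targeted nuisances. -/
lemma IsTruth.tendstoInMeasure_plugIn (hQ : T.IsTruth P Q)
    (hfact : T.TopologicalFactorization P) (hpos : T.Positivity P Q)
    (hint : T.OutcomeIntegrable P Q) {O : ℕ → Ω → ∀ v, S v} (hOmeas : ∀ j, Measurable (O j))
    (hOindep : iIndepFun O Pr) (hOlaw : ∀ j, Pr.map (O j) = P)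
    (hreg : T.RegularEstimates Pr P O Q Qh) (htar : T.Targeted Pr O Qh)
    (hdc : T.DisjunctiveConditions Pr P Q Qh) :
    TendstoInMeasure Pr (fun n ω => T.plugIn O n ω (Qh n ω)) atTop fun _ => T.psi P Q := by
  have h1 := hQ.tendstoInMeasure_oneStep hfact hpos hint hOmeas hOindep hOlaw hreg hdc
  have h1' : TendstoInMeasure Pr (fun n ω => T.oneStep O n ω (Qh n ω) - T.psi P Q) atTop
      fun _ => 0 :=
    tendstoInMeasure_of_abs_sub_le h1
      (Eventually.of_forall fun n => ae_of_all _ fun ω => by rw [sub_zero])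
  have h2 : TendstoInMeasure Pr (fun n ω =>
      -empMean O n ω (T.eif (Qh n ω) (T.plugIn O n ω (Qh n ω)))) atTop fun _ => 0 := by
    -- For `n ≥ 1` the factor `√n` is at least one, so the targeting condition implies that `P_n
    -- Φ(Q̂*)` itself vanishes.
    refine tendstoInMeasure_of_abs_sub_le htar ?_
    filter_upwards [eventually_ge_atTop 1] with n hn
    refine ae_of_all _ fun ω => ?_
    rw [sub_zero, sub_zero, abs_neg, abs_mul, abs_of_nonneg (Real.sqrt_nonneg _)]
    refine le_mul_of_one_le_left (abs_nonneg _) ?_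
    rw [Real.one_le_sqrt]
    exact_mod_cast hn
  refine tendstoInMeasure_of_abs_sub_le (tendstoInMeasure_zero_add h1' h2)
    (Eventually.of_forall fun n => ae_of_all _ fun ω => le_of_eq (congrArg abs ?_))
  rw [oneStep]
  ring

end CausalModel

theorem mainTheorem9 {V : Type u} [LinearOrder V] [Fintype V] {S : V → Type w}
    [∀ v, MeasurableSpace (S v)] (T : CausalModel V S)
    (P : Measure (∀ v, S v)) [IsProbabilityMeasure P]
    (Q : Nuisance V S) (hfact : T.TopologicalFactorization P) (hQ : T.IsTruth P Q)
    (hpos : T.Positivity P Q) (hint : T.OutcomeIntegrable P Q)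
    {Ω : Type*} [MeasurableSpace Ω] (Pr : Measure Ω) [IsProbabilityMeasure Pr]
    (O : ℕ → Ω → ∀ v, S v) (hOmeas : ∀ j, Measurable (O j)) (hOindep : iIndepFun O Pr)
    (hOlaw : ∀ j, Pr.map (O j) = P) :
    -- the one-step estimator
    (∀ Qhat : ℕ → Ω → Nuisance V S, T.RegularEstimates Pr P O Q Qhat →
      (T.DisjunctiveConditions Pr P Q Qhat →
        TendstoInMeasure Pr (fun n ω => T.oneStep O n ω (Qhat n ω)) atTop
          (fun _ => T.psi P Q)) ∧
      (T.DoublyRobustConditions Pr P Q Qhat →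
        TendstoInMeasure Pr (fun n ω => T.oneStep O n ω (Qhat n ω)) atTop
          (fun _ => T.psi P Q))) ∧
    -- the TMLE
    (∀ Qstar : ℕ → Ω → Nuisance V S, T.RegularEstimates Pr P O Q Qstar →
      T.Targeted Pr O Qstar →
      (T.DisjunctiveConditions Pr P Q Qstar →
        TendstoInMeasure Pr (fun n ω => T.plugIn O n ω (Qstar n ω)) atTop
          (fun _ => T.psi P Q)) ∧
      (T.DoublyRobustConditions Pr P Q Qstar →
        TendstoInMeasure Pr (fun n ω => T.plugIn O n ω (Qstar n ω)) atTop
          (fun _ => T.psi P Q))) := by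

  have h1 := fun (Qh : ℕ → Ω → Nuisance V S) (hreg : T.RegularEstimates Pr P O Q Qh)
      (hdc : T.DisjunctiveConditions Pr P Q Qh) =>
    hQ.tendstoInMeasure_oneStep hfact hpos hint hOmeas hOindep hOlaw hreg hdc
  have h2 := fun (Qh : ℕ → Ω → Nuisance V S) (hreg : T.RegularEstimates Pr P O Q Qh)
      (htar : T.Targeted Pr O Qh) (hdc : T.DisjunctiveConditions Pr P Q Qh) =>
    hQ.tendstoInMeasure_plugIn hfact hpos hint hOmeas hOindep hOlaw hreg htar hdc
  exact ⟨fun Qh hreg => ⟨h1 Qh hreg, fun hdr => h1 Qh hreg hdr.disjunctive⟩,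
    fun Qh hreg htar => ⟨h2 Qh hreg htar, fun hdr => h2 Qh hreg htar hdr.disjunctive⟩⟩
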